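/- Let $d\ge 1$, let $\gamma_d(dx)=\pi^{-d/2}e^{-|x|^2}\,dx$ on $\mathbb{R}^d$, let $L=\frac12\Delta-\langle x,\nabla\rangle$, and let $T_tf(x)=\int f\big(\sqrt{1-e^{-2t}}\,u+e^{-t}x\big)\,\gamma_d(du)$ and $P_tf(x)=\frac1{\sqrt\pi}\int_0^\infty\frac{e^{-u}}{\sqrt u}\,T_{t^2/4u}f(x)\,du$ be the Ornstein–Uhlenbeck and Poisson–Hermite semigroups. For a measure $\mu$ and a finite measurable exponent $p(\cdot)$, put $\|f\|_{p(\cdot),\mu}=\inf\{\lambda>0:\int|f/\lambda|^{p(x)}\,d\mu\le1\}$, let $L^{p(\cdot)}(\mu)$ be the set of measurable $f$ with $\int|f/\lambda|^{p(x)}\,d\mu<\infty$ for some $\lambda>0$, and let $p_-$, $p_+$ be the essential infimum and supremum of $p(\cdot)$. Let $0<\beta<\alpha$. Let $p(\cdot):\mathbb{R}^d\to[1,\infty)$ be measurable with $1<p_-\le p_+<\infty$, such that for some $C>0$ and $p_\infty\ge1$ one has $|p(x)-p_\infty|\le C/|x|^2$ for all $x\ne0$ (that is, $p(\cdot)\in\mathcal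 P^\infty_{\gamma_d}$) and $|p(x)-p(y)|\le C/\log(e+1/|x-y|)$ for all $x\neq y$ (that is, $p(\cdot)\in LH_0$). Let $q(\cdot):(0,\infty)\to(0,\infty)$ be in $\mathcal P_{0,\infty}$: it is measurable, $1\le q_-\le q_+<\infty$, the limits $q(0)=\lim_{t\to0^+}q(t)$ and $q(\infty)=\lim_{t\to\infty}q(t)$ exist and are finite, and for some $A$ one has $|q(t)-q(0)|\le A/\ln(1/t)$ for $0<t\le\frac12$ and $|q(t)-q(\infty)|\le A/\ln t$ for $t>2$. For $a\ge0$ let $k$ be the smallest integer greater than $a$, and let $B^a_{p(\cdot),q(\cdot)}(\gamma_d)$ be the set of $f\in L^{p(\cdot)}(\gamma_d)$ for which $$\|f\|_{B^a_{p(\cdot),q(\cdot)}}=\|f\|_{p(\cdot),\gamma_d}+\Big\|t^{k-a}\big\|\tfrac{\partial^k}{\partial t^k}P_tf\big\|_{p(\cdot),\gamma_d}\Big\|_{q(\cdot),\,dt/t}$$ is finite. Let the Gaussian Bessel fractional derivative $\mathcal D^\beta=(I+\sqrt{-L})^\beta$ be given by $$\mathcal D^\beta f=\frac1{c_\beta}\int_0^\infty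 t^{-\beta-1}(e^{-t}P_t-I)^kf\,dt,\qquad c_\beta=\int_0^\infty u^{-\beta-1}(e^{-u}-1)^k\,du,$$ where $k$ is the smallest integer greater than $\beta$. Then $\mathcal D^\beta$ is bounded from $B^\alpha_{p(\cdot),q(\cdot)}(\gamma_d)$ into $B^{\alpha-\beta}_{p(\cdot),q(\cdot)}(\gamma_d)$: there is a constant $C$, depending only on $d,\alpha,\beta,p(\cdot),q(\cdot)$, such that for every $f\in B^\alpha_{p(\cdot),q(\cdot)}(\gamma_d)$ the integral defining $\mathcal D^\beta f(x)$ converges absolutely for almost every $x$; $\mathcal D^\beta f$ acts on Hermite expansions as $(I+\sqrt{-L})^\beta$, i.e. $\int \mathcal D^\beta f\,h_\nu\,d\gamma_d=(1+\sqrt{|\nu|})^\beta\int f\,h_\nu\,d\gamma_d$ for every multi-index $\nu$, where $h_\nu$ is the Hermite polynomial of order $\nu$ normalized in $L^2(\gamma_d)$; $\mathcal D^\beta f\in B^{\alpha-\beta}_{p(\cdot),q(\cdot)}(\gamma_d)$; and $$\|\mathcal D^\beta f\|_{B^{\alpha-\beta}_{p(\cdot),q(\cdot)}}\le C\,\|f\|_{B^\alpha_{p(\cdot),q(\cdot)}}.$$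 -/

import Mathlib

open MeasureTheory Filter Topology
open scoped ENNReal NNReal

noncomputable section

namespace GaussianBesov

/-- `ℝ^d` with the Euclidean norm. -/
abbrev E (d : ℕ) : Type := EuclideanSpace ℝ (Fin d)

/-- The Gaussian measure `γ_d(dx) = π^{-d/2} e^{-|x|²} dx`. -/
def gauss (d : ℕ) : Measure (E d) :=
  (volume : Measure (E d)).withDensity
    (fun x => ENNReal.ofReal (Real.exp (-‖x‖ ^ 2) / Real.pi ^ ((d : ℝ) / 2)))

/-- The measure `dt / t` on `(0, ∞)`. -/
def haarPos : Measure ℝ :=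
  (volume.restrict (Set.Ioi (0 : ℝ))).withDensity (fun t => ENNReal.ofReal (1 / t))

/-! ### Hermite polynomials -/

/-- The Hermite polynomial of order `ν`, normalized in `L²(γ_d)`:
`h_ν(x) = (2^{|ν|} ν!)^{-1/2} ∏ᵢ (-1)^{νᵢ} e^{xᵢ²} ∂^{νᵢ} (e^{-xᵢ²})`. -/
def hermiteH {d : ℕ} (ν : Fin d → ℕ) (x : E d) : ℝ :=
  1 / Real.sqrt (2 ^ (∑ i, ν i) * ∏ i, ((ν i).factorial : ℝ)) *
    ∏ i, ((-1) ^ (ν i) * Real.exp (x i ^ 2) *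
      iteratedDeriv (ν i) (fun s : ℝ => Real.exp (-s ^ 2)) (x i))

/-- The Fourier-Hermite coefficient of `f`. -/
def hermiteCoeff {d : ℕ} (f : E d → ℝ) (ν : Fin d → ℕ) : ℝ :=
  ∫ x, f x * hermiteH ν x ∂(gauss d)

/-! ### The Ornstein-Uhlenbeck and Poisson-Hermite semigroups -/

/-- `T_t f(x) = ∫ f(√(1 - e^{-2t}) u + e^{-t} x) γ_d(du)`. -/
def ouSemigroup {d : ℕ} (t : ℝ) (f : E d → ℝ) (x : E d) : ℝ :=
  ∫ u, f (Real.sqrt (1 - Real.exp (-2 * t)) • u + Real.exp (-t) • x) ∂(gauss d)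

/-- `P_t f(x) = π^{-1/2} ∫_0^∞ e^{-u} u^{-1/2} T_{t²/(4u)} f(x) du`. -/
def poisson {d : ℕ} (t : ℝ) (f : E d → ℝ) (x : E d) : ℝ :=
  1 / Real.sqrt Real.pi *
    ∫ u in Set.Ioi (0 : ℝ),
      Real.exp (-u) / Real.sqrt u * ouSemigroup (t ^ 2 / (4 * u)) f x

/-- The `k`-th derivative in time, `∂^k P_t f(x) / ∂t^k`. -/
def poissonDeriv {d : ℕ} (k : ℕ) (t : ℝ) (f : E d → ℝ) (x : E d) : ℝ :=
  iteratedDeriv k (fun s : ℝ => poisson s f x) t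

/-! ### Variable exponents and variable Lebesgue spaces -/

section Exponents

variable {X : Type*} [MeasurableSpace X]

/-- `p_-`, the essential infimum of the exponent, in the extended reals. -/
def expInf (μ : Measure X) (p : X → ℝ) : EReal := essInf (fun x => (p x : EReal)) μ

/-- `p_+`, the essential supremum of the exponent, in the extended reals. -/
def expSup (μ : Measure X) (p : X → ℝ) : EReal := essSup (fun x => (p x : EReal)) μ

/-- The modular `∫ f(x)^{p(x)} μ(dx)` of a function with values in `[0, ∞]`
(finite-valued exponent `p`). -/
def modular (μ : Measure X) (p : X → ℝ) (f : X → ℝ≥0∞) : ℝ≥0∞ :=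
  ∫⁻ x, f x ^ p x ∂μ

/-- The Luxemburg norm `inf {c > 0 : ρ(f / c) ≤ 1}`, equal to `∞` if there is no such `c`. -/
def luxNorm (μ : Measure X) (p : X → ℝ) (f : X → ℝ≥0∞) : ℝ≥0∞ :=
  sInf {c : ℝ≥0∞ | 0 < c ∧ c < ⊤ ∧ modular μ p (fun x => f x / c) ≤ 1}

/-- The norm of the variable Lebesgue space `L^{p(·)}(μ)`. -/
def varLpNorm (μ : Measure X) (p : X → ℝ) (f : X → ℝ) : ℝ≥0∞ :=
  luxNorm μ p (fun x => ‖f x‖ₑ)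

/-- Membership in `L^{p(·)}(μ)`. -/
def MemVarLp (μ : Measure X) (p : X → ℝ) (f : X → ℝ) : Prop :=
  AEMeasurable f μ ∧
    ∃ c : ℝ≥0∞, 0 < c ∧ c < ⊤ ∧ modular μ p (fun x => ‖f x‖ₑ / c) < ⊤

end Exponents

/-- Local log-Hölder continuity on `ℝ^d`. -/
def LocLogHolder {d : ℕ} (a : E d → ℝ) : Prop :=
  ∃ C > (0 : ℝ), ∀ x y : E d, x ≠ y →
    |a x - a y| ≤ C / Real.log (Real.exp 1 + 1 / ‖x - y‖)

/-- The class `𝒫^∞_{γ_d}`: measurable exponents `p(·) ≥ 1` with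
`|p(x) - p_∞| ≤ C / |x|²` for `x ≠ 0`. -/
def GaussExponent {d : ℕ} (p : E d → ℝ) : Prop :=
  AEMeasurable p (gauss d) ∧ (∀ x, 1 ≤ p x) ∧
    ∃ C > (0 : ℝ), ∃ pinf ≥ (1 : ℝ), ∀ x : E d, x ≠ 0 → |p x - pinf| ≤ C / ‖x‖ ^ 2

/-- The class `𝒫_{0,∞}` of exponents on `(0, ∞)`; the values of `q` outside `(0, ∞)` are
irrelevant. -/
structure ExponentZeroInfty (q : ℝ → ℝ) : Prop where
  aemeasurable : AEMeasurable q (volume.restrict (Set.Ioi (0 : ℝ)))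
  pos : ∀ t > 0, 0 < q t
  one_le_inf : 1 ≤ expInf (volume.restrict (Set.Ioi (0 : ℝ))) q
  sup_lt_top : expSup (volume.restrict (Set.Ioi (0 : ℝ))) q < ⊤
  at_zero : ∃ q0 : ℝ, Tendsto q (𝓝[>] 0) (𝓝 q0) ∧
    ∃ A : ℝ, ∀ t, 0 < t → t ≤ 1 / 2 → |q t - q0| ≤ A / Real.log (1 / t)
  at_infty : ∃ qinf : ℝ, Tendsto q atTop (𝓝 qinf) ∧
    ∃ A : ℝ, ∀ t, 2 < t → |q t - qinf| ≤ A / Real.log t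

/-! ### Variable Gaussian Besov-Lipschitz spaces -/

/-- The smallest integer greater than `a`, for `a ≥ 0`. -/
def nextInt (a : ℝ) : ℕ := ⌊a⌋₊ + 1

/-- `‖ t^{k-α} ‖∂_t^k P_t f‖_{p(·),γ_d} ‖_{q(·),dt/t}`, with `k` the smallest integer
greater than `α`. -/
def besovSeminorm {d : ℕ} (α : ℝ) (p : E d → ℝ) (q : ℝ → ℝ) (f : E d → ℝ) : ℝ≥0∞ :=
  luxNorm haarPos q (fun t =>
    ENNReal.ofReal (t ^ ((nextInt α : ℝ) - α)) *
      varLpNorm (gauss d) p (poissonDeriv (nextInt α) t f))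

/-- Membership in `B^α_{p(·),q(·)}(γ_d)`. -/
def MemBesov {d : ℕ} (α : ℝ) (p : E d → ℝ) (q : ℝ → ℝ) (f : E d → ℝ) : Prop :=
  MemVarLp (gauss d) p f ∧ besovSeminorm α p q f < ⊤

/-- The norm of `B^α_{p(·),q(·)}(γ_d)`. -/
def besovNorm {d : ℕ} (α : ℝ) (p : E d → ℝ) (q : ℝ → ℝ) (f : E d → ℝ) : ℝ≥0∞ :=
  varLpNorm (gauss d) p f + besovSeminorm α p q f

/-! ### The Gaussian Bessel fractional derivative -/

/-- The operator `e^{-t} P_t - I`. -/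
def besselDiff {d : ℕ} (t : ℝ) (f : E d → ℝ) : E d → ℝ :=
  fun x => Real.exp (-t) * poisson t f x - f x

/-- `t^{-β-1} (e^{-t} P_t - I)^k f(x)`, with `k` the smallest integer greater than `β`. -/
def besselIntegrand {d : ℕ} (β : ℝ) (f : E d → ℝ) (x : E d) (t : ℝ) : ℝ :=
  t ^ (-β - 1) * (besselDiff t)^[nextInt β] f x

/-- `c_β = ∫_0^∞ u^{-β-1} (e^{-u} - 1)^k du`, with `k` the smallest integer greater than `β`. -/
def besselConst (β : ℝ) : ℝ :=
  ∫ u in Set.Ioi (0 : ℝ), u ^ (-β - 1) * (Real.exp (-u) - 1) ^ nextInt β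

/-- `𝒟^β f(x) = c_β^{-1} ∫_0^∞ t^{-β-1} (e^{-t} P_t - I)^k f(x) dt`. -/
def besselDeriv {d : ℕ} (β : ℝ) (f : E d → ℝ) (x : E d) : ℝ :=
  1 / besselConst β * ∫ t in Set.Ioi (0 : ℝ), besselIntegrand β f x t

end GaussianBesov

end

open GaussianBesov

/-! Write `φ(r) = e^{-r} P_r f`. By the semigroup law, `e^{-s} P_s` shifts this path by `s`, so
`(e^{-s} P_s - I)^k f` is the `k`-th forward difference of `φ` with step `s` at `0`. Applying `∂_t^l
P_t` moves the base point from `0` to `t`: up to the factor `e^t` it gives the `k`-th difference at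
`t` of the smooth path `r ↦ e^{-r} ∂_r^l P_r f`.

For steps `s < 1` the difference is bounded by `∫ ρ^{k-1} |ψ^{(k)}(t+ρ)| dρ` over `0 < ρ < ks`,
where `ψ` is that path, and integrating against `s^{-β-1} ds` leaves `∫_0^k ρ^{k-β-1} |ψ^{(k)}(t+ρ)|
dρ`. For large steps the uniform boundedness of the semigroup suffices
(`lintegral_rpow_mul_fwdDiff_le`, `luxNorm_lintegral_fwdDiff_tail_le`). Minkowski's inequality
reduces everything to `‖∂^j P_{t+ρ} f‖_{p(·)}`. Orders `j` below the one in the `B^α` norm grow at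
most like `t^{-ε}`, and higher orders are controlled by the profile `r^{k_α-α} ‖∂^{k_α} P_r f‖`,
where `k_α = nextInt α`. With `a = l - (α-β)` and `b = k - β`, the substitution `ρ = tθ` turns the
main term into an average of the profile at `t(1+θ)` with weight `θ^{b-1} (1+θ)^{-(a+b)}`,
integrable because `a, b > 0`. Jensen's inequality and the dilation invariance of `dt/t` give a
Hardy inequality for a constant exponent (`lintegral_haarPos_rpow_average_le`). The variable `q` is
replaced by `q(0)` on `(0, 1/2]`: for values at most `1`, log-Hölder continuity at zero makes this
cost a constant factor and an error `t`, which is integrable for `dt/t`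
(`rpow_le_exp_mul_rpow_add`). For `t > 1/2` the decay `t^{-(α-β)}` comes from the `L^{p(·)}` bound
of the fractional derivative alone.

Behind this lie two facts on the semigroups. First, `T_σ` is bounded on `L^{p(·)}(γ_d)` uniformly in
`σ` (`exists_luxNorm_ouPos_le`). A function of modular at most `1` is cut at the heights `1` and
`e^{A|y|²}`. On the middle part `|x|² |p(x) - p_∞| ≤ C` makes `p(·)` interchangeable with `p_∞`. The
top part is integrable against `e^{2|y|²} dγ_d`, where the Mehler kernel is small away from the
diagonal, and log-Hölder continuity of `p` handles the diagonal. Second, `P_t` averages `T_σ`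
against the stable density of order `1/2`. Each `t`-derivative of this density costs `t^{-1}`
(`exists_subKer_le`), and the densities convolve by their Laplace transform `e^{-t√λ}`, which yields
`∂^l P_t ∂^j P_s = ∂^{l+j} P_{t+s}` (`poissonD_poissonD`).

The action on Hermite coefficients follows from symmetry of `T_σ` and Fubini: the multiplier of
`(e^{-s} P_s - I)^k` is `(e^{-sc} - 1)^k` with `c = 1 + √|ν|`, and scaling the integral in `s`
produces `c^β c_β`. -/

namespace GaussianBesov

/-! ### The Luxemburg norm -/

section Luxemburg

variable {X : Type*} [MeasurableSpace X] {μ : Measure X} {p : X → ℝ}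

/-- Jensen's inequality for powers, for measures of finite mass. -/
theorem lintegral_rpow_le_mass {α : Type*} [MeasurableSpace α] (ν : Measure α) {s : ℝ}
    (hs : 1 ≤ s) {f : α → ℝ≥0∞} (hf : AEMeasurable f ν) :
    (∫⁻ x, f x ∂ν) ^ s ≤ ν Set.univ ^ (s - 1) * ∫⁻ x, f x ^ s ∂ν := by
  rcases hs.eq_or_lt with rfl | hs
  · simp
  have hc := Real.HolderConjugate.conjExponent hs
  have h := ENNReal.lintegral_mul_le_Lp_mul_Lq ν hc hf (g := fun _ => 1) aemeasurable_const
  simp only [Pi.mul_apply, mul_one, ENNReal.one_rpow, lintegral_const, one_mul] at h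
  have h2 := ENNReal.rpow_le_rpow h (by linarith : 0 ≤ s)
  rw [ENNReal.mul_rpow_of_nonneg _ _ (by linarith), ← ENNReal.rpow_mul, ← ENNReal.rpow_mul,
    one_div_mul_cancel (by linarith), ENNReal.rpow_one, mul_comm] at h2
  convert h2 using 3
  rw [Real.conjExponent]
  have : s - 1 ≠ 0 := by linarith
  field_simp

theorem lintegral_rpow_le_of_mass_le_one {α : Type*} [MeasurableSpace α] (ν : Measure α) {s : ℝ}
    (hs : 1 ≤ s) (hν : ν Set.univ ≤ 1) {f : α → ℝ≥0∞} (hf : AEMeasurable f ν) :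
    (∫⁻ x, f x ∂ν) ^ s ≤ ∫⁻ x, f x ^ s ∂ν := by
  refine (lintegral_rpow_le_mass ν hs hf).trans ?_
  calc _ ≤ (1 : ℝ≥0∞) ^ (s - 1) * ∫⁻ x, f x ^ s ∂ν := by
        gcongr
    _ = _ := by simp

theorem modular_mono (hp : ∀ᵐ x ∂μ, 1 ≤ p x) {F G : X → ℝ≥0∞} (h : ∀ᵐ x ∂μ, F x ≤ G x) :
    modular μ p F ≤ modular μ p G := by
  refine lintegral_mono_ae ?_
  filter_upwards [hp, h] with x hx hFG
  exact ENNReal.rpow_le_rpow hFG (by linarith)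

theorem luxNorm_le_of_modular_le {F : X → ℝ≥0∞} {c : ℝ≥0∞} (h0 : 0 < c) (hc : c < ⊤)
    (h : modular μ p (fun x => F x / c) ≤ 1) : luxNorm μ p F ≤ c :=
  sInf_le ⟨h0, hc, h⟩

theorem modular_le_of_luxNorm_lt (hp : ∀ᵐ x ∂μ, 1 ≤ p x) {F : X → ℝ≥0∞} {c : ℝ≥0∞}
    (h : luxNorm μ p F < c) : modular μ p (fun x => F x / c) ≤ 1 := by
  obtain ⟨b, ⟨_, _, hb⟩, hbc⟩ := sInf_lt_iff.1 h
  exact (modular_mono hp (.of_forall fun x => ENNReal.div_le_div_left hbc.le _)).trans hb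

theorem luxNorm_mono (hp : ∀ᵐ x ∂μ, 1 ≤ p x) {F G : X → ℝ≥0∞} (h : ∀ᵐ x ∂μ, F x ≤ G x) :
    luxNorm μ p F ≤ luxNorm μ p G := by
  refine sInf_le_sInf fun c ⟨h0, hc, hm⟩ => ⟨h0, hc, (modular_mono hp ?_).trans hm⟩
  filter_upwards [h] with x hx
  exact ENNReal.div_le_div_right hx _

theorem luxNorm_congr {F G : X → ℝ≥0∞} (h : F =ᵐ[μ] G) : luxNorm μ p F = luxNorm μ p G := by
  have : ∀ c : ℝ≥0∞, modular μ p (fun x => F x / c) = modular μ p (fun x => G x / c) := by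
    intro c
    refine lintegral_congr_ae ?_
    filter_upwards [h] with x hx
    rw [hx]
  simp only [luxNorm, this]

/-- Since `p ≥ 1` and `C ≥ 1`, dividing by `C` shrinks the modular at least by the factor `C⁻¹`.
This turns modular estimates into norm estimates. -/
theorem luxNorm_le_of_modular_le_const (hp : ∀ᵐ x ∂μ, 1 ≤ p x) {F : X → ℝ≥0∞} {C : ℝ≥0∞}
    (hC : 1 ≤ C) (hC' : C ≠ ⊤) (h : modular μ p F ≤ C) : luxNorm μ p F ≤ C := by
  refine luxNorm_le_of_modular_le (by positivity) hC'.lt_top ?_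
  have h0 : C ≠ 0 := by positivity
  calc modular μ p (fun x => F x / C) ≤ ∫⁻ x, C⁻¹ * F x ^ p x ∂μ := by
        refine lintegral_mono_ae ?_
        filter_upwards [hp] with x hx
        rw [ENNReal.div_eq_inv_mul, ENNReal.mul_rpow_of_nonneg _ _ (by linarith)]
        gcongr
        exact ENNReal.rpow_le_self_of_le_one (ENNReal.inv_le_one.2 hC) hx
    _ = C⁻¹ * modular μ p F := lintegral_const_mul' _ _ (ENNReal.inv_ne_top.2 h0)
    _ ≤ C⁻¹ * C := by gcongr
    _ = 1 := ENNReal.inv_mul_cancel h0 hC'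

theorem luxNorm_zero (hp : ∀ᵐ x ∂μ, 1 ≤ p x) : luxNorm μ p (fun _ => 0) = 0 := by
  refine le_antisymm (le_of_forall_gt_imp_ge_of_dense fun c hc => ?_) bot_le
  rcases eq_or_ne c ⊤ with rfl | hc'
  · exact le_top
  refine luxNorm_le_of_modular_le hc hc'.lt_top ?_
  have : modular μ p (fun _ => 0 / c) = ∫⁻ _, 0 ∂μ := by
    refine lintegral_congr_ae ?_
    filter_upwards [hp] with x hx
    rw [ENNReal.zero_div, ENNReal.zero_rpow_of_pos (by linarith)]
  rw [this]
  simp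

/-- A bound valid at each admissible scale passes to the infimum. The factor must be invertible in
`ℝ≥0∞`, hence `a ≠ 0` and `a ≠ ⊤`. -/
theorem le_mul_luxNorm {F : X → ℝ≥0∞} {a y : ℝ≥0∞} (h0 : a ≠ 0) (ha : a ≠ ⊤)
    (h : ∀ c : ℝ≥0∞, 0 < c → c < ⊤ → modular μ p (fun x => F x / c) ≤ 1 → y ≤ a * c) :
    y ≤ a * luxNorm μ p F := by
  rw [mul_comm, ← ENNReal.div_le_iff_le_mul (Or.inl h0) (Or.inl ha)]
  refine le_sInf fun c ⟨hc0, hc, hm⟩ => ?_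
  rw [ENNReal.div_le_iff_le_mul (Or.inl h0) (Or.inl ha), mul_comm]
  exact h c hc0 hc hm

theorem luxNorm_const_mul_le (hp : ∀ᵐ x ∂μ, 1 ≤ p x) (F : X → ℝ≥0∞) {a : ℝ≥0∞} (ha : a ≠ ⊤) :
    luxNorm μ p (fun x => a * F x) ≤ a * luxNorm μ p F := by
  rcases eq_or_ne a 0 with rfl | h0
  · simp [luxNorm_zero hp]
  refine le_mul_luxNorm h0 ha fun c hc0 hc hm => ?_
  refine luxNorm_le_of_modular_le (ENNReal.mul_pos h0 hc0.ne') (ENNReal.mul_lt_top ha.lt_top hc) ?_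
  simpa only [ENNReal.mul_div_mul_left _ _ h0 ha] using hm

/-- Minkowski's integral inequality for the Luxemburg norm. -/
theorem luxNorm_lintegral_le [SFinite μ] (hpm : Measurable p) (hp : ∀ᵐ x ∂μ, 1 ≤ p x)
    {α : Type*} [MeasurableSpace α] (ν : Measure α) [SigmaFinite ν] {F : α → X → ℝ≥0∞}
    (hF : Measurable (Function.uncurry F)) {B : α → ℝ≥0∞} (hB : AEMeasurable B ν)
    (h : ∀ᵐ s ∂ν, luxNorm μ p (F s) ≤ B s) :
    luxNorm μ p (fun x => ∫⁻ s, F s x ∂ν) ≤ ∫⁻ s, B s ∂ν := by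
  rcases eq_or_ne (∫⁻ s, B s ∂ν) ⊤ with hT | hT
  · rw [hT]; exact le_top
  refine ENNReal.le_of_forall_pos_le_add fun ε hε _ => ?_
  rcases eq_or_ne ν 0 with rfl | hν
  · simp [luxNorm_zero hp]
  -- A strictly positive `g` of integral below `ε` is added to the bound. Then `lam s` exceeds the
  -- norm of `F s` strictly, so the modular at scale `lam s` is at most `1` although the infimum
  -- need not be attained, and no division by zero occurs.
  obtain ⟨g, hg0, hgm, hg⟩ := exists_pos_lintegral_lt_of_sigmaFinite ν
    (ENNReal.coe_ne_zero.2 hε.ne')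
  obtain ⟨B', hB'm, hBB'⟩ := hB
  set lam : α → ℝ≥0∞ := fun s => B' s + g s with hlam
  have hlm : Measurable lam := hB'm.add hgm.coe_nnreal_ennreal
  set L := ∫⁻ s, lam s ∂ν with hL
  have hLe : L = ∫⁻ s, B s ∂ν + ∫⁻ s, (g s : ℝ≥0∞) ∂ν := by
    rw [hL, hlam, lintegral_add_left hB'm, lintegral_congr_ae hBB']
  have hLT : L ≠ ⊤ := by rw [hLe]; exact ENNReal.add_ne_top.2 ⟨hT, (hg.trans ENNReal.coe_lt_top).ne⟩
  have hlpos : ∀ s, lam s ≠ 0 := fun s => by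
    simp only [hlam]
    exact ((ENNReal.coe_pos.2 (hg0 s)).trans_le le_add_self).ne'
  have hL0 : L ≠ 0 := by
    rw [hL, Ne, lintegral_eq_zero_iff hlm]
    intro h0
    obtain ⟨s, hs⟩ := @Filter.Eventually.exists _ _ _ (ae_neBot.2 hν) h0
    exact hlpos s hs
  have hlT : ∀ᵐ s ∂ν, lam s ≠ ⊤ := by
    filter_upwards [ae_lt_top hlm hLT] with s hs using hs.ne
  have hmod : ∀ᵐ s ∂ν, modular μ p (fun x => F s x / lam s) ≤ 1 := by
    filter_upwards [h, hlT, hBB'] with s hs hsT hsB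
    refine modular_le_of_luxNorm_lt hp (hs.trans_lt ?_)
    simp only [hlam, ← hsB] at hsT ⊢
    exact ENNReal.lt_add_right (fun h => hsT (by simp [h])) (by simpa using (hg0 s).ne')
  refine le_trans (luxNorm_le_of_modular_le (pos_iff_ne_zero.2 hL0) hLT.lt_top ?_)
    (hLe.le.trans (by gcongr))
  -- The integral of `F` divided by `L` is the average of `F s / lam s` against `κ`, of mass at most
  -- `1`. Jensen at each `x` with exponent `p x`, then Tonelli, leaves an average of modulars, each
  -- at most `1`.
  set κ := ν.withDensity (fun s => lam s / L) with hκ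
  have hκm : Measurable fun s => lam s / L := hlm.div_const _
  have hκ1 : κ Set.univ ≤ 1 := by
    rw [hκ, withDensity_apply _ MeasurableSet.univ, Measure.restrict_univ]
    simp only [ENNReal.div_eq_inv_mul]
    rw [lintegral_const_mul _ hlm, ENNReal.inv_mul_cancel hL0 hLT]
  have hFm : ∀ x, Measurable fun s => F s x := fun x => hF.comp (measurable_id.prodMk measurable_const)
  have hFlm : Measurable (fun z : α × X => (F z.1 z.2 / lam z.1) ^ p z.2) :=
    (hF.div (hlm.comp measurable_fst)).pow (hpm.comp measurable_snd)
  calc modular μ p (fun x => (∫⁻ s, F s x ∂ν) / L)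
      ≤ ∫⁻ x, ∫⁻ s, (F s x / lam s) ^ p x ∂κ ∂μ := by
        refine lintegral_mono_ae ?_
        filter_upwards [hp] with x hx
        have : (∫⁻ s, F s x ∂ν) / L = ∫⁻ s, F s x / lam s ∂κ := by
          have hm : Measurable fun s => F s x / lam s := (hFm x).div hlm
          rw [hκ, lintegral_withDensity_eq_lintegral_mul _ hκm hm,
            ENNReal.div_eq_inv_mul, ← lintegral_const_mul _ (hFm x)]
          refine lintegral_congr_ae ?_
          filter_upwards [hlT] with s hs
          simp only [Pi.mul_apply, ENNReal.div_eq_inv_mul]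
          calc L⁻¹ * F s x = L⁻¹ * F s x * (lam s * (lam s)⁻¹) := by
                rw [ENNReal.mul_inv_cancel (hlpos s) hs, mul_one]
            _ = _ := by ring
        rw [this]
        exact lintegral_rpow_le_of_mass_le_one _ hx hκ1 ((hFm x).div hlm).aemeasurable
    _ = ∫⁻ x, ∫⁻ s, (lam s / L) * (F s x / lam s) ^ p x ∂ν ∂μ := by
        refine lintegral_congr fun x => ?_
        have hm : Measurable fun s => (F s x / lam s) ^ p x :=
          hFlm.comp (measurable_id.prodMk measurable_const)
        rw [hκ, lintegral_withDensity_eq_lintegral_mul _ hκm hm]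
        rfl
    _ = ∫⁻ s, ∫⁻ x, (lam s / L) * (F s x / lam s) ^ p x ∂μ ∂ν := by
        refine lintegral_lintegral_swap ?_
        exact ((hκm.comp measurable_snd).mul (hFlm.comp measurable_swap)).aemeasurable
    _ ≤ ∫⁻ s, lam s / L ∂ν := by
        refine lintegral_mono_ae ?_
        filter_upwards [hmod] with s hs
        have hm : Measurable fun x => (F s x / lam s) ^ p x :=
          hFlm.comp (measurable_const.prodMk measurable_id)
        rw [lintegral_const_mul _ hm]
        exact (mul_le_mul_right hs _).trans (by simp)
    _ ≤ 1 := by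
        simp only [ENNReal.div_eq_inv_mul]
        rw [lintegral_const_mul _ hlm, ENNReal.inv_mul_cancel hL0 hLT]

/-- The triangle inequality is Minkowski's integral inequality for the counting measure. -/
theorem luxNorm_sum_le [SFinite μ] (hpm : Measurable p) (hp : ∀ᵐ x ∂μ, 1 ≤ p x) {n : ℕ}
    {F : Fin n → X → ℝ≥0∞} (hF : ∀ i, Measurable (F i)) :
    luxNorm μ p (fun x => ∑ i, F i x) ≤ ∑ i, luxNorm μ p (F i) := by
  have h := luxNorm_lintegral_le (μ := μ) hpm hp (Measure.count : Measure (Fin n)) (F := F)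
    (measurable_from_prod_countable_right hF) (B := fun i => luxNorm μ p (F i))
    measurable_from_top.aemeasurable (.of_forall fun _ => le_rfl)
  simpa [lintegral_count] using h

theorem luxNorm_sum_range_le [SFinite μ] (hpm : Measurable p) (hp : ∀ᵐ x ∂μ, 1 ≤ p x) (n : ℕ)
    {F : ℕ → X → ℝ≥0∞} (hF : ∀ i, Measurable (F i)) :
    luxNorm μ p (fun x => ∑ i ∈ Finset.range n, F i x) ≤
      ∑ i ∈ Finset.range n, luxNorm μ p (F i) := by
  simpa only [Finset.sum_range] using luxNorm_sum_le hpm hp (F := fun i : Fin n => F i)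
    fun i => hF i

theorem luxNorm_add_le [SFinite μ] (hpm : Measurable p) (hp : ∀ᵐ x ∂μ, 1 ≤ p x)
    {F G : X → ℝ≥0∞} (hF : Measurable F) (hG : Measurable G) :
    luxNorm μ p (fun x => F x + G x) ≤ luxNorm μ p F + luxNorm μ p G := by
  simpa [Fin.sum_univ_two] using luxNorm_sum_le hpm hp (F := ![F, G])
    (by intro i; fin_cases i <;> assumption)

/-- Fatou's lemma for the Luxemburg norm. -/
theorem luxNorm_le_of_tendsto (hpm : Measurable p) (hp : ∀ᵐ x ∂μ, 1 ≤ p x)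
    {F : ℕ → X → ℝ≥0∞} (hF : ∀ i, Measurable (F i)) {G : X → ℝ≥0∞}
    (hG : ∀ᵐ x ∂μ, G x ≤ liminf (fun i => F i x) atTop) {c : ℝ≥0∞}
    (h : ∀ i, luxNorm μ p (F i) ≤ c) : luxNorm μ p G ≤ c := by
  refine le_of_forall_gt_imp_ge_of_dense fun b hb => ?_
  rcases eq_or_ne b ⊤ with rfl | hbT
  · exact le_top
  have hb0 : b ≠ 0 := (bot_le.trans_lt hb).ne'
  refine luxNorm_le_of_modular_le (pos_iff_ne_zero.2 hb0) hbT.lt_top ?_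
  calc modular μ p (fun x => G x / b)
      ≤ ∫⁻ x, liminf (fun i => (F i x / b) ^ p x) atTop ∂μ := by
        refine lintegral_mono_ae ?_
        filter_upwards [hp, hG] with x hx hGx
        have hmono : Monotone fun y : ℝ≥0∞ => (y / b) ^ p x := fun y z hyz =>
          ENNReal.rpow_le_rpow (ENNReal.div_le_div_right hyz _) (by linarith)
        have hcont : Continuous fun y : ℝ≥0∞ => (y / b) ^ p x :=
          ENNReal.continuous_rpow_const.comp (ENNReal.continuous_div_const _ hb0)
        exact (hmono hGx).trans_eq (hmono.map_liminf_of_continuousAt _ hcont.continuousAt)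
    _ ≤ liminf (fun i => ∫⁻ x, (F i x / b) ^ p x ∂μ) atTop :=
        lintegral_liminf_le fun i => ((hF i).div_const _).pow hpm
    _ ≤ 1 := by
        refine liminf_le_of_le (by isBoundedDefault) fun a ha => ?_
        obtain ⟨i, hi⟩ := ha.exists
        exact hi.trans (modular_le_of_luxNorm_lt hp ((h i).trans_lt hb))

/-- Hölder's inequality against a fixed weight, for exponents bounded away from `1`. -/
theorem lintegral_mul_le_luxNorm [IsProbabilityMeasure μ] {r s : ℝ}
    (hrs : r.HolderConjugate s) (hr : ∀ᵐ x ∂μ, r ≤ p x) {W : X → ℝ≥0∞} (hW : Measurable W)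
    (hWs : ∫⁻ x, W x ^ s ∂μ ≠ ⊤) {F : X → ℝ≥0∞} :
    ∫⁻ x, F x * W x ∂μ ≤ (2 + ∫⁻ x, W x ^ s ∂μ) * luxNorm μ p F := by
  have h2 : (2 + ∫⁻ x, W x ^ s ∂μ) ≠ 0 := by positivity
  have hT : (2 + ∫⁻ x, W x ^ s ∂μ) ≠ ⊤ := by finiteness
  refine le_mul_luxNorm h2 hT fun c hc0 hc hm => ?_
  have hr1 := hrs.lt
  calc ∫⁻ x, F x * W x ∂μ = ∫⁻ x, c * (F x / c * W x) ∂μ := by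
        refine lintegral_congr fun x => ?_
        rw [← mul_assoc, ENNReal.mul_div_cancel hc0.ne' hc.ne]
    _ ≤ ∫⁻ x, c * (1 + (F x / c) ^ p x + W x ^ s) ∂μ := by
        refine lintegral_mono_ae ?_
        filter_upwards [hr] with x hx
        gcongr
        -- Young's inequality with the fixed exponent `r ≤ p x`. Raising `r` to `p x` costs an
        -- additive `1`; with the modular bound `1` and total mass `1` this makes the constant `2`.
        refine (ENNReal.young_inequality _ _ hrs).trans ?_
        gcongr
        · refine ENNReal.div_le_of_le_mul ?_
          have : (F x / c) ^ r ≤ 1 + (F x / c) ^ p x := by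
            rcases le_total (F x / c) 1 with h1 | h1
            · exact (ENNReal.rpow_le_one h1 (by linarith)).trans le_self_add
            · exact (ENNReal.rpow_le_rpow_of_exponent_le h1 hx).trans le_add_self
          refine this.trans (le_mul_of_one_le_right' ?_)
          exact ENNReal.one_le_ofReal.2 hr1.le
        · refine ENNReal.div_le_of_le_mul (le_mul_of_one_le_right' ?_)
          exact ENNReal.one_le_ofReal.2 hrs.symm.lt.le
    _ = c * (∫⁻ x, 1 + (F x / c) ^ p x ∂μ + ∫⁻ x, W x ^ s ∂μ) := by
        rw [lintegral_const_mul' _ _ hc.ne, lintegral_add_right _ (hW.pow_const s)]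
    _ ≤ c * (2 + ∫⁻ x, W x ^ s ∂μ) := by
        gcongr
        rw [lintegral_add_left measurable_const]
        simp only [lintegral_const, measure_univ, mul_one]
        calc _ ≤ (1 : ℝ≥0∞) + 1 := by gcongr; exact hm
          _ = 2 := by norm_num
    _ = _ := mul_comm _ _

end Luxemburg

end GaussianBesov

noncomputable section

namespace GaussianBesov

/-! ### The Gaussian measure and the Mehler formula -/

section Gauss

variable {d : ℕ}

/-- The density of the Gaussian measure. -/
def gaussDensity (d : ℕ) (x : E d) : ℝ≥0∞ :=
  ENNReal.ofReal (Real.exp (-‖x‖ ^ 2) / Real.pi ^ ((d : ℝ) / 2))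

theorem measurable_gaussDensity : Measurable (gaussDensity d) := by
  unfold gaussDensity; fun_prop

theorem lintegral_gauss {F : E d → ℝ≥0∞} (hF : Measurable F) :
    ∫⁻ x, F x ∂(gauss d) = ∫⁻ x, gaussDensity d x * F x :=
  lintegral_withDensity_eq_lintegral_mul _ measurable_gaussDensity hF

theorem lintegral_exp_neg_mul_sq_norm {b : ℝ} (hb : 0 < b) :
    ∫⁻ x : E d, ENNReal.ofReal (Real.exp (-b * ‖x‖ ^ 2)) =
      ENNReal.ofReal ((Real.pi / b) ^ ((d : ℝ) / 2)) := by
  have h := GaussianFourier.integral_rexp_neg_mul_sq_norm (V := E d) hb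
  rw [finrank_euclideanSpace_fin] at h
  have hint : Integrable (fun x : E d => Real.exp (-b * ‖x‖ ^ 2)) := by
    by_contra hn
    rw [integral_undef hn] at h
    have : 0 < (Real.pi / b) ^ ((d : ℝ) / 2) := by positivity
    linarith
  rw [← h, ofReal_integral_eq_lintegral_ofReal hint (.of_forall fun x => (Real.exp_pos _).le)]

instance isProbabilityMeasure_gauss : IsProbabilityMeasure (gauss d) := by
  constructor
  rw [← setLIntegral_one, Measure.restrict_univ, lintegral_gauss measurable_const]
  have hpi : (0 : ℝ) < Real.pi ^ ((d : ℝ) / 2) := by positivity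
  have h := lintegral_exp_neg_mul_sq_norm (d := d) one_pos
  simp only [neg_mul, one_mul, div_one] at h
  simp only [gaussDensity, mul_one, div_eq_mul_inv (Real.exp _), ENNReal.ofReal_mul (Real.exp_pos _).le]
  rw [lintegral_mul_const _ (by fun_prop), h, ← ENNReal.ofReal_mul hpi.le, mul_inv_cancel₀ hpi.ne',
    ENNReal.ofReal_one]

theorem lintegral_comp_smul_add {c : ℝ} (hc : c ≠ 0) (b : E d) {g : E d → ℝ≥0∞}
    (hg : Measurable g) :
    ∫⁻ u, g (c • u + b) = ENNReal.ofReal |(c ^ d)⁻¹| * ∫⁻ y, g y := by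
  have h1 : ∫⁻ u, g (c • u + b) = ∫⁻ y, g (y + b) ∂(Measure.map (c • ·) (volume : Measure (E d))) := by
    rw [lintegral_map (by fun_prop) (by fun_prop)]
  rw [h1, Measure.map_addHaar_smul _ hc, lintegral_smul_measure, lintegral_add_right_eq_self,
    finrank_euclideanSpace_fin, smul_eq_mul]

/-- The product density depends only on `‖y‖² + ‖z‖²`, which an orthogonal change of the pair
preserves. -/
theorem gaussDensity_mul_rotation {c s : ℝ} (hcs : c ^ 2 + s ^ 2 = 1) (y z : E d) :
    gaussDensity d (c • y - s • z) * gaussDensity d (c • z + s • y) =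
      gaussDensity d y * gaussDensity d z := by
  unfold gaussDensity
  rw [← ENNReal.ofReal_mul (by positivity), ← ENNReal.ofReal_mul (by positivity)]
  congr 1
  rw [div_mul_div_comm, div_mul_div_comm, ← Real.exp_add, ← Real.exp_add]
  congr 2
  rw [norm_sub_sq_real, norm_add_sq_real]
  simp only [norm_smul, inner_smul_left, inner_smul_right, mul_pow, Real.norm_eq_abs, sq_abs,
    real_inner_comm y z, conj_trivial]
  linear_combination (-‖y‖ ^ 2 - ‖z‖ ^ 2) * hcs

/-- The rotation `(u, x) ↦ (c u + s x, - s u + c x)` preserves `γ_d × γ_d`. -/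
theorem measurePreserving_rotation {c s : ℝ} (hc : 0 < c) (hcs : c ^ 2 + s ^ 2 = 1) :
    MeasurePreserving (fun z : E d × E d => (c • z.1 + s • z.2, -s • z.1 + c • z.2))
      ((gauss d).prod (gauss d)) ((gauss d).prod (gauss d)) := by
  have hm : Measurable (fun z : E d × E d => (c • z.1 + s • z.2, -s • z.1 + c • z.2)) := by
    fun_prop
  refine ⟨hm, Measure.ext_of_lintegral _ fun F hF => ?_⟩
  rw [lintegral_map hF hm, lintegral_prod_symm _ (by fun_prop),
    lintegral_prod _ hF.aemeasurable]
  have hD := measurable_gaussDensity (d := d)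
  set K := ENNReal.ofReal |(c ^ d)⁻¹|
  have hKT : K ≠ ⊤ := ENNReal.ofReal_ne_top
  -- The rotation is factored into two affine substitutions in one variable: `y = c u + s x` for
  -- fixed `x`, and `x = c z + s y` for fixed `y`. Both carry the same Jacobian factor `K` and lead
  -- to the double integral of `g`, in the two orders. This is where `c > 0` is needed.
  set g : E d → E d → ℝ≥0∞ := fun x y =>
    gaussDensity d x * (gaussDensity d (c⁻¹ • (y - s • x)) * F (y, c⁻¹ • (x - s • y)))
  have hg : Measurable (Function.uncurry g) := by
    simp only [Function.uncurry_def, g]; fun_prop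
  have hinv : ∀ a : E d, c⁻¹ • c • a = a := fun a => inv_smul_smul₀ hc.ne' a
  have h1 : ∀ x, gaussDensity d x * ∫⁻ u, F (c • u + s • x, -s • u + c • x) ∂(gauss d) =
      K * ∫⁻ y, g x y := by
    intro x
    rw [lintegral_gauss (by fun_prop), ← lintegral_const_mul _ (by fun_prop),
      ← lintegral_comp_smul_add hc.ne' (s • x) (g := fun y => g x y) hg.of_uncurry_left]
    refine lintegral_congr fun u => ?_
    simp only [g]
    rw [add_sub_cancel_right, hinv]
    congr 4
    rw [eq_inv_smul_iff₀ hc.ne', smul_add, smul_smul, smul_smul, smul_add, smul_smul, smul_smul]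
    have : c * c = 1 - s * s := by linear_combination hcs
    rw [this]
    module
  have h2 : ∀ y, gaussDensity d y * ∫⁻ z, F (y, z) ∂(gauss d) = K * ∫⁻ x, g x y := by
    intro y
    rw [lintegral_gauss (by fun_prop), ← lintegral_const_mul _ (by fun_prop),
      ← lintegral_comp_smul_add hc.ne' (s • y) (g := fun x => g x y) hg.of_uncurry_right]
    refine lintegral_congr fun z => ?_
    simp only [g]
    rw [add_sub_cancel_right, hinv, ← mul_assoc, ← mul_assoc, ← gaussDensity_mul_rotation hcs y z,
      mul_comm (gaussDensity d (c • y - s • z))]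
    congr 3
    rw [eq_inv_smul_iff₀ hc.ne', smul_sub, smul_smul, smul_smul, smul_add, smul_smul, smul_smul]
    have : c * c = 1 - s * s := by linear_combination hcs
    rw [this]
    module
  have m1 : Measurable fun x => ∫⁻ u, F (c • u + s • x, -s • u + c • x) ∂(gauss d) :=
    Measurable.lintegral_prod_left (f := fun u x => F (c • u + s • x, -s • u + c • x)) (hF.comp hm)
  rw [lintegral_gauss m1, lintegral_gauss hF.lintegral_prod_right']
  simp only [h1, h2]
  rw [lintegral_const_mul' _ _ hKT, lintegral_const_mul' _ _ hKT,
    lintegral_lintegral_swap hg.aemeasurable]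

/-- `√(1 - e^{-2σ})`. -/
def ouStd (σ : ℝ) : ℝ := Real.sqrt (1 - Real.exp (-2 * σ))

theorem one_sub_exp_pos {σ : ℝ} (hσ : 0 < σ) : 0 < 1 - Real.exp (-2 * σ) := by
  have : Real.exp (-2 * σ) < 1 := Real.exp_lt_one_iff.2 (by linarith)
  linarith

theorem ouStd_pos {σ : ℝ} (hσ : 0 < σ) : 0 < ouStd σ := Real.sqrt_pos.2 (one_sub_exp_pos hσ)

theorem ouStd_sq {σ : ℝ} (hσ : 0 < σ) : ouStd σ ^ 2 = 1 - Real.exp (-2 * σ) :=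
  Real.sq_sqrt (one_sub_exp_pos hσ).le

theorem ouStd_sq_add {σ : ℝ} (hσ : 0 < σ) : ouStd σ ^ 2 + Real.exp (-σ) ^ 2 = 1 := by
  rw [ouStd_sq hσ, ← Real.exp_nat_mul]
  ring_nf

@[fun_prop]
theorem measurable_ouStd : Measurable ouStd := by unfold ouStd; fun_prop

/-- The Ornstein-Uhlenbeck semigroup on functions with values in `[0, ∞]`. -/
def ouPos (σ : ℝ) (F : E d → ℝ≥0∞) (x : E d) : ℝ≥0∞ :=
  ∫⁻ u, F (ouStd σ • u + Real.exp (-σ) • x) ∂(gauss d)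

theorem ouSemigroup_eq (σ : ℝ) (f : E d → ℝ) (x : E d) :
    ouSemigroup σ f x = ∫ u, f (ouStd σ • u + Real.exp (-σ) • x) ∂(gauss d) := rfl

theorem measurable_ouPos_uncurry {F : E d → ℝ≥0∞} (hF : Measurable F) :
    Measurable (fun z : ℝ × E d => ouPos z.1 F z.2) := by
  have : Measurable (fun w : (ℝ × E d) × E d =>
      F (ouStd w.1.1 • w.2 + Real.exp (-w.1.1) • w.1.2)) := by fun_prop
  exact this.lintegral_prod_right'

theorem measurable_ouPos {F : E d → ℝ≥0∞} (hF : Measurable F) (σ : ℝ) : Measurable (ouPos σ F) := by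
  have h := (measurable_ouPos_uncurry hF).comp (measurable_prodMk_left (x := σ))
  exact h

theorem ouPos_mono {F G : E d → ℝ≥0∞} (h : ∀ x, F x ≤ G x) (σ : ℝ) (x : E d) :
    ouPos σ F x ≤ ouPos σ G x := lintegral_mono fun _ => h _

theorem ouPos_add {F G : E d → ℝ≥0∞} (hF : Measurable F) (σ : ℝ) (x : E d) :
    ouPos σ (fun y => F y + G y) x = ouPos σ F x + ouPos σ G x :=
  lintegral_add_left (by fun_prop) _

theorem ouPos_const_mul {F : E d → ℝ≥0∞} (hF : Measurable F) (c : ℝ≥0∞) (σ : ℝ) (x : E d) :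
    ouPos σ (fun y => c * F y) x = c * ouPos σ F x :=
  lintegral_const_mul _ (by fun_prop)

/-- The Gaussian measure is invariant. -/
theorem lintegral_ouPos {F : E d → ℝ≥0∞} (hF : Measurable F) {σ : ℝ} (hσ : 0 < σ) :
    ∫⁻ x, ouPos σ F x ∂(gauss d) = ∫⁻ x, F x ∂(gauss d) := by
  have h := measurePreserving_rotation (d := d) (ouStd_pos hσ) (ouStd_sq_add hσ)
  have h2 := h.lintegral_comp (f := fun z => F z.1) (by fun_prop)
  rw [lintegral_prod_symm _ (by fun_prop), lintegral_prod _ (by fun_prop)] at h2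
  simpa [ouPos] using h2

/-- The law of `a U + b V`, for `a² + b² = c²`. -/
theorem lintegral_gauss_add {a b c : ℝ} (ha : 0 < a) (hc : 0 < c) (habc : a ^ 2 + b ^ 2 = c ^ 2)
    {F : E d → ℝ≥0∞} (hF : Measurable F) :
    ∫⁻ x, ∫⁻ u, F (a • u + b • x) ∂(gauss d) ∂(gauss d) = ∫⁻ u, F (c • u) ∂(gauss d) := by
  have h := measurePreserving_rotation (d := d) (c := a / c) (s := b / c) (by positivity)
    (by field_simp; linarith)
  have h2 := h.lintegral_comp (f := fun z => F (c • z.1)) (by fun_prop)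
  rw [lintegral_prod_symm _ (by fun_prop), lintegral_prod _ (by fun_prop)] at h2
  simp only [smul_add, smul_smul, mul_div_cancel₀ _ hc.ne'] at h2
  simpa using h2

/-- Addition of variances of the independent noises in two successive Mehler formulas; the semigroup
law rests on it. -/
theorem ouStd_comp {σ ρ : ℝ} (hσ : 0 < σ) (hρ : 0 < ρ) :
    ouStd ρ ^ 2 + (Real.exp (-ρ) * ouStd σ) ^ 2 = ouStd (σ + ρ) ^ 2 := by
  rw [mul_pow, ouStd_sq hσ, ouStd_sq hρ, ouStd_sq (by positivity), ← Real.exp_nat_mul]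
  have : Real.exp (-2 * (σ + ρ)) = Real.exp (-2 * ρ) * Real.exp (-2 * σ) := by
    rw [← Real.exp_add]; ring_nf
  rw [this]
  push_cast
  rw [show 2 * -ρ = -2 * ρ by ring]
  ring

theorem ouPos_ouPos {F : E d → ℝ≥0∞} (hF : Measurable F) {σ ρ : ℝ} (hσ : 0 < σ) (hρ : 0 < ρ)
    (x : E d) : ouPos σ (ouPos ρ F) x = ouPos (σ + ρ) F x := by
  have h := lintegral_gauss_add (d := d) (ouStd_pos hρ) (ouStd_pos (add_pos hσ hρ))
    (ouStd_comp hσ hρ) (F := fun y => F (y + Real.exp (-(σ + ρ)) • x)) (by fun_prop)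
  unfold ouPos
  rw [← h]
  refine lintegral_congr fun v => lintegral_congr fun u => ?_
  rw [smul_add, smul_smul, smul_smul, ← Real.exp_add, add_assoc, neg_add_rev]

/-! ### Ornstein-Uhlenbeck semigroup on integrable functions -/

/-- The Mehler kernel with respect to Lebesgue measure, as a density with respect to `γ_d`. -/
theorem ouPos_eq_kernel {F : E d → ℝ≥0∞} (hF : Measurable F) {σ : ℝ} (hσ : 0 < σ) (x : E d) :
    ouPos σ F x = ∫⁻ y, ENNReal.ofReal ((ouStd σ ^ d)⁻¹ *
      Real.exp (‖y‖ ^ 2 - ‖y - Real.exp (-σ) • x‖ ^ 2 / ouStd σ ^ 2)) * F y ∂(gauss d) := by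
  have hτ := ouStd_pos hσ
  have hg : Measurable fun y => gaussDensity d ((ouStd σ)⁻¹ • (y - Real.exp (-σ) • x)) * F y := by
    have := measurable_gaussDensity (d := d)
    fun_prop
  have h := lintegral_comp_smul_add (d := d) hτ.ne' (Real.exp (-σ) • x) hg
  unfold ouPos
  rw [lintegral_gauss (by fun_prop), lintegral_gauss (by fun_prop)]
  simp only [add_sub_cancel_right, inv_smul_smul₀ hτ.ne'] at h
  rw [h, ← lintegral_const_mul _ hg]
  refine lintegral_congr fun y => ?_
  rw [← mul_assoc, ← mul_assoc]
  congr 1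
  unfold gaussDensity
  rw [← ENNReal.ofReal_mul (by positivity), ← ENNReal.ofReal_mul (by positivity)]
  congr 1
  rw [abs_of_pos (by positivity), norm_smul, mul_pow, norm_inv, Real.norm_of_nonneg hτ.le]
  rw [mul_div_assoc', div_mul_eq_mul_div]
  congr 1
  rw [mul_left_comm, ← Real.exp_add]
  congr 2
  field_simp
  ring

/-- Symmetry of the Mehler kernel. In the second form the exponent is visibly at most `‖x‖²`,
whatever `y` is. -/
theorem mehler_exponent_eq {σ : ℝ} (hσ : 0 < σ) (x y : E d) :
    ‖y‖ ^ 2 - ‖y - Real.exp (-σ) • x‖ ^ 2 / ouStd σ ^ 2 =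
      ‖x‖ ^ 2 - ‖x - Real.exp (-σ) • y‖ ^ 2 / ouStd σ ^ 2 := by
  have hτ := ouStd_pos hσ
  have h1 := ouStd_sq_add hσ
  rw [norm_sub_sq_real, norm_sub_sq_real]
  simp only [norm_smul, inner_smul_right, mul_pow, Real.norm_eq_abs, sq_abs, real_inner_comm x y]
  field_simp
  linear_combination (‖y‖ ^ 2 - ‖x‖ ^ 2) * h1

/-- A bound from `L¹` at every point, not only almost every one. It is what lets identities between
semigroups be stated pointwise for integrable functions. -/
theorem ouPos_le_exp_mul_lintegral {F : E d → ℝ≥0∞} (hF : Measurable F) {σ : ℝ} (hσ : 0 < σ)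
    (x : E d) : ouPos σ F x ≤
      ENNReal.ofReal ((ouStd σ ^ d)⁻¹ * Real.exp (‖x‖ ^ 2)) * ∫⁻ y, F y ∂(gauss d) := by
  rw [ouPos_eq_kernel hF hσ, ← lintegral_const_mul _ hF]
  refine lintegral_mono fun y => ?_
  have hτ := ouStd_pos hσ
  gcongr
  rw [mehler_exponent_eq hσ]
  have : 0 ≤ ‖x - Real.exp (-σ) • y‖ ^ 2 / ouStd σ ^ 2 := by positivity
  linarith

end Gauss

end GaussianBesov

end

noncomputable section

namespace GaussianBesov

/-! ### Uniform boundedness of the Ornstein-Uhlenbeck semigroup on `L^{p(·)}(γ_d)` -/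

section OUBounded

variable {d : ℕ} {p : E d → ℝ}

/-- The properties of the exponent `p(·)` which are used below. -/
structure IsAdmissible (p : E d → ℝ) : Prop where
  measurable : Measurable p
  one_le : ∀ x, 1 ≤ p x
  bounded : ∃ P, ∀ x, p x ≤ P
  lower : ∃ r > (1 : ℝ), ∀ᵐ x ∂(gauss d), r ≤ p x
  decay : ∃ C > (0 : ℝ), ∃ pinf ≥ (1 : ℝ), ∀ x : E d, x ≠ 0 → |p x - pinf| ≤ C / ‖x‖ ^ 2
  logHolder : LocLogHolder p

theorem IsAdmissible.ae_one_le (hp : IsAdmissible p) : ∀ᵐ x ∂(gauss d), 1 ≤ p x :=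
  .of_forall hp.one_le

theorem one_le_log_exp_add {y : ℝ} (hy : 0 ≤ y) : 1 ≤ Real.log (Real.exp 1 + y) := by
  rw [Real.le_log_iff_exp_le (by positivity)]
  linarith

/-- Continuity makes `p` Borel measurable, as the use of Tonelli in Minkowski's inequality requires.
-/
theorem LocLogHolder.continuous {a : E d → ℝ} (ha : LocLogHolder a) : Continuous a := by
  obtain ⟨C, hC, h⟩ := ha
  refine continuous_iff_continuousAt.2 fun x => ?_
  rw [continuousAt_iff_punctured_nhds, tendsto_iff_norm_sub_tendsto_zero]
  have h1 : Tendsto (fun y : E d => ‖y - x‖) (𝓝[≠] x) (𝓝[>] 0) := by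
    refine tendsto_nhdsWithin_iff.2 ⟨?_, ?_⟩
    · refine (Continuous.tendsto' (by fun_prop) x 0 (by simp)).mono_left nhdsWithin_le_nhds
    · filter_upwards [self_mem_nhdsWithin] with y hy
      exact norm_pos_iff.2 (sub_ne_zero.2 hy)
  have h2 : Tendsto (fun s : ℝ => C / Real.log (Real.exp 1 + 1 / s)) (𝓝[>] 0) (𝓝 0) := by
    refine tendsto_const_nhds.div_atTop (Real.tendsto_log_atTop.comp ?_)
    simp only [one_div]
    exact tendsto_atTop_add_const_left _ _ tendsto_inv_nhdsGT_zero
  refine squeeze_zero' (.of_forall fun _ => norm_nonneg _) ?_ (h2.comp h1)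
  filter_upwards [self_mem_nhdsWithin] with y hy
  exact h y x hy

theorem isAdmissible_of (hp : GaussExponent p) (hpLH : LocLogHolder p)
    (hp_inf : 1 < expInf (gauss d) p) : IsAdmissible p where
  measurable := hpLH.continuous.measurable
  one_le := hp.2.1
  bounded := by
    obtain ⟨C, hC, h⟩ := hpLH
    -- The logarithm in the log-Hölder condition is at least `1`, so `p` stays within `C` of `p 0`
    -- on the whole space.
    refine ⟨p 0 + C, fun x => ?_⟩
    rcases eq_or_ne x 0 with rfl | hx
    · linarith
    · have h1 := h x 0 hx
      have h2 : C / Real.log (Real.exp 1 + 1 / ‖x - 0‖) ≤ C :=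
        div_le_self hC.le (one_le_log_exp_add (by positivity))
      linarith [le_abs_self (p x - p 0)]
  lower := by
    obtain ⟨r, hr1, hr2⟩ := EReal.lt_iff_exists_real_btwn.1 hp_inf
    refine ⟨r, by exact_mod_cast hr1, ?_⟩
    filter_upwards [ae_lt_of_lt_essInf hr2] with x hx
    exact_mod_cast hx.le
  decay := hp.2.2
  logHolder := hpLH

theorem luxNorm_const_le {c : ℝ≥0∞} (h0 : 0 < c) (hc : c < ⊤) :
    luxNorm (gauss d) p (fun _ => c) ≤ c := by
  refine luxNorm_le_of_modular_le h0 hc ?_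
  simp [modular, ENNReal.div_self h0.ne' hc.ne]

theorem lintegral_exp_half_sq_norm_ne_top :
    ∫⁻ u : E d, ENNReal.ofReal (Real.exp (‖u‖ ^ 2 / 2)) ∂(gauss d) ≠ ⊤ := by
  rw [lintegral_gauss (by fun_prop)]
  have h := lintegral_exp_neg_mul_sq_norm (d := d) (b := 1 / 2) (by norm_num)
  have : ∀ u : E d, gaussDensity d u * ENNReal.ofReal (Real.exp (‖u‖ ^ 2 / 2)) =
      ENNReal.ofReal (Real.pi ^ ((d : ℝ) / 2))⁻¹ *
        ENNReal.ofReal (Real.exp (-(1 / 2) * ‖u‖ ^ 2)) := by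
    intro u
    rw [gaussDensity, ← ENNReal.ofReal_mul (by positivity), ← ENNReal.ofReal_mul (by positivity),
      div_eq_inv_mul, mul_assoc, ← Real.exp_add]
    ring_nf
  simp only [this]
  rw [lintegral_const_mul _ (by fun_prop), h]
  finiteness

theorem le_rpow_self_of_zero_or_one_le {y : ℝ≥0∞} (hy : y = 0 ∨ 1 ≤ y) {s : ℝ} (hs : 1 ≤ s) :
    y ≤ y ^ s := by
  rcases hy with rfl | hy
  · simp
  · exact ENNReal.le_rpow_self_of_one_le hy hs

/-- Pointwise bound for functions below a Gaussian exponential. -/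
theorem exists_ouPos_le_exp {A : ℝ} (hA : 0 < A) : ∃ B ≥ (1 : ℝ), ∀ σ > 0, ∀ F : E d → ℝ≥0∞,
    Measurable F → (∀ y, F y ≤ ENNReal.ofReal (Real.exp (A * ‖y‖ ^ 2))) →
    ∫⁻ y, F y ∂(gauss d) ≤ 1 → ∀ x,
    ouPos σ F x ≤ ENNReal.ofReal (B * Real.exp ((1 + 2 * A) * ‖x‖ ^ 2)) := by
  -- Chosen so that `2 A s0² ‖u‖² = ‖u‖² / 2`, which is still integrable against the Gaussian after
  -- exponentiation. If `ouStd σ ≥ s0`, the kernel bound and the `L¹` hypothesis suffice; otherwise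
  -- the growth hypothesis is integrated in `u`.
  set s0 := Real.sqrt (1 / (4 * A)) with hs0
  have hs0pos : 0 < s0 := Real.sqrt_pos.2 (by positivity)
  have hs0sq : s0 ^ 2 = 1 / (4 * A) := Real.sq_sqrt (by positivity)
  set B0 := (∫⁻ u : E d, ENNReal.ofReal (Real.exp (‖u‖ ^ 2 / 2)) ∂(gauss d)).toReal with hB0
  have hB0' : ∫⁻ u : E d, ENNReal.ofReal (Real.exp (‖u‖ ^ 2 / 2)) ∂(gauss d) = ENNReal.ofReal B0 :=
    (ENNReal.ofReal_toReal lintegral_exp_half_sq_norm_ne_top).symm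
  have hB0n : 0 ≤ B0 := ENNReal.toReal_nonneg
  refine ⟨1 + (s0 ^ d)⁻¹ + B0, by have : 0 < (s0 ^ d)⁻¹ := by positivity
                                  linarith, fun σ hσ F hF hFE hF1 x => ?_⟩
  have hτ := ouStd_pos hσ
  have hinv : 0 < (s0 ^ d)⁻¹ := by positivity
  rcases le_total s0 (ouStd σ) with h | h
  · refine (ouPos_le_exp_mul_lintegral hF hσ x).trans ?_
    calc _ ≤ ENNReal.ofReal ((ouStd σ ^ d)⁻¹ * Real.exp (‖x‖ ^ 2)) * 1 := by gcongr
      _ ≤ _ := by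
        rw [mul_one]
        gcongr
        · calc (ouStd σ ^ d)⁻¹ ≤ (s0 ^ d)⁻¹ := by gcongr
            _ ≤ _ := by linarith
        · nlinarith [sq_nonneg ‖x‖]
  · calc ouPos σ F x ≤ ∫⁻ u, ENNReal.ofReal (Real.exp (2 * A * ‖x‖ ^ 2)) *
          ENNReal.ofReal (Real.exp (‖u‖ ^ 2 / 2)) ∂(gauss d) := by
          refine lintegral_mono fun u => (hFE _).trans ?_
          rw [← ENNReal.ofReal_mul (by positivity), ← Real.exp_add]
          gcongr
          have h1 : ‖ouStd σ • u + Real.exp (-σ) • x‖ ≤ ouStd σ * ‖u‖ + Real.exp (-σ) * ‖x‖ := by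
            refine (norm_add_le _ _).trans_eq ?_
            rw [norm_smul, norm_smul, Real.norm_of_nonneg hτ.le,
              Real.norm_of_nonneg (Real.exp_pos _).le]
          have h2 : ouStd σ * ‖u‖ ≤ s0 * ‖u‖ := by gcongr
          have h3 : Real.exp (-σ) * ‖x‖ ≤ ‖x‖ :=
            mul_le_of_le_one_left (norm_nonneg _) (Real.exp_le_one_iff.2 (by linarith))
          have h4 : ‖ouStd σ • u + Real.exp (-σ) • x‖ ^ 2 ≤ (s0 * ‖u‖ + ‖x‖) ^ 2 := by
            gcongr
            linarith
          have h5 : (s0 * ‖u‖ + ‖x‖) ^ 2 ≤ 2 * (s0 ^ 2 * ‖u‖ ^ 2) + 2 * ‖x‖ ^ 2 := by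
            nlinarith [sq_nonneg (s0 * ‖u‖ - ‖x‖)]
          rw [hs0sq] at h5
          calc A * ‖ouStd σ • u + Real.exp (-σ) • x‖ ^ 2
              ≤ A * (2 * (1 / (4 * A) * ‖u‖ ^ 2) + 2 * ‖x‖ ^ 2) := by
                gcongr
                exact h4.trans h5
            _ = 2 * A * ‖x‖ ^ 2 + ‖u‖ ^ 2 / 2 := by field_simp; ring
      _ = ENNReal.ofReal (Real.exp (2 * A * ‖x‖ ^ 2) * B0) := by
          rw [lintegral_const_mul _ (by fun_prop), hB0', ← ENNReal.ofReal_mul (by positivity)]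
      _ ≤ _ := by
          rw [mul_comm]
          gcongr
          · linarith
          · nlinarith [sq_nonneg ‖x‖]

theorem exponent_diff_mul_le {C pinf : ℝ} (hC : 0 < C)
    (h : ∀ x : E d, x ≠ 0 → |p x - pinf| ≤ C / ‖x‖ ^ 2) (x : E d) :
    ‖x‖ ^ 2 * |p x - pinf| ≤ C := by
  rcases eq_or_ne x 0 with rfl | hx
  · simpa using hC.le
  · have := h x hx
    rwa [le_div_iff₀ (by positivity), mul_comm] at this

/-- The middle part of the decomposition. Where a function is at most a Gaussian exponential,
changing its exponent by `|p(x) - p_∞|` costs a bounded factor, because `‖x‖² |p(x) - p_∞|` is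
bounded. Both `F` and `T_σ F` have such growth, so the claim reduces to Jensen and invariance of
`γ_d` for the constant exponent `p_∞`. -/
theorem exists_luxNorm_ouPos_le_of_le_exp (hp : IsAdmissible p) {A : ℝ} (hA : 0 < A) :
    ∃ C : ℝ≥0, ∀ σ > 0, ∀ F : E d → ℝ≥0∞, Measurable F →
    (∀ y, F y ≤ ENNReal.ofReal (Real.exp (A * ‖y‖ ^ 2))) → (∀ y, F y = 0 ∨ 1 ≤ F y) →
    modular (gauss d) p F ≤ 1 → luxNorm (gauss d) p (ouPos σ F) ≤ C := by
  obtain ⟨C, hC, pinf, hpinf, hdec⟩ := hp.decay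
  obtain ⟨P, hP⟩ := hp.bounded
  obtain ⟨B, hB, hbound⟩ := exists_ouPos_le_exp (d := d) hA
  -- `K` bounds the growth estimate of `T_σ F` raised to the power `|p x - pinf| ≤ P + pinf`.
  set K : ℝ := B ^ (P + pinf) * Real.exp ((1 + 2 * A) * C) with hK
  set C' : ℝ≥0 := 1 + K.toNNReal * (Real.exp (A * C)).toNNReal with hC'
  refine ⟨C', fun σ hσ F hF hFE hF1 hmod => ?_⟩
  have hP1 : 1 ≤ P := (hp.one_le 0).trans (hP 0)
  have hFint : ∫⁻ y, F y ∂(gauss d) ≤ 1 :=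
    (lintegral_mono fun y => le_rpow_self_of_zero_or_one_le (hF1 y) (hp.one_le y)).trans hmod
  have hz := hbound σ hσ F hF hFE hFint
  have hpow : ∫⁻ y, F y ^ pinf ∂(gauss d) ≤ ENNReal.ofReal (Real.exp (A * C)) := by
    calc ∫⁻ y, F y ^ pinf ∂(gauss d)
        ≤ ∫⁻ y, ENNReal.ofReal (Real.exp (A * C)) * F y ^ p y ∂(gauss d) := by
          refine lintegral_mono fun y => ?_
          rcases hF1 y with h0 | h1
          · simp [h0, ENNReal.zero_rpow_of_pos (by linarith : 0 < pinf)]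
          have hT : F y ≠ ⊤ := ((hFE y).trans_lt ENNReal.ofReal_lt_top).ne
          calc F y ^ pinf ≤ F y ^ (|p y - pinf| + p y) := by
                refine ENNReal.rpow_le_rpow_of_exponent_le h1 ?_
                linarith [neg_abs_le (p y - pinf)]
            _ = F y ^ |p y - pinf| * F y ^ p y :=
                ENNReal.rpow_add_of_nonneg _ _ (abs_nonneg _) (by linarith [hp.one_le y])
            _ ≤ _ := by
                gcongr
                calc F y ^ |p y - pinf| ≤ ENNReal.ofReal (Real.exp (A * ‖y‖ ^ 2)) ^ |p y - pinf| := by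
                      gcongr
                      exact hFE y
                  _ = ENNReal.ofReal (Real.exp (A * ‖y‖ ^ 2 * |p y - pinf|)) := by
                      rw [ENNReal.ofReal_rpow_of_pos (Real.exp_pos _), ← Real.exp_mul]
                  _ ≤ _ := by
                      refine ENNReal.ofReal_le_ofReal (Real.exp_le_exp.2 ?_)
                      rw [mul_assoc]
                      exact mul_le_mul_of_nonneg_left (exponent_diff_mul_le hC hdec y) hA.le
      _ ≤ ENNReal.ofReal (Real.exp (A * C)) * 1 := by
          rw [lintegral_const_mul' _ _ ENNReal.ofReal_ne_top]
          gcongr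
          exact hmod
      _ = _ := mul_one _
  refine luxNorm_le_of_modular_le_const hp.ae_one_le (by simp [hC']) ENNReal.coe_ne_top ?_
  calc modular (gauss d) p (ouPos σ F)
      ≤ ∫⁻ x, 1 + ENNReal.ofReal K * ouPos σ (fun y => F y ^ pinf) x ∂(gauss d) := by
        refine lintegral_mono fun x => ?_
        rcases le_total (ouPos σ F x) 1 with h1 | h1
        · exact (ENNReal.rpow_le_one h1 (by linarith [hp.one_le x])).trans le_self_add
        refine le_trans ?_ le_add_self
        have hδP : |p x - pinf| ≤ P + pinf := by
          rw [abs_le]; constructor <;> linarith [hp.one_le x, hP x]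
        calc ouPos σ F x ^ p x ≤ ouPos σ F x ^ (|p x - pinf| + pinf) := by
              refine ENNReal.rpow_le_rpow_of_exponent_le h1 ?_
              linarith [le_abs_self (p x - pinf)]
          _ = ouPos σ F x ^ |p x - pinf| * ouPos σ F x ^ pinf :=
              ENNReal.rpow_add_of_nonneg _ _ (abs_nonneg _) (by linarith)
          _ ≤ _ := by
              gcongr
              · calc ouPos σ F x ^ |p x - pinf|
                    ≤ ENNReal.ofReal (B * Real.exp ((1 + 2 * A) * ‖x‖ ^ 2)) ^ |p x - pinf| := by
                      gcongr
                      exact hz x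
                  _ = ENNReal.ofReal (B ^ |p x - pinf| *
                        Real.exp ((1 + 2 * A) * ‖x‖ ^ 2 * |p x - pinf|)) := by
                      rw [ENNReal.ofReal_rpow_of_pos (by positivity), Real.mul_rpow (by linarith)
                        (Real.exp_pos _).le, ← Real.exp_mul]
                  _ ≤ _ := by
                      refine ENNReal.ofReal_le_ofReal (mul_le_mul
                        (Real.rpow_le_rpow_of_exponent_le hB hδP) (Real.exp_le_exp.2 ?_)
                        (Real.exp_pos _).le (by positivity))
                      rw [mul_assoc]
                      exact mul_le_mul_of_nonneg_left (exponent_diff_mul_le hC hdec x) (by positivity)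
              · exact lintegral_rpow_le_of_mass_le_one _ hpinf (by simp) (by fun_prop)
    _ = 1 + ENNReal.ofReal K * ∫⁻ y, F y ^ pinf ∂(gauss d) := by
        rw [lintegral_add_left measurable_const, lintegral_const_mul' _ _ ENNReal.ofReal_ne_top,
          lintegral_ouPos (by fun_prop) hσ]
        simp
    _ ≤ 1 + ENNReal.ofReal K * ENNReal.ofReal (Real.exp (A * C)) := by gcongr
    _ = C' := by
        simp [hC', ENNReal.ofReal]

/-- Kernel bound for functions which are integrable against `e^{2|y|²}`. -/
theorem ouPos_le_of_support {F : E d → ℝ≥0∞} (hF : Measurable F) {σ : ℝ} (hσ : 0 < σ) (x : E d)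
    {κ : ℝ} (hκ : ∀ y, F y ≠ 0 → κ ≤ ‖y‖ ^ 2 + ‖y - Real.exp (-σ) • x‖ ^ 2 / ouStd σ ^ 2) :
    ouPos σ F x ≤ ENNReal.ofReal ((ouStd σ ^ d)⁻¹ * Real.exp (-κ)) *
      ∫⁻ y, F y * ENNReal.ofReal (Real.exp (2 * ‖y‖ ^ 2)) ∂(gauss d) := by
  have hτ := ouStd_pos hσ
  rw [ouPos_eq_kernel hF hσ, ← lintegral_const_mul' _ _ ENNReal.ofReal_ne_top]
  refine lintegral_mono fun y => ?_
  rcases eq_or_ne (F y) 0 with h0 | h0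
  · simp [h0]
  rw [mul_comm (F y), ← mul_assoc, ← ENNReal.ofReal_mul (by positivity)]
  rw [mul_assoc (ouStd σ ^ d)⁻¹, ← Real.exp_add]
  gcongr ENNReal.ofReal (_ * Real.exp ?_) * _
  linarith [hκ y h0]

/-- With `s = ouStd σ`, `r = e^{-σ}` and `e = ‖y - r x‖`, write `x - y = (1 - r) x - (y - r x)`.
Since `1 - r ≤ s²` and `‖x‖ ≤ 2(‖y‖ + e)`, the distance is at most `2(e + s² ‖y‖)`. A distance of at
least `√s` therefore forces `s ≤ 8(e² + s² ‖y‖²)`. -/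
theorem far_exponent_le {σ : ℝ} (hσ : 0 < σ) (hs : ouStd σ ^ 2 ≤ 1 / 2) {x y : E d}
    (hxy : Real.sqrt (ouStd σ) ≤ ‖x - y‖) :
    1 / (8 * ouStd σ) ≤ ‖y‖ ^ 2 + ‖y - Real.exp (-σ) • x‖ ^ 2 / ouStd σ ^ 2 := by
  have hτ := ouStd_pos hσ
  have h1 := ouStd_sq_add hσ
  set s := ouStd σ
  set r := Real.exp (-σ)
  have hr0 : 0 < r := Real.exp_pos _
  have hr1 : r ≤ 1 := Real.exp_le_one_iff.2 (by linarith)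
  have hr2 : 1 / 2 ≤ r := by nlinarith
  have hr3 : 1 - r ≤ s ^ 2 := by nlinarith
  set e := ‖y - r • x‖
  have hxe : r * ‖x‖ ≤ ‖y‖ + e := by
    have : ‖r • x‖ ≤ ‖y‖ + ‖y - r • x‖ := by
      have := norm_sub_le y (y - r • x)
      simpa using this
    rwa [norm_smul, Real.norm_of_nonneg hr0.le] at this
  have hxy2 : ‖x - y‖ ≤ (1 - r) * ‖x‖ + e := by
    have : x - y = (1 - r) • x - (y - r • x) := by module
    rw [this]
    refine (norm_sub_le _ _).trans_eq ?_
    rw [norm_smul, Real.norm_of_nonneg (by linarith)]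
  have he0 : 0 ≤ e := norm_nonneg _
  have hx0 := norm_nonneg x
  have hy0 := norm_nonneg y
  have hx2 : ‖x‖ ≤ 2 * (‖y‖ + e) := by nlinarith
  have h3 : (1 - r) * ‖x‖ ≤ s ^ 2 * (2 * (‖y‖ + e)) := by gcongr
  have h4 : Real.sqrt s ≤ 2 * (e + s ^ 2 * ‖y‖) := by nlinarith
  have h5 : s ≤ (2 * (e + s ^ 2 * ‖y‖)) ^ 2 := by
    rw [← Real.sq_sqrt hτ.le]
    gcongr
    rwa [Real.sq_sqrt hτ.le]
  have h6 : s ≤ 8 * (e ^ 2 + s ^ 2 * ‖y‖ ^ 2) := by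
    have h7 : s ^ 4 ≤ s ^ 2 := by nlinarith [sq_nonneg s]
    have : s ^ 4 * ‖y‖ ^ 2 ≤ s ^ 2 * ‖y‖ ^ 2 := mul_le_mul_of_nonneg_right h7 (sq_nonneg _)
    nlinarith [sq_nonneg (e - s ^ 2 * ‖y‖)]
  rw [div_le_iff₀ (by positivity)]
  have : (‖y‖ ^ 2 + e ^ 2 / s ^ 2) * (8 * s) = 8 * (e ^ 2 + s ^ 2 * ‖y‖ ^ 2) / s := by
    field_simp
    ring
  rw [this, le_div_iff₀ hτ]
  linarith

/-- The exponential gain off the diagonal beats the singular factor `s^{-d}` of the Mehler kernel,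
uniformly in `s`. -/
theorem inv_pow_mul_exp_le {s : ℝ} (hs : 0 < s) :
    (s ^ d)⁻¹ * Real.exp (-(1 / (8 * s))) ≤ 8 ^ d * d.factorial := by
  have h := Real.pow_div_factorial_le_exp (1 / (8 * s)) (by positivity) d
  rw [Real.exp_neg, ← div_eq_mul_inv, div_le_iff₀ (Real.exp_pos _)]
  have hf : (0 : ℝ) < d.factorial := by positivity
  calc (s ^ d)⁻¹ = 8 ^ d * d.factorial * ((1 / (8 * s)) ^ d / d.factorial) := by
        rw [one_div, inv_pow, mul_pow]
        field_simp
    _ ≤ _ := by gcongr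

/-- The top part of the decomposition. Relative to `e^{2‖y‖²} dγ_d` the Mehler kernel is at most
`s^{-d}`, where `s = ouStd σ`, and is bounded at distances above `√s`. Nearer the diagonal only a
power of `1/s` is available, and log-Hölder continuity absorbs it: the oscillation of `p` on a ball
of radius `√s` is `O(1 / log(1/s))`. -/
theorem exists_luxNorm_ouPos_le_of_large (hp : IsAdmissible p) :
    ∃ C : ℝ≥0, ∀ σ > 0, ∀ F : E d → ℝ≥0∞, Measurable F → (∀ y, F y = 0 ∨ 1 ≤ F y) →
    ∫⁻ y, F y * ENNReal.ofReal (Real.exp (2 * ‖y‖ ^ 2)) ∂(gauss d) ≤ 1 →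
    modular (gauss d) p F ≤ 1 → luxNorm (gauss d) p (ouPos σ F) ≤ C := by
  obtain ⟨L, hL, hLH⟩ := hp.logHolder
  set K0 : ℝ := 8 ^ d * d.factorial with hK0
  have hK0' : 0 < K0 := by positivity
  set K1 : ℝ := 2 ^ d with hK1
  set K2 : ℝ := Real.exp (2 * d * L) with hK2
  have hK2' : 1 ≤ K2 := Real.one_le_exp (by positivity)
  refine ⟨(K0 + K1 + K2).toNNReal, fun σ hσ F hF hF1 hexp hmod => ?_⟩
  have hτ := ouStd_pos hσ
  have hcoe : ((K0 + K1 + K2).toNNReal : ℝ≥0∞) = ENNReal.ofReal (K0 + K1 + K2) := rfl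
  rw [hcoe]
  have hK1' : 0 < K1 := by positivity
  have hall : ∀ G : E d → ℝ≥0∞, Measurable G → (∀ y, G y ≤ F y) → ∀ x κ,
      (∀ y, G y ≠ 0 → κ ≤ ‖y‖ ^ 2 + ‖y - Real.exp (-σ) • x‖ ^ 2 / ouStd σ ^ 2) →
      ouPos σ G x ≤ ENNReal.ofReal ((ouStd σ ^ d)⁻¹ * Real.exp (-κ)) := by
    intro G hG hGF x κ hκ
    refine (ouPos_le_of_support hG hσ x hκ).trans ?_
    calc _ ≤ ENNReal.ofReal ((ouStd σ ^ d)⁻¹ * Real.exp (-κ)) * 1 := by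
          gcongr
          refine (lintegral_mono fun y => ?_).trans hexp
          gcongr
          exact hGF y
      _ = _ := mul_one _
  rcases le_total (1 / 2) (ouStd σ ^ 2) with hs | hs
  · have hs2 : 1 / 2 ≤ ouStd σ := by nlinarith [ouStd_sq_add hσ, Real.exp_pos (-σ)]
    refine (luxNorm_mono hp.ae_one_le (G := fun _ => ENNReal.ofReal K1) (.of_forall fun x => ?_)).trans
      ((luxNorm_const_le (by simpa using hK1') ENNReal.ofReal_lt_top).trans ?_)
    · refine (hall F hF (fun _ => le_rfl) x 0 fun y _ => by positivity).trans ?_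
      gcongr
      rw [neg_zero, Real.exp_zero, mul_one, hK1, ← inv_pow]
      gcongr
      rw [inv_le_comm₀ hτ two_pos]
      linarith
    · gcongr
      linarith
  -- This radius is large enough for an exponential gain beyond it, and being a power of `ouStd σ`
  -- it has a logarithm comparable to that of `ouStd σ`.
  set δ := Real.sqrt (ouStd σ) with hδ
  have hδ0 : 0 < δ := Real.sqrt_pos.2 hτ
  set near : E d → ℝ≥0∞ := fun x =>
    ouPos σ (fun y => (Metric.closedBall x δ).indicator F y) x with hnear
  have hballm : ∀ x : E d, Measurable fun y => (Metric.closedBall x δ).indicator F y := fun x =>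
    hF.indicator measurableSet_closedBall
  have hnearm : Measurable near := by
    have h1 : Measurable (fun w : E d × E d => {w : E d × E d |
        dist (ouStd σ • w.2 + Real.exp (-σ) • w.1) w.1 ≤ δ}.indicator
          (fun w => F (ouStd σ • w.2 + Real.exp (-σ) • w.1)) w) :=
      Measurable.indicator (by fun_prop) (measurableSet_le (by fun_prop) measurable_const)
    exact h1.lintegral_prod_right'
  have hfar : ∀ x, ouPos σ F x ≤ near x + ENNReal.ofReal K0 := by
    intro x
    have hsplit : ∀ y, F y = (Metric.closedBall x δ).indicator F y +
        (Metric.closedBall x δ)ᶜ.indicator F y := fun y =>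
      (congrFun (Set.indicator_self_add_compl (Metric.closedBall x δ) F) y).symm
    have h1 : ouPos σ F x = near x + ouPos σ ((Metric.closedBall x δ)ᶜ.indicator F) x := by
      rw [hnear, ← ouPos_add (hballm x)]
      exact lintegral_congr fun u => hsplit _
    rw [h1]
    gcongr
    refine (hall _ (hF.indicator measurableSet_closedBall.compl)
      (fun y => Set.indicator_le_self _ _ _) x (1 / (8 * ouStd σ)) fun y hy => ?_).trans ?_
    · have hy' := Set.mem_of_indicator_ne_zero hy
      refine far_exponent_le hσ hs ?_
      rw [Set.mem_compl_iff, Metric.mem_closedBall, not_le, dist_comm, dist_eq_norm] at hy'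
      exact hy'.le
    · gcongr
      exact inv_pow_mul_exp_le hτ
  have hnearmod : modular (gauss d) p near ≤ ENNReal.ofReal K2 := by
    set ω := L / Real.log (Real.exp 1 + 1 / δ) with hω
    have hlog1 := one_le_log_exp_add (y := 1 / δ) (by positivity)
    have hω0 : 0 ≤ ω := by positivity
    have hs1 : ouStd σ ≤ 1 := by nlinarith
    have hωs : ω * Real.log (ouStd σ)⁻¹ ≤ 2 * L := by
      have h1 : Real.log (ouStd σ)⁻¹ ≤ 2 * Real.log (Real.exp 1 + 1 / δ) := by
        have h2 : (ouStd σ)⁻¹ ≤ (Real.exp 1 + 1 / δ) ^ 2 := by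
          have h3 : (1 / δ) ^ 2 = (ouStd σ)⁻¹ := by
            rw [div_pow, hδ, Real.sq_sqrt hτ.le]; simp
          rw [← h3]
          gcongr
          linarith [Real.exp_pos 1]
        have := Real.log_le_log (by positivity) h2
        rwa [Real.log_pow, Nat.cast_ofNat] at this
      calc ω * Real.log (ouStd σ)⁻¹ ≤ ω * (2 * Real.log (Real.exp 1 + 1 / δ)) := by gcongr
        _ = 2 * L := by rw [hω, div_mul_eq_mul_div, div_eq_iff (by positivity)]; ring
    calc modular (gauss d) p near
        ≤ ∫⁻ x, ENNReal.ofReal K2 * ouPos σ (fun y => F y ^ p y) x ∂(gauss d) := by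
          refine lintegral_mono fun x => ?_
          -- `s` is a lower bound of `p` on the ball, kept at least `1` for Jensen. The excess power
          -- `p x - s ≤ ω` of the kernel bound is at most `K2`. In the remaining power, `F ^ s ≤ F ^
          -- p` on the ball because `F` is `0` or at least `1`.
          set s := max 1 (p x - ω) with hsdef
          have hs1 : 1 ≤ s := le_max_left _ _
          have hsp : s ≤ p x := max_le (hp.one_le x) (by linarith)
          have hps : p x - s ≤ ω := by linarith [le_max_right 1 (p x - ω)]
          have hn1 : near x ≤ ENNReal.ofReal ((ouStd σ ^ d)⁻¹) := by
            have := hall _ (hballm x) (fun y => Set.indicator_le_self _ _ _) x 0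
              fun y _ => by positivity
            simpa using this
          calc near x ^ p x = near x ^ (p x - s) * near x ^ s := by
                rw [← ENNReal.rpow_add_of_nonneg _ _ (by linarith) (by linarith)]
                congr 1
                ring
            _ ≤ _ := by
                gcongr
                · calc near x ^ (p x - s) ≤ ENNReal.ofReal ((ouStd σ ^ d)⁻¹) ^ (p x - s) := by
                        gcongr
                    _ ≤ ENNReal.ofReal ((ouStd σ ^ d)⁻¹) ^ ω := by
                        refine ENNReal.rpow_le_rpow_of_exponent_le ?_ hps
                        rw [ENNReal.one_le_ofReal, one_le_inv₀ (by positivity)]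
                        exact pow_le_one₀ hτ.le (by nlinarith)
                    _ ≤ ENNReal.ofReal K2 := by
                        rw [ENNReal.ofReal_rpow_of_pos (by positivity)]
                        refine ENNReal.ofReal_le_ofReal ?_
                        rw [Real.rpow_def_of_pos (by positivity), hK2, ← inv_pow, Real.log_pow]
                        refine Real.exp_le_exp.2 ?_
                        calc d * Real.log (ouStd σ)⁻¹ * ω = d * (ω * Real.log (ouStd σ)⁻¹) := by ring
                          _ ≤ d * (2 * L) := by gcongr
                          _ = 2 * d * L := by ring
                · refine (lintegral_rpow_le_of_mass_le_one _ hs1 (by simp)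
                    ((hballm x).comp (by fun_prop)).aemeasurable).trans (lintegral_mono fun u => ?_)
                  simp only [Function.comp_apply]
                  generalize ouStd σ • u + Real.exp (-σ) • x = y
                  by_cases hy : y ∈ Metric.closedBall x δ
                  · rw [Set.indicator_of_mem hy]
                    rcases hF1 y with h0 | h1
                    · rw [h0, ENNReal.zero_rpow_of_pos (by linarith)]
                      exact bot_le
                    refine ENNReal.rpow_le_rpow_of_exponent_le h1 (max_le (hp.one_le y) ?_)
                    rcases eq_or_ne x y with rfl | hxy
                    · linarith
                    have h2 := hLH x y hxy
                    have h3 : L / Real.log (Real.exp 1 + 1 / ‖x - y‖) ≤ ω := by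
                      rw [Metric.mem_closedBall, dist_comm, dist_eq_norm] at hy
                      have : 0 < ‖x - y‖ := norm_pos_iff.2 (sub_ne_zero.2 hxy)
                      rw [hω]
                      gcongr
                    linarith [le_abs_self (p x - p y)]
                  · rw [Set.indicator_of_notMem hy, ENNReal.zero_rpow_of_pos (by linarith)]
                    exact bot_le
      _ ≤ ENNReal.ofReal K2 * 1 := by
          rw [lintegral_const_mul' _ _ ENNReal.ofReal_ne_top,
            lintegral_ouPos (hF.pow hp.measurable) hσ]
          gcongr
          exact hmod
      _ = _ := mul_one _
  calc luxNorm (gauss d) p (ouPos σ F)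
      ≤ luxNorm (gauss d) p (fun x => near x + ENNReal.ofReal K0) :=
        luxNorm_mono hp.ae_one_le (.of_forall hfar)
    _ ≤ luxNorm (gauss d) p near + luxNorm (gauss d) p (fun _ => ENNReal.ofReal K0) :=
        luxNorm_add_le hp.measurable hp.ae_one_le hnearm measurable_const
    _ ≤ ENNReal.ofReal K2 + ENNReal.ofReal K0 := by
        gcongr
        · exact luxNorm_le_of_modular_le_const hp.ae_one_le (by simpa using hK2')
            ENNReal.ofReal_ne_top hnearmod
        · exact luxNorm_const_le (by simpa using hK0') ENNReal.ofReal_lt_top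
    _ ≤ _ := by
        rw [← ENNReal.ofReal_add (by positivity) (by positivity)]
        exact ENNReal.ofReal_le_ofReal (by linarith)

/-- Uniformity in `σ` is the point: Minkowski's inequality then transfers the bound to every
superposition of the operators `T_σ`. The function is cut at the heights `1` and `e^{A‖y‖²}`, and
each piece has its own argument. -/
theorem exists_luxNorm_ouPos_le (hp : IsAdmissible p) : ∃ C : ℝ≥0, ∀ σ > 0, ∀ F : E d → ℝ≥0∞,
    Measurable F → luxNorm (gauss d) p (ouPos σ F) ≤ C * luxNorm (gauss d) p F := by
  obtain ⟨r, hr, hrp⟩ := hp.lower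
  -- With this `A`, the cutting height to the power `r - 1` equals `e^{2‖y‖²}`. Above the height, `F
  -- e^{2‖y‖²} ≤ F ^ r ≤ F ^ p`.
  set A := 2 / (r - 1) with hA
  have hA0 : 0 < A := div_pos two_pos (by linarith)
  obtain ⟨C1, h1⟩ := exists_luxNorm_ouPos_le_of_le_exp hp hA0
  obtain ⟨C2, h2⟩ := exists_luxNorm_ouPos_le_of_large hp
  have hunit : ∀ σ > 0, ∀ F : E d → ℝ≥0∞, Measurable F → modular (gauss d) p F ≤ 1 →
      luxNorm (gauss d) p (ouPos σ F) ≤ (1 + C1 + C2 : ℝ≥0) := by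
    intro σ hσ F hF hmod
    set e : E d → ℝ≥0∞ := fun y => ENNReal.ofReal (Real.exp (A * ‖y‖ ^ 2)) with he
    have hem : Measurable e := by fun_prop
    have he1 : ∀ y, 1 ≤ e y := fun y => by
      simp only [he, ENNReal.one_le_ofReal]
      exact Real.one_le_exp (by positivity)
    set S1 : Set (E d) := {y | 1 < F y ∧ F y ≤ e y} with hS1
    set S2 : Set (E d) := {y | e y < F y} with hS2
    have hS1m : MeasurableSet S1 := (measurableSet_lt measurable_const hF).inter
      (measurableSet_le hF hem)
    have hS2m : MeasurableSet S2 := measurableSet_lt hem hF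
    have hle : ∀ y, F y ≤ 1 + (S1.indicator F y + S2.indicator F y) := by
      intro y
      by_cases hy1 : y ∈ S1
      · rw [Set.indicator_of_mem hy1]
        exact le_self_add.trans le_add_self
      by_cases hy2 : y ∈ S2
      · rw [Set.indicator_of_mem hy2]
        exact le_add_self.trans le_add_self
      refine le_trans ?_ le_self_add
      simp only [hS1, hS2, Set.mem_ofPred_eq, not_and, not_le, not_lt] at hy1 hy2
      by_contra h
      exact (hy1 (not_le.1 h)).not_ge hy2
    have hmodle : ∀ S : Set (E d), modular (gauss d) p (S.indicator F) ≤ 1 := fun S =>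
      (modular_mono hp.ae_one_le (.of_forall fun y => Set.indicator_le_self _ _ _)).trans hmod
    have hm1 : Measurable (S1.indicator F) := hF.indicator hS1m
    have hm2 : Measurable (S2.indicator F) := hF.indicator hS2m
    have hb1 : luxNorm (gauss d) p (ouPos σ (S1.indicator F)) ≤ C1 := by
      refine h1 σ hσ _ hm1 (fun y => ?_) (fun y => ?_) (hmodle S1)
      · by_cases hy : y ∈ S1
        · rw [Set.indicator_of_mem hy]; exact hy.2
        · rw [Set.indicator_of_notMem hy]; exact bot_le
      · by_cases hy : y ∈ S1
        · rw [Set.indicator_of_mem hy]; exact Or.inr hy.1.le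
        · exact Or.inl (Set.indicator_of_notMem hy _)
    have hb2 : luxNorm (gauss d) p (ouPos σ (S2.indicator F)) ≤ C2 := by
      refine h2 σ hσ _ hm2 (fun y => ?_) ?_ (hmodle S2)
      · by_cases hy : y ∈ S2
        · rw [Set.indicator_of_mem hy]; exact Or.inr ((he1 y).trans (le_of_lt hy))
        · exact Or.inl (Set.indicator_of_notMem hy _)
      · refine le_trans (lintegral_mono_ae ?_) (hmodle S2)
        filter_upwards [hrp] with y hy
        by_cases hyS : y ∈ S2
        · rw [Set.indicator_of_mem hyS]
          have hyF : e y ≤ F y := le_of_lt hyS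
          have h3 : ENNReal.ofReal (Real.exp (2 * ‖y‖ ^ 2)) = e y ^ (r - 1) := by
            simp only [he]
            rw [ENNReal.ofReal_rpow_of_pos (Real.exp_pos _), ← Real.exp_mul, hA]
            congr 2
            have : r - 1 ≠ 0 := by linarith
            field_simp
          calc F y * ENNReal.ofReal (Real.exp (2 * ‖y‖ ^ 2)) ≤ F y ^ (1 : ℝ) * F y ^ (r - 1) := by
                rw [h3, ENNReal.rpow_one]
                gcongr
            _ = F y ^ r := by
                rw [← ENNReal.rpow_add_of_nonneg _ _ zero_le_one (by linarith)]
                congr 1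
                ring
            _ ≤ F y ^ p y := ENNReal.rpow_le_rpow_of_exponent_le ((he1 y).trans hyF) hy
        · rw [Set.indicator_of_notMem hyS]
          simp
    calc luxNorm (gauss d) p (ouPos σ F)
        ≤ luxNorm (gauss d) p (fun x => 1 +
            (ouPos σ (S1.indicator F) x + ouPos σ (S2.indicator F) x)) := by
          refine luxNorm_mono hp.ae_one_le (.of_forall fun x => ?_)
          refine (ouPos_mono hle σ x).trans_eq ?_
          rw [ouPos_add measurable_const, ouPos_add hm1]
          simp [ouPos]
      _ ≤ luxNorm (gauss d) p (fun _ => 1) + (luxNorm (gauss d) p (ouPos σ (S1.indicator F)) +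
            luxNorm (gauss d) p (ouPos σ (S2.indicator F))) := by
          have m1 := measurable_ouPos hm1 σ
          have m2 := measurable_ouPos hm2 σ
          refine (luxNorm_add_le hp.measurable hp.ae_one_le measurable_const (m1.add m2)).trans ?_
          gcongr
          exact luxNorm_add_le hp.measurable hp.ae_one_le m1 m2
      _ ≤ 1 + (C1 + C2) := by
          gcongr
          exact luxNorm_const_le one_pos ENNReal.one_lt_top
      _ = _ := by push_cast; ring
  refine ⟨1 + C1 + C2, fun σ hσ F hF => ?_⟩
  refine le_mul_luxNorm (by positivity) ENNReal.coe_ne_top fun c hc0 hc hm => ?_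
  have h3 := hunit σ hσ (fun y => F y / c) (hF.div_const c) hm
  have h4 : ouPos σ F = fun x => c * ouPos σ (fun y => F y / c) x := by
    funext x
    rw [← ouPos_const_mul (hF.div_const c)]
    simp only [ENNReal.mul_div_cancel hc0.ne' hc.ne]
  rw [h4]
  refine (luxNorm_const_mul_le hp.ae_one_le _ hc.ne).trans ?_
  rw [mul_comm]
  gcongr

end OUBounded

end GaussianBesov

end

noncomputable section

namespace GaussianBesov

/-! ### The one-sided stable density of order `1/2` and its derivatives -/

section Subordinator

open Polynomial in
/-- The polynomial factors of the derivatives of `y e^{-y²/4} / (2 √π)`. -/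
def subPoly : ℕ → ℝ[X]
  | 0 => C (1 / (2 * Real.sqrt Real.pi)) * X
  | l + 1 => derivative (subPoly l) - C (1 / 2) * X * subPoly l

/-- The `l`-th derivative of `y e^{-y²/4} / (2 √π)`. -/
def subProfile (l : ℕ) (y : ℝ) : ℝ := (subPoly l).eval y * Real.exp (-y ^ 2 / 4)

/-- The `l`-th derivative in `t` of the density `t σ^{-3/2} e^{-t²/(4σ)} / (2 √π)`. -/
def subKer (l : ℕ) (t σ : ℝ) : ℝ := σ⁻¹ * (Real.sqrt σ)⁻¹ ^ l * subProfile l (t * (Real.sqrt σ)⁻¹)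

theorem hasDerivAt_subProfile (l : ℕ) (y : ℝ) :
    HasDerivAt (subProfile l) (subProfile (l + 1) y) y := by
  have h1 := (subPoly l).hasDerivAt y
  have h2 : HasDerivAt (fun y : ℝ => Real.exp (-y ^ 2 / 4))
      (Real.exp (-y ^ 2 / 4) * (-(2 * y) / 4)) y := by
    have := ((hasDerivAt_pow 2 y).neg.div_const 4).exp
    simpa using this
  refine (h1.mul h2).congr_deriv ?_
  simp only [subProfile, subPoly, Polynomial.eval_sub, Polynomial.eval_mul, Polynomial.eval_C,
    Polynomial.eval_X]
  ring

theorem continuous_subProfile (l : ℕ) : Continuous (subProfile l) :=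
  continuous_iff_continuousAt.2 fun y => (hasDerivAt_subProfile l y).continuousAt

theorem hasDerivAt_subKer (l : ℕ) (t σ : ℝ) :
    HasDerivAt (fun t => subKer l t σ) (subKer (l + 1) t σ) t := by
  have h1 : HasDerivAt (fun t : ℝ => t * (Real.sqrt σ)⁻¹) (Real.sqrt σ)⁻¹ t := by
    simpa using (hasDerivAt_id t).mul_const (Real.sqrt σ)⁻¹
  have h2 := (hasDerivAt_subProfile l (t * (Real.sqrt σ)⁻¹)).comp t h1
  refine (h2.const_mul (σ⁻¹ * (Real.sqrt σ)⁻¹ ^ l)).congr_deriv ?_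
  rw [subKer, pow_succ]
  ring

theorem measurable_subKer_uncurry (l : ℕ) : Measurable fun z : ℝ × ℝ => subKer l z.1 z.2 := by
  have := (continuous_subProfile l).measurable
  unfold subKer
  fun_prop

theorem measurable_subKer (l : ℕ) (t : ℝ) : Measurable (subKer l t) := by
  have := (continuous_subProfile l).measurable
  unfold subKer
  fun_prop

theorem subProfile_zero (y : ℝ) :
    subProfile 0 y = 1 / (2 * Real.sqrt Real.pi) * y * Real.exp (-y ^ 2 / 4) := by
  simp [subProfile, subPoly]

theorem subKer_zero_eq {t σ : ℝ} (hσ : 0 < σ) : subKer 0 t σ =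
    1 / (2 * Real.sqrt Real.pi) * t * (σ⁻¹ * (Real.sqrt σ)⁻¹) * Real.exp (-(t ^ 2 / (4 * σ))) := by
  rw [subKer, subProfile_zero, pow_zero, mul_one, mul_pow, inv_pow, Real.sq_sqrt hσ.le]
  have : -(t ^ 2 * σ⁻¹) / 4 = -(t ^ 2 / (4 * σ)) := by field_simp
  rw [this]
  ring

theorem subKer_zero_pos {t σ : ℝ} (ht : 0 < t) (hσ : 0 < σ) : 0 < subKer 0 t σ := by
  rw [subKer_zero_eq hσ]
  have : 0 < Real.sqrt σ := Real.sqrt_pos.2 hσ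
  positivity

/-- Allows densities at nearby later times to be dominated by one density at a fixed earlier time,
as differentiation under the integral requires. -/
theorem subKer_zero_le {s t σ : ℝ} (hs : 0 < s) (hst : s ≤ t) (hσ : 0 < σ) :
    subKer 0 t σ ≤ t / s * subKer 0 s σ := by
  rw [subKer_zero_eq hσ, subKer_zero_eq hσ]
  have h0 : 0 < Real.sqrt σ := Real.sqrt_pos.2 hσ
  have ht : 0 < t := hs.trans_le hst
  calc 1 / (2 * Real.sqrt Real.pi) * t * (σ⁻¹ * (Real.sqrt σ)⁻¹) * Real.exp (-(t ^ 2 / (4 * σ)))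
      ≤ 1 / (2 * Real.sqrt Real.pi) * t * (σ⁻¹ * (Real.sqrt σ)⁻¹) *
          Real.exp (-(s ^ 2 / (4 * σ))) := by gcongr
    _ = _ := by field_simp

theorem exists_pow_mul_exp_neg_sq_le (n : ℕ) {c : ℝ} (hc : 0 < c) :
    ∃ C, ∀ y : ℝ, 0 ≤ y → y ^ n * Real.exp (-(c * y ^ 2)) ≤ C := by
  refine ⟨1 + n.factorial / c ^ n, fun y hy => ?_⟩
  have h := Real.pow_div_factorial_le_exp (c * y ^ 2) (by positivity) n
  rw [Real.exp_neg, ← div_eq_mul_inv, div_le_iff₀ (Real.exp_pos _)]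
  have h1 : y ^ n ≤ 1 + (y ^ 2) ^ n := by
    rw [← pow_mul, mul_comm, pow_mul]
    nlinarith [sq_nonneg (y ^ n - 1), pow_nonneg hy n]
  have h2 : (y ^ 2) ^ n ≤ n.factorial / c ^ n * Real.exp (c * y ^ 2) := by
    calc (y ^ 2) ^ n = n.factorial / c ^ n * ((c * y ^ 2) ^ n / n.factorial) := by
          rw [mul_pow]; field_simp
      _ ≤ _ := by gcongr
  have h3 : 1 ≤ Real.exp (c * y ^ 2) := Real.one_le_exp (by positivity)
  linarith

theorem exists_eval_mul_exp_neg_sq_le (R : Polynomial ℝ) {c : ℝ} (hc : 0 < c) :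
    ∃ C, ∀ y : ℝ, 0 ≤ y → |R.eval y| * Real.exp (-(c * y ^ 2)) ≤ C := by
  induction R using Polynomial.induction_on' with
  | add P Q hP hQ =>
    obtain ⟨A, hA⟩ := hP
    obtain ⟨B, hB⟩ := hQ
    refine ⟨A + B, fun y hy => ?_⟩
    have h1 := hA y hy
    have h2 := hB y hy
    rw [Polynomial.eval_add]
    calc _ ≤ (|P.eval y| + |Q.eval y|) * Real.exp (-(c * y ^ 2)) := by
          gcongr; exact abs_add_le _ _
      _ ≤ _ := by linarith
  | monomial n a =>
    obtain ⟨A, hA⟩ := exists_pow_mul_exp_neg_sq_le n hc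
    refine ⟨|a| * A, fun y hy => ?_⟩
    rw [Polynomial.eval_monomial, abs_mul, abs_of_nonneg (pow_nonneg hy n), mul_assoc]
    gcongr
    exact hA y hy

/-- Halving the argument weakens `e^{-y²/4}` to `e^{-y²/16}`, and the spare factor `e^{-3y²/16}`
absorbs every polynomial. For `l ≥ 1` the zero of `subProfile 0` at the origin is compensated by one
power in `y^{-l}`; for `l = 0` the polynomial `y` itself provides it, hence the two cases. -/
theorem exists_subProfile_le (l : ℕ) : ∃ C > 0, ∀ y : ℝ, 0 < y →
    |subProfile l y| ≤ C * (y ^ l)⁻¹ * subProfile 0 (y / 2) := by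
  have hpi : 0 < Real.sqrt Real.pi := Real.sqrt_pos.2 Real.pi_pos
  cases l with
  | zero =>
    refine ⟨2, two_pos, fun y hy => ?_⟩
    rw [subProfile_zero, subProfile_zero, abs_of_pos (by positivity)]
    calc 1 / (2 * Real.sqrt Real.pi) * y * Real.exp (-y ^ 2 / 4)
        ≤ 1 / (2 * Real.sqrt Real.pi) * y * Real.exp (-(y / 2) ^ 2 / 4) := by
          gcongr
          linarith
      _ = _ := by simp; ring
  | succ l =>
    obtain ⟨C, hC⟩ := exists_eval_mul_exp_neg_sq_le (Polynomial.X ^ l * subPoly (l + 1))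
      (c := 3 / 16) (by norm_num)
    refine ⟨(|C| + 1) * (4 * Real.sqrt Real.pi), by positivity, fun y hy => ?_⟩
    have h := hC y hy.le
    rw [Polynomial.eval_mul, Polynomial.eval_pow, Polynomial.eval_X, abs_mul,
      abs_of_pos (by positivity)] at h
    rw [subProfile, abs_mul, abs_of_pos (Real.exp_pos _), subProfile_zero]
    have hexp : Real.exp (-y ^ 2 / 4) =
        Real.exp (-(3 / 16 * y ^ 2)) * Real.exp (-(y / 2) ^ 2 / 4) := by
      rw [← Real.exp_add]; ring_nf
    rw [hexp]
    have h2 : y ^ l * |(subPoly (l + 1)).eval y| * Real.exp (-(3 / 16 * y ^ 2)) ≤ |C| + 1 := by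
      linarith [le_abs_self C]
    calc _ = (y ^ l)⁻¹ * (y ^ l * |(subPoly (l + 1)).eval y| * Real.exp (-(3 / 16 * y ^ 2))) *
          Real.exp (-(y / 2) ^ 2 / 4) := by field_simp
      _ ≤ (y ^ l)⁻¹ * (|C| + 1) * Real.exp (-(y / 2) ^ 2 / 4) := by gcongr
      _ = _ := by
          rw [pow_succ]
          field_simp
          ring

/-- The scaled form of the profile bound, and the source of `‖∂_t^l P_t‖ ≤ C t^{-l}`: a derivative
of the density is dominated by a positive density at half the time, which again has mass `1`. -/
theorem exists_subKer_le (l : ℕ) : ∃ C > 0, ∀ t σ : ℝ, 0 < t → 0 < σ →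
    |subKer l t σ| ≤ C * (t ^ l)⁻¹ * subKer 0 (t / 2) σ := by
  obtain ⟨C, hC, h⟩ := exists_subProfile_le l
  refine ⟨C, hC, fun t σ ht hσ => ?_⟩
  have h0 : 0 < Real.sqrt σ := Real.sqrt_pos.2 hσ
  have h1 := h (t * (Real.sqrt σ)⁻¹) (by positivity)
  rw [subKer, subKer, abs_mul, abs_of_pos (by positivity), pow_zero, mul_one]
  calc σ⁻¹ * (Real.sqrt σ)⁻¹ ^ l * |subProfile l (t * (Real.sqrt σ)⁻¹)|
      ≤ σ⁻¹ * (Real.sqrt σ)⁻¹ ^ l * (C * ((t * (Real.sqrt σ)⁻¹) ^ l)⁻¹ *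
        subProfile 0 (t * (Real.sqrt σ)⁻¹ / 2)) := by gcongr
    _ = _ := by
        rw [mul_pow, mul_inv, show t * (Real.sqrt σ)⁻¹ / 2 = t / 2 * (Real.sqrt σ)⁻¹ by ring]
        field_simp

/-! ### Change of variables and the Laplace transform -/

theorem image_div_Ioi {c : ℝ} (hc : 0 < c) : (fun u : ℝ => c / u) '' Set.Ioi 0 = Set.Ioi 0 := by
  ext y
  simp only [Set.mem_image, Set.mem_Ioi]
  constructor
  · rintro ⟨u, hu, rfl⟩
    positivity
  · intro hy
    exact ⟨c / y, by positivity, by field_simp⟩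

theorem injOn_div {c : ℝ} (hc : 0 < c) : Set.InjOn (fun u : ℝ => c / u) (Set.Ioi 0) := by
  intro a ha b hb hab
  simp only [Set.mem_Ioi] at ha hb
  simp only at hab
  field_simp at hab
  exact hab.symm

theorem hasDerivWithinAt_div {c u : ℝ} (hu : 0 < u) (s : Set ℝ) :
    HasDerivWithinAt (fun u : ℝ => c / u) (-(c / u ^ 2)) s u := by
  have := ((hasDerivAt_inv hu.ne').const_mul c).hasDerivWithinAt (s := s)
  refine this.congr_deriv ?_
  field_simp

/-- The substitution `σ = t²/(4u)` moves all dependence on `t` into the kernel, so that time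
derivatives never act on `f`. -/
theorem integral_subKer_zero_mul {t : ℝ} (ht : 0 < t) (H : ℝ → ℝ) :
    ∫ σ in Set.Ioi 0, subKer 0 t σ * H σ = 1 / Real.sqrt Real.pi *
      ∫ u in Set.Ioi 0, Real.exp (-u) / Real.sqrt u * H (t ^ 2 / (4 * u)) := by
  have hc : 0 < t ^ 2 / 4 := by positivity
  have h := integral_image_eq_integral_abs_deriv_smul measurableSet_Ioi
    (fun u hu => hasDerivWithinAt_div (c := t ^ 2 / 4) hu _) (injOn_div hc)
    (fun σ => subKer 0 t σ * H σ)
  rw [image_div_Ioi hc] at h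
  rw [h, ← integral_const_mul]
  refine setIntegral_congr_fun measurableSet_Ioi fun u hu => ?_
  have hu' : 0 < u := hu
  have hs : 0 < Real.sqrt u := Real.sqrt_pos.2 hu'
  have hpi : 0 < Real.sqrt Real.pi := Real.sqrt_pos.2 Real.pi_pos
  simp only [smul_eq_mul]
  rw [subKer_zero_eq (by positivity), abs_neg, abs_of_pos (by positivity),
    show t ^ 2 / 4 / u = t ^ 2 / (4 * u) by field_simp]
  have h1 : t ^ 2 / (4 * (t ^ 2 / (4 * u))) = u := by field_simp
  have h2 : Real.sqrt (t ^ 2 / (4 * u)) = t / (2 * Real.sqrt u) := by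
    rw [Real.sqrt_div' _ (by positivity), Real.sqrt_sq ht.le, Real.sqrt_mul' _ hu'.le]
    congr 2
    rw [show (4 : ℝ) = 2 ^ 2 by norm_num, Real.sqrt_sq two_pos.le]
  rw [h1, h2]
  have h3 : u = Real.sqrt u ^ 2 := (Real.sq_sqrt hu'.le).symm
  generalize Real.exp (-u) = e
  generalize H (t ^ 2 / (4 * u)) = w
  set s := Real.sqrt u
  rw [h3]
  field_simp

/-- The map `v ↦ v - c/v` is a bijection of `(0, ∞)` onto `ℝ` with derivative `1 + c/v²`, so the
integral with this factor is `√π`. The inversion `v ↦ c/v` shows that the summands `1` and `c/v²`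
contribute equally. -/
theorem integral_exp_neg_sub_div_sq {c : ℝ} (hc : 0 < c) :
    ∫ v in Set.Ioi 0, Real.exp (-(v - c / v) ^ 2) = Real.sqrt Real.pi / 2 := by
  have hder : ∀ v ∈ Set.Ioi (0 : ℝ), HasDerivWithinAt (fun v : ℝ => v - c / v) (1 + c / v ^ 2)
      (Set.Ioi 0) v := fun v hv => by
    refine ((hasDerivAt_id v).hasDerivWithinAt.sub (hasDerivWithinAt_div hv _)).congr_deriv ?_
    ring
  have hinj : Set.InjOn (fun v : ℝ => v - c / v) (Set.Ioi 0) := by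
    intro a ha b hb hab
    simp only [Set.mem_Ioi] at ha hb
    simp only at hab
    have h1 : (a - b) * (1 + c / (a * b)) = 0 := by
      field_simp at hab ⊢
      linarith
    have h2 : 0 < 1 + c / (a * b) := by positivity
    rcases mul_eq_zero.1 h1 with h | h
    · linarith
    · linarith
  have himg : (fun v : ℝ => v - c / v) '' Set.Ioi 0 = Set.univ := by
    refine Set.eq_univ_of_forall fun y => ?_
    set D := Real.sqrt (y ^ 2 + 4 * c) with hD
    have hD2 : D ^ 2 = y ^ 2 + 4 * c := Real.sq_sqrt (by positivity)
    have hD0 : 0 ≤ D := Real.sqrt_nonneg _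
    have hDy : |y| < D := abs_lt_of_sq_lt_sq (by linarith) hD0
    have hpos : 0 < y + D := by linarith [neg_abs_le y]
    refine ⟨(y + D) / 2, by simpa using by positivity, ?_⟩
    simp only
    field_simp
    nlinarith
  have hgauss : Integrable (fun y : ℝ => Real.exp (-y ^ 2)) := by
    simpa using integrable_exp_neg_mul_sq one_pos
  have hint : IntegrableOn (fun v : ℝ => |1 + c / v ^ 2| • Real.exp (-(v - c / v) ^ 2))
      (Set.Ioi 0) := by
    rw [← integrableOn_image_iff_integrableOn_abs_deriv_smul measurableSet_Ioi hder hinj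
      (fun y => Real.exp (-y ^ 2)), himg]
    exact hgauss.integrableOn
  have htot : ∫ v in Set.Ioi 0, |1 + c / v ^ 2| • Real.exp (-(v - c / v) ^ 2) =
      Real.sqrt Real.pi := by
    rw [← integral_image_eq_integral_abs_deriv_smul measurableSet_Ioi hder hinj
      (fun y => Real.exp (-y ^ 2)), himg, Measure.restrict_univ]
    simpa using integral_gaussian 1
  have hmeas : Measurable fun v : ℝ => Real.exp (-(v - c / v) ^ 2) := by fun_prop
  have hI1 : IntegrableOn (fun v : ℝ => Real.exp (-(v - c / v) ^ 2)) (Set.Ioi 0) := by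
    refine hint.mono' hmeas.aestronglyMeasurable ?_
    filter_upwards [ae_restrict_mem measurableSet_Ioi] with v hv
    have hv' : 0 < v := hv
    rw [Real.norm_of_nonneg (Real.exp_pos _).le, smul_eq_mul]
    refine le_mul_of_one_le_left (Real.exp_pos _).le ?_
    rw [abs_of_pos (by positivity)]
    have : 0 ≤ c / v ^ 2 := by positivity
    linarith
  have hswap : ∫ v in Set.Ioi 0, Real.exp (-(v - c / v) ^ 2) =
      ∫ v in Set.Ioi 0, c / v ^ 2 * Real.exp (-(v - c / v) ^ 2) := by
    have h := integral_image_eq_integral_abs_deriv_smul measurableSet_Ioi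
      (fun u hu => hasDerivWithinAt_div (c := c) hu _) (injOn_div hc)
      (fun v => Real.exp (-(v - c / v) ^ 2))
    rw [image_div_Ioi hc] at h
    rw [h]
    refine setIntegral_congr_fun measurableSet_Ioi fun v hv => ?_
    have hv' : 0 < v := hv
    simp only [smul_eq_mul]
    rw [abs_neg, abs_of_pos (by positivity), div_div_cancel₀ hc.ne', ← neg_sub, neg_sq]
  have hI2 : IntegrableOn (fun v : ℝ => c / v ^ 2 * Real.exp (-(v - c / v) ^ 2)) (Set.Ioi 0) := by
    refine (hint.sub hI1).congr_fun (fun v hv => ?_) measurableSet_Ioi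
    have hv' : 0 < v := hv
    simp only [Pi.sub_apply, smul_eq_mul]
    rw [abs_of_pos (by positivity)]
    ring
  have hsum : ∫ v in Set.Ioi 0, |1 + c / v ^ 2| • Real.exp (-(v - c / v) ^ 2) =
      (∫ v in Set.Ioi 0, Real.exp (-(v - c / v) ^ 2)) +
      ∫ v in Set.Ioi 0, c / v ^ 2 * Real.exp (-(v - c / v) ^ 2) := by
    rw [← integral_add hI1 hI2]
    refine setIntegral_congr_fun measurableSet_Ioi fun v hv => ?_
    have hv' : 0 < v := hv
    simp only [smul_eq_mul]
    rw [abs_of_pos (by positivity)]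
    ring
  linarith

/-- After `u = v²`, complete the square: `v² + c²/v² = (v - c/v)² + 2c`. -/
theorem integral_exp_neg_div_sqrt {c : ℝ} (hc : 0 ≤ c) :
    ∫ u in Set.Ioi 0, Real.exp (-u) / Real.sqrt u * Real.exp (-(c ^ 2 / u)) =
      Real.sqrt Real.pi * Real.exp (-(2 * c)) := by
  rw [← integral_comp_rpow_Ioi_of_pos (p := 2) two_pos]
  have h1 : ∀ v ∈ Set.Ioi (0 : ℝ), ((2 : ℝ) * v ^ ((2 : ℝ) - 1)) •
      (Real.exp (-v ^ (2 : ℝ)) / Real.sqrt (v ^ (2 : ℝ)) * Real.exp (-(c ^ 2 / v ^ (2 : ℝ)))) =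
      2 * Real.exp (-(2 * c)) * Real.exp (-(v - c / v) ^ 2) := by
    intro v hv
    have hv' : 0 < v := hv
    rw [show (2 : ℝ) - 1 = 1 by norm_num, Real.rpow_one, Real.rpow_two, Real.sqrt_sq hv'.le,
      smul_eq_mul, mul_assoc 2 (Real.exp _), ← Real.exp_add]
    have : -(2 * c) + -(v - c / v) ^ 2 = -v ^ 2 + -(c ^ 2 / v ^ 2) := by
      field_simp
      ring
    rw [this, Real.exp_add]
    field_simp
  rw [setIntegral_congr_fun measurableSet_Ioi h1, integral_const_mul]
  rcases hc.eq_or_lt with rfl | hc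
  · have := integral_gaussian_Ioi 1
    simp only [neg_mul, one_mul, div_one] at this
    simp only [zero_div, sub_zero, this]
    ring
  · rw [integral_exp_neg_sub_div_sq hc]
    ring

/-- The Laplace transform of the stable density of order `1/2`. -/
theorem integral_subKer_zero_mul_exp {t : ℝ} (ht : 0 < t) {lam : ℝ} (hl : 0 ≤ lam) :
    ∫ σ in Set.Ioi 0, subKer 0 t σ * Real.exp (-(lam * σ)) = Real.exp (-(t * Real.sqrt lam)) := by
  rw [integral_subKer_zero_mul ht]
  have h := integral_exp_neg_div_sqrt (c := t * Real.sqrt lam / 2) (by positivity)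
  have h1 : ∀ u : ℝ, lam * (t ^ 2 / (4 * u)) = (t * Real.sqrt lam / 2) ^ 2 / u := by
    intro u
    rw [div_pow, mul_pow, Real.sq_sqrt hl]
    ring
  simp only [h1]
  have hpi : 0 < Real.sqrt Real.pi := Real.sqrt_pos.2 Real.pi_pos
  rw [h, show 2 * (t * Real.sqrt lam / 2) = t * Real.sqrt lam by ring]
  field_simp

theorem integral_subKer_zero {t : ℝ} (ht : 0 < t) : ∫ σ in Set.Ioi 0, subKer 0 t σ = 1 := by
  simpa using integral_subKer_zero_mul_exp ht le_rfl

/-- A function that is not integrable has integral `0` by convention, while here the value is `1`.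
-/
theorem integrableOn_subKer_zero {t : ℝ} (ht : 0 < t) :
    IntegrableOn (subKer 0 t) (Set.Ioi 0) := by
  by_contra h
  have := integral_subKer_zero ht
  rw [integral_undef h] at this
  exact zero_ne_one this

theorem lintegral_subKer_zero {t : ℝ} (ht : 0 < t) :
    ∫⁻ σ in Set.Ioi 0, ENNReal.ofReal (subKer 0 t σ) = 1 := by
  rw [← ofReal_integral_eq_lintegral_ofReal (integrableOn_subKer_zero ht), integral_subKer_zero ht,
    ENNReal.ofReal_one]
  filter_upwards [ae_restrict_mem measurableSet_Ioi] with σ hσ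
  exact (subKer_zero_pos ht hσ).le

theorem exists_lintegral_subKer_le (l : ℕ) : ∃ C : ℝ≥0, ∀ t : ℝ, 0 < t →
    ∫⁻ σ in Set.Ioi 0, ‖subKer l t σ‖ₑ ≤ C * ENNReal.ofReal ((t ^ l)⁻¹) := by
  obtain ⟨C, hC, h⟩ := exists_subKer_le l
  refine ⟨C.toNNReal, fun t ht => ?_⟩
  calc ∫⁻ σ in Set.Ioi 0, ‖subKer l t σ‖ₑ
      ≤ ∫⁻ σ in Set.Ioi 0, ENNReal.ofReal (C * (t ^ l)⁻¹) * ENNReal.ofReal (subKer 0 (t / 2) σ) := by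
        refine setLIntegral_mono' measurableSet_Ioi fun σ hσ => ?_
        rw [← ENNReal.ofReal_mul (by positivity), Real.enorm_eq_ofReal_abs]
        exact ENNReal.ofReal_le_ofReal (h t σ ht hσ)
    _ = ENNReal.ofReal (C * (t ^ l)⁻¹) := by
        rw [lintegral_const_mul' _ _ ENNReal.ofReal_ne_top, lintegral_subKer_zero (by positivity),
          mul_one]
    _ = _ := by rw [ENNReal.ofReal_mul hC.le]; rfl

/-- Differentiation under the integral sign. -/
theorem integrableOn_subKer_mul_and_hasDerivAt {H : ℝ → ℝ} (hH : Measurable H)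
    (hint : ∀ t > 0, IntegrableOn (fun σ => subKer 0 t σ * H σ) (Set.Ioi 0)) (l : ℕ) {t : ℝ}
    (ht : 0 < t) :
    IntegrableOn (fun σ => subKer l t σ * H σ) (Set.Ioi 0) ∧
      HasDerivAt (fun t => ∫ σ in Set.Ioi 0, subKer l t σ * H σ)
        (∫ σ in Set.Ioi 0, subKer (l + 1) t σ * H σ) t := by
  have hm : ∀ l t, AEStronglyMeasurable (fun σ => subKer l t σ * H σ)
      (volume.restrict (Set.Ioi 0)) := fun l t =>
    ((measurable_subKer l t).mul hH).aestronglyMeasurable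
  have hI : ∀ l, ∀ t > 0, IntegrableOn (fun σ => subKer l t σ * H σ) (Set.Ioi 0) := by
    intro l t ht
    obtain ⟨C, hC, h⟩ := exists_subKer_le l
    refine ((hint (t / 2) (by positivity)).norm.const_mul (C * (t ^ l)⁻¹)).mono' (hm l t) ?_
    filter_upwards [ae_restrict_mem measurableSet_Ioi] with σ hσ
    rw [norm_mul, norm_mul, ← mul_assoc, Real.norm_eq_abs (subKer 0 _ _),
      abs_of_pos (subKer_zero_pos (by positivity) hσ)]
    gcongr
    exact h t σ ht hσ
  refine ⟨hI l t ht, ?_⟩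
  obtain ⟨C, hC, h⟩ := exists_subKer_le (l + 1)
  have hball : Metric.ball t (t / 2) ∈ 𝓝 t := Metric.ball_mem_nhds _ (by positivity)
  refine (hasDerivAt_integral_of_dominated_loc_of_deriv_le (F := fun t σ => subKer l t σ * H σ)
    (F' := fun t σ => subKer (l + 1) t σ * H σ)
    -- For `s` within `t/2` of `t`, the derivative is controlled by the density at `s/2`, which lies
    -- between `t/4` and `3t/4`. The ratio of these times is the factor `3`.
    (bound := fun σ => C * ((t / 2) ^ (l + 1))⁻¹ * 3 * ‖subKer 0 (t / 4) σ * H σ‖)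
    hball (.of_forall fun s => hm l s) (hI l t ht) (hm (l + 1) t) ?_
    ((hint (t / 4) (by positivity)).norm.const_mul _)
    (.of_forall fun σ s _ => (hasDerivAt_subKer l s σ).mul_const _)).2
  filter_upwards [ae_restrict_mem measurableSet_Ioi] with σ hσ s hs
  rw [Metric.mem_ball, Real.dist_eq, abs_lt] at hs
  have hs1 : t / 2 < s := by linarith
  have hs2 : s < 3 * t / 2 := by linarith
  have hs0 : 0 < s := by linarith
  rw [norm_mul, norm_mul, ← mul_assoc, Real.norm_eq_abs (subKer 0 _ _),
      abs_of_pos (subKer_zero_pos (by positivity) hσ)]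
  gcongr
  refine (h s σ hs0 hσ).trans ?_
  have h1 := subKer_zero_le (s := t / 4) (t := s / 2) (by positivity) (by linarith) hσ
  have h2 : s / 2 / (t / 4) ≤ 3 := by
    rw [div_le_iff₀ (by positivity)]
    linarith
  have h3 := subKer_zero_pos (t := t / 4) (by positivity) hσ
  calc C * (s ^ (l + 1))⁻¹ * subKer 0 (s / 2) σ
      ≤ C * ((t / 2) ^ (l + 1))⁻¹ * (3 * subKer 0 (t / 4) σ) := by
        gcongr
        · exact (subKer_zero_pos (by positivity) hσ).le
        · exact h1.trans (by gcongr)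
    _ = _ := by ring

end Subordinator

end GaussianBesov

end

noncomputable section

namespace GaussianBesov

/-! ### Convolution of stable densities -/

section Convolution

open BoundedContinuousFunction in
/-- A finite measure on `[0, ∞)` is determined by its Laplace transform at the integers. -/
theorem measure_ext_of_laplace {P Q : Measure ℝ≥0} [IsFiniteMeasure P] [IsFiniteMeasure Q]
    (h : ∀ n : ℕ, ∫ x, Real.exp (-(x : ℝ)) ^ n ∂P = ∫ x, Real.exp (-(x : ℝ)) ^ n ∂Q) : P = Q := by
  set φ : ℝ≥0 →ᵇ ℝ := BoundedContinuousFunction.ofNormedAddCommGroup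
    (fun x : ℝ≥0 => Real.exp (-(x : ℝ))) (by fun_prop) 1 (fun x => by
      rw [Real.norm_of_nonneg (Real.exp_pos _).le]
      exact Real.exp_le_one_iff.2 (by simp)) with hφ
  have hφx : ∀ x, φ x = Real.exp (-(x : ℝ)) := fun x => rfl
  -- The polynomials in `e^{-x}` form an algebra that separates points, so their integrals determine
  -- a finite measure.
  let A : StarSubalgebra ℝ (ℝ≥0 →ᵇ ℝ) :=
    { (Polynomial.aeval (R := ℝ) φ).range with
      star_mem' := by
        intro a ha
        have : star a = a := by ext x; simp
        rw [this]
        exact ha }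
  refine ext_of_forall_mem_subalgebra_integral_eq_of_polish (𝕜 := ℝ) (A := A) ?_ ?_
  · intro x y hxy
    refine ⟨φ, ⟨φ.toContinuousMap, ⟨φ, ⟨Polynomial.X, by simp⟩, rfl⟩, rfl⟩, ?_⟩
    simp only [hφx]
    intro hxy'
    exact hxy (by simpa using hxy')
  · rintro g ⟨R, rfl⟩
    have hg : ∀ x, (Polynomial.aeval (R := ℝ) φ R) x =
        ∑ i ∈ R.support, R.coeff i * Real.exp (-(x : ℝ)) ^ i := by
      intro x
      rw [Polynomial.aeval_def, Polynomial.eval₂_eq_sum, Polynomial.sum]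
      simp [hφx]
    have hint : ∀ (M : Measure ℝ≥0) [IsFiniteMeasure M] (i : ℕ),
        Integrable (fun x : ℝ≥0 => R.coeff i * Real.exp (-(x : ℝ)) ^ i) M := by
      intro M _ i
      have := (φ ^ i).integrable M
      exact this.const_mul _
    show ∫ x, (Polynomial.aeval (R := ℝ) φ R) x ∂P = ∫ x, (Polynomial.aeval (R := ℝ) φ R) x ∂Q
    simp only [hg]
    rw [integral_finsetSum _ fun i _ => hint P i, integral_finsetSum _ fun i _ => hint Q i]
    simp only [integral_const_mul, h]

/-- The one-sided stable law of order `1/2`. -/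
def subMeasure (t : ℝ) : Measure ℝ :=
  (volume.restrict (Set.Ioi 0)).withDensity fun σ => ENNReal.ofReal (subKer 0 t σ)

theorem isProbabilityMeasure_subMeasure {t : ℝ} (ht : 0 < t) :
    IsProbabilityMeasure (subMeasure t) := by
  constructor
  rw [subMeasure, withDensity_apply _ MeasurableSet.univ, Measure.restrict_univ,
    lintegral_subKer_zero ht]

theorem integral_subMeasure {t : ℝ} (ht : 0 < t) (H : ℝ → ℝ) :
    ∫ σ, H σ ∂(subMeasure t) = ∫ σ in Set.Ioi 0, subKer 0 t σ * H σ := by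
  rw [subMeasure, integral_withDensity_eq_integral_toReal_smul
    (measurable_subKer 0 t).ennreal_ofReal (.of_forall fun _ => ENNReal.ofReal_lt_top)]
  refine setIntegral_congr_fun measurableSet_Ioi fun σ hσ => ?_
  simp only [smul_eq_mul]
  rw [ENNReal.toReal_ofReal (subKer_zero_pos ht hσ).le]

theorem ae_subMeasure_pos (t : ℝ) : ∀ᵐ σ ∂(subMeasure t), 0 < σ :=
  (withDensity_absolutelyContinuous _ _).ae_le (ae_restrict_mem measurableSet_Ioi)

/-- The Laplace transform `λ ↦ e^{-t√λ}` is multiplicative in `t`, so the laws form a convolution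
semigroup. They are carried by `(0, ∞)`, hence nothing is lost in passing to `ℝ≥0` and back for the
uniqueness theorem. -/
theorem map_add_subMeasure {s t : ℝ} (hs : 0 < s) (ht : 0 < t) :
    ((subMeasure s).prod (subMeasure t)).map (fun z => z.1 + z.2) = subMeasure (s + t) := by
  have := isProbabilityMeasure_subMeasure hs
  have := isProbabilityMeasure_subMeasure ht
  have := isProbabilityMeasure_subMeasure (add_pos hs ht)
  have hmadd : Measurable fun z : ℝ × ℝ => z.1 + z.2 := by fun_prop
  set M := ((subMeasure s).prod (subMeasure t)).map (fun z => z.1 + z.2) with hM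
  have : IsProbabilityMeasure M := Measure.isProbabilityMeasure_map hmadd.aemeasurable
  have hMpos : ∀ᵐ σ ∂M, 0 < σ := by
    rw [hM, ae_map_iff hmadd.aemeasurable measurableSet_Ioi]
    have h1 : ∀ᵐ z ∂((subMeasure s).prod (subMeasure t)), 0 < z.1 :=
      Measure.quasiMeasurePreserving_fst.ae (ae_subMeasure_pos s)
    have h2 : ∀ᵐ z ∂((subMeasure s).prod (subMeasure t)), 0 < z.2 :=
      Measure.quasiMeasurePreserving_snd.ae (ae_subMeasure_pos t)
    filter_upwards [h1, h2] with z hz1 hz2 using add_pos hz1 hz2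
  have hlap : ∀ {r : ℝ}, 0 < r → ∀ n : ℕ, ∫ σ, Real.exp (-σ) ^ n ∂(subMeasure r) =
      Real.exp (-(r * Real.sqrt n)) := by
    intro r hr n
    rw [integral_subMeasure hr, ← integral_subKer_zero_mul_exp hr (Nat.cast_nonneg n)]
    refine integral_congr_ae (.of_forall fun σ => ?_)
    simp only [← Real.exp_nat_mul, mul_neg]
  have hNN : ∀ (S : Measure ℝ), (∀ᵐ σ ∂S, 0 < σ) → ∀ n : ℕ,
      ∫ x, Real.exp (-(x : ℝ)) ^ n ∂(S.map Real.toNNReal) = ∫ σ, Real.exp (-σ) ^ n ∂S := by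
    intro S hR n
    rw [integral_map (by fun_prop) (Continuous.aestronglyMeasurable (by fun_prop))]
    refine integral_congr_ae ?_
    filter_upwards [hR] with σ hσ
    rw [Real.coe_toNNReal _ hσ.le]
  have hback : ∀ (S : Measure ℝ), (∀ᵐ σ ∂S, 0 < σ) →
      (S.map Real.toNNReal).map ((↑) : ℝ≥0 → ℝ) = S := by
    intro S hR
    rw [Measure.map_map (by fun_prop) (by fun_prop)]
    conv_rhs => rw [← Measure.map_id (μ := S)]
    refine Measure.map_congr ?_
    filter_upwards [hR] with σ hσ
    simp [hσ.le]
  have key : M.map Real.toNNReal = (subMeasure (s + t)).map Real.toNNReal := by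
    refine measure_ext_of_laplace fun n => ?_
    rw [hNN _ hMpos, hNN _ (ae_subMeasure_pos _), hlap (add_pos hs ht), hM,
      integral_map hmadd.aemeasurable (Continuous.aestronglyMeasurable (by fun_prop))]
    simp only [neg_add, Real.exp_add, mul_pow]
    rw [integral_prod_mul (fun σ => Real.exp (-σ) ^ n) (fun σ => Real.exp (-σ) ^ n), hlap hs,
      hlap ht, ← Real.exp_add]
    ring_nf
  rw [← hback M hMpos, key, hback _ (ae_subMeasure_pos _)]

theorem integrable_subMeasure_iff {t : ℝ} (ht : 0 < t) {H : ℝ → ℝ} :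
    Integrable H (subMeasure t) ↔ IntegrableOn (fun σ => subKer 0 t σ * H σ) (Set.Ioi 0) := by
  rw [subMeasure, integrable_withDensity_iff_integrable_smul'
    (measurable_subKer 0 t).ennreal_ofReal (.of_forall fun _ => ENNReal.ofReal_lt_top)]
  refine integrableOn_congr_fun (fun σ hσ => ?_) measurableSet_Ioi
  rw [ENNReal.toReal_ofReal (subKer_zero_pos ht hσ).le, smul_eq_mul]

/-- Iterated integration against two stable densities. -/
theorem integral_subKer_zero_conv {s t : ℝ} (hs : 0 < s) (ht : 0 < t) {H : ℝ → ℝ}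
    (hH : Measurable H) (hint : IntegrableOn (fun σ => subKer 0 (s + t) σ * H σ) (Set.Ioi 0)) :
    ∫ σ in Set.Ioi 0, subKer 0 s σ * ∫ ρ in Set.Ioi 0, subKer 0 t ρ * H (σ + ρ) =
      ∫ σ in Set.Ioi 0, subKer 0 (s + t) σ * H σ := by
  have := isProbabilityMeasure_subMeasure hs
  have := isProbabilityMeasure_subMeasure ht
  have hmadd : Measurable fun z : ℝ × ℝ => z.1 + z.2 := by fun_prop
  rw [← integrable_subMeasure_iff (add_pos hs ht), ← map_add_subMeasure hs ht,
    integrable_map_measure hH.aestronglyMeasurable hmadd.aemeasurable] at hint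
  rw [← integral_subMeasure (add_pos hs ht), ← map_add_subMeasure hs ht,
    integral_map hmadd.aemeasurable hH.aestronglyMeasurable]
  simp only [← integral_subMeasure ht]
  rw [← integral_subMeasure hs]
  exact (integral_prod _ hint).symm

end Convolution

end GaussianBesov

end

noncomputable section

namespace GaussianBesov

/-! ### The Poisson-Hermite semigroup and its time derivatives -/

section Poisson

variable {d : ℕ} {f : E d → ℝ}

/-- The `l`-th time derivative of the Poisson-Hermite semigroup, as an integral. -/
def poissonD (l : ℕ) (t : ℝ) (f : E d → ℝ) (x : E d) : ℝ :=
  ∫ σ in Set.Ioi 0, subKer l t σ * ouSemigroup σ f x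

/-- The positive majorant of `poissonD`. -/
def poissonPos (l : ℕ) (t : ℝ) (F : E d → ℝ≥0∞) (x : E d) : ℝ≥0∞ :=
  ∫⁻ σ in Set.Ioi 0, ‖subKer l t σ‖ₑ * ouPos σ F x

theorem poisson_eq_poissonD {t : ℝ} (ht : 0 < t) (f : E d → ℝ) (x : E d) :
    poisson t f x = poissonD 0 t f x :=
  (integral_subKer_zero_mul ht fun σ => ouSemigroup σ f x).symm

theorem enorm_ouSemigroup_le (σ : ℝ) (f : E d → ℝ) (x : E d) :
    ‖ouSemigroup σ f x‖ₑ ≤ ouPos σ (fun y => ‖f y‖ₑ) x :=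
  enorm_integral_le_lintegral_enorm _

theorem enorm_poissonD_le (l : ℕ) (t : ℝ) (f : E d → ℝ) (x : E d) :
    ‖poissonD l t f x‖ₑ ≤ poissonPos l t (fun y => ‖f y‖ₑ) x := by
  refine (enorm_integral_le_lintegral_enorm _).trans (lintegral_mono fun σ => ?_)
  rw [enorm_mul]
  gcongr
  exact enorm_ouSemigroup_le σ f x

theorem measurable_ouSemigroup_family {S : Type*} [MeasurableSpace S] {g : S → E d → ℝ}
    (hg : Measurable (Function.uncurry g)) :
    Measurable fun w : (S × ℝ) × E d => ouSemigroup w.1.2 (g w.1.1) w.2 := by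
  have : Measurable (fun w : ((S × ℝ) × E d) × E d =>
      Function.uncurry g (w.1.1.1, ouStd w.1.1.2 • w.2 + Real.exp (-w.1.1.2) • w.1.2)) := by
    fun_prop
  exact (this.stronglyMeasurable.integral_prod_right').measurable

theorem measurable_ouSemigroup_uncurry (hf : Measurable f) :
    Measurable fun w : ℝ × E d => ouSemigroup w.1 f w.2 := by
  have h : Measurable (Function.uncurry fun _ : Unit => f) := hf.comp measurable_snd
  exact (measurable_ouSemigroup_family h).comp
    (f := fun w : ℝ × E d => (((), w.1), w.2)) (by fun_prop)

theorem measurable_ouSemigroup_time (hf : Measurable f) (x : E d) :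
    Measurable fun σ => ouSemigroup σ f x := by
  have := (measurable_ouSemigroup_uncurry hf).comp (measurable_prodMk_right (y := x))
  exact this

theorem measurable_poissonD_uncurry (l : ℕ) (hf : Measurable f) :
    Measurable fun w : ℝ × E d => poissonD l w.1 f w.2 := by
  have h1 : Measurable fun v : (ℝ × E d) × ℝ => subKer l v.1.1 v.2 :=
    (measurable_subKer_uncurry l).comp (f := fun v : (ℝ × E d) × ℝ => (v.1.1, v.2)) (by fun_prop)
  have h2 : Measurable fun v : (ℝ × E d) × ℝ => ouSemigroup v.2 f v.1.2 :=
    (measurable_ouSemigroup_uncurry hf).comp (f := fun v : (ℝ × E d) × ℝ => (v.2, v.1.2))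
      (by fun_prop)
  exact ((h1.mul h2).stronglyMeasurable.integral_prod_right').measurable

theorem measurable_poissonD (l : ℕ) (t : ℝ) (hf : Measurable f) : Measurable (poissonD l t f) := by
  have := (measurable_poissonD_uncurry l hf).comp (measurable_prodMk_left (x := t))
  exact this

/-! ### Finiteness and differentiability of Poisson integrals at every point. -/

theorem inv_ouStd_pow_le {σ : ℝ} (hσ : 0 < σ) : (ouStd σ ^ d)⁻¹ ≤ (1 + 1 / (2 * σ)) ^ d := by
  rw [← inv_pow]
  have hs := ouStd_pos hσ
  have hs1 : ouStd σ ≤ 1 := by nlinarith [ouStd_sq_add hσ, Real.exp_pos (-σ)]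
  refine pow_le_pow_left₀ (by positivity) ?_ d
  have h1 : (ouStd σ)⁻¹ ≤ (ouStd σ ^ 2)⁻¹ := by
    gcongr
    nlinarith
  refine h1.trans ?_
  rw [ouStd_sq hσ]
  have h2 : 1 + 2 * σ ≤ Real.exp (2 * σ) := by linarith [Real.add_one_le_exp (2 * σ)]
  have h3 : Real.exp (-2 * σ) ≤ (1 + 2 * σ)⁻¹ := by
    rw [neg_mul, Real.exp_neg]
    gcongr
  have h4 : 2 * σ / (1 + 2 * σ) ≤ 1 - Real.exp (-2 * σ) := by
    have : 2 * σ / (1 + 2 * σ) = 1 - (1 + 2 * σ)⁻¹ := by field_simp; ring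
    linarith
  calc (1 - Real.exp (-2 * σ))⁻¹ ≤ (2 * σ / (1 + 2 * σ))⁻¹ := by gcongr
    _ = 1 + 1 / (2 * σ) := by field_simp; ring

/-- The Mehler kernel blows up as `σ → 0`, but the stable density vanishes exponentially there.
Halving `t` spares enough of the exponential to absorb the blow-up. -/
theorem exists_inv_ouStd_pow_mul_subKer_le (d : ℕ) {t : ℝ} (ht : 0 < t) : ∃ C > 0, ∀ σ > 0,
    (ouStd σ ^ d)⁻¹ * subKer 0 t σ ≤ C * subKer 0 (t / 2) σ := by
  -- `c/(2σ)` is the difference of the exponents `t²/(4σ)` and `(t/2)²/(4σ)`.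
  set c := 3 * t ^ 2 / 8 with hc
  have hc0 : 0 < c := by positivity
  refine ⟨d.factorial / c ^ d * Real.exp c * 2, by positivity, fun σ hσ => ?_⟩
  have hk := subKer_zero_pos ht hσ
  have h1 := Real.pow_div_factorial_le_exp (c * (1 + 1 / (2 * σ))) (by positivity) d
  have h2 : (1 + 1 / (2 * σ)) ^ d ≤ d.factorial / c ^ d * Real.exp (c * (1 + 1 / (2 * σ))) := by
    calc (1 + 1 / (2 * σ)) ^ d =
        d.factorial / c ^ d * ((c * (1 + 1 / (2 * σ))) ^ d / d.factorial) := by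
          rw [mul_pow c]; field_simp
      _ ≤ _ := by gcongr
  calc (ouStd σ ^ d)⁻¹ * subKer 0 t σ
      ≤ d.factorial / c ^ d * Real.exp (c * (1 + 1 / (2 * σ))) * subKer 0 t σ := by
        gcongr
        exact (inv_ouStd_pow_le hσ).trans h2
    _ = _ := by
        rw [subKer_zero_eq hσ, subKer_zero_eq hσ]
        have h3 : Real.exp (c * (1 + 1 / (2 * σ))) * Real.exp (-(t ^ 2 / (4 * σ))) =
            Real.exp c * Real.exp (-((t / 2) ^ 2 / (4 * σ))) := by
          rw [← Real.exp_add, ← Real.exp_add]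
          congr 1
          rw [hc]
          field_simp
          ring
        linear_combination (d.factorial / c ^ d * (1 / (2 * Real.sqrt Real.pi) * t *
          (σ⁻¹ * (Real.sqrt σ)⁻¹))) * h3

theorem lintegral_subKer_mul_inv_ouStd_ne_top (d l : ℕ) {t : ℝ} (ht : 0 < t) :
    ∫⁻ σ in Set.Ioi 0, ‖subKer l t σ‖ₑ * ENNReal.ofReal ((ouStd σ ^ d)⁻¹) ≠ ⊤ := by
  obtain ⟨C, hC, h⟩ := exists_subKer_le l
  obtain ⟨C', hC', h'⟩ := exists_inv_ouStd_pow_mul_subKer_le d (t := t / 2) (by positivity)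
  refine ne_top_of_le_ne_top (b := ENNReal.ofReal (C * (t ^ l)⁻¹ * C')) ENNReal.ofReal_ne_top ?_
  calc ∫⁻ σ in Set.Ioi 0, ‖subKer l t σ‖ₑ * ENNReal.ofReal ((ouStd σ ^ d)⁻¹)
      ≤ ∫⁻ σ in Set.Ioi 0, ENNReal.ofReal (C * (t ^ l)⁻¹ * C') *
          ENNReal.ofReal (subKer 0 (t / 2 / 2) σ) := by
        refine setLIntegral_mono' measurableSet_Ioi fun σ hσ => ?_
        have hs := ouStd_pos hσ
        rw [← ENNReal.ofReal_mul (by positivity), Real.enorm_eq_ofReal_abs,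
          ← ENNReal.ofReal_mul (abs_nonneg _)]
        refine ENNReal.ofReal_le_ofReal ?_
        calc |subKer l t σ| * (ouStd σ ^ d)⁻¹
            ≤ C * (t ^ l)⁻¹ * subKer 0 (t / 2) σ * (ouStd σ ^ d)⁻¹ := by
              gcongr
              exact h t σ ht hσ
          _ = C * (t ^ l)⁻¹ * ((ouStd σ ^ d)⁻¹ * subKer 0 (t / 2) σ) := by ring
          _ ≤ C * (t ^ l)⁻¹ * (C' * subKer 0 (t / 2 / 2) σ) :=
              mul_le_mul_of_nonneg_left (h' σ hσ) (by positivity)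
          _ = _ := by ring
    _ = _ := by
        rw [lintegral_const_mul' _ _ ENNReal.ofReal_ne_top, lintegral_subKer_zero (by positivity),
          mul_one]

/-- Pointwise bound of `poissonPos` by the `L¹` norm. -/
theorem poissonPos_le (l : ℕ) (t : ℝ) {F : E d → ℝ≥0∞} (hF : Measurable F) (x : E d) :
    poissonPos l t F x ≤
      (∫⁻ σ in Set.Ioi 0, ‖subKer l t σ‖ₑ * ENNReal.ofReal ((ouStd σ ^ d)⁻¹)) *
        (ENNReal.ofReal (Real.exp (‖x‖ ^ 2)) * ∫⁻ y, F y ∂(gauss d)) := by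
  have hm : Measurable fun σ => ‖subKer l t σ‖ₑ * ENNReal.ofReal ((ouStd σ ^ d)⁻¹) := by
    have := measurable_subKer l t
    fun_prop
  rw [← lintegral_mul_const _ hm]
  refine setLIntegral_mono' measurableSet_Ioi fun σ hσ => ?_
  have hs := ouStd_pos hσ
  rw [mul_assoc]
  gcongr
  refine (ouPos_le_exp_mul_lintegral hF hσ x).trans_eq ?_
  rw [ENNReal.ofReal_mul (by positivity), mul_assoc]

theorem poissonPos_ne_top (l : ℕ) {t : ℝ} (ht : 0 < t) {F : E d → ℝ≥0∞} (hF : Measurable F)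
    (hFi : ∫⁻ y, F y ∂(gauss d) ≠ ⊤) (x : E d) : poissonPos l t F x ≠ ⊤ :=
  ne_top_of_le_ne_top (ENNReal.mul_ne_top (lintegral_subKer_mul_inv_ouStd_ne_top d l ht)
    (ENNReal.mul_ne_top ENNReal.ofReal_ne_top hFi)) (poissonPos_le l t hF x)

theorem integrableOn_poissonD (l : ℕ) {t : ℝ} (ht : 0 < t) (hf : Measurable f)
    (hfi : Integrable f (gauss d)) (x : E d) :
    IntegrableOn (fun σ => subKer l t σ * ouSemigroup σ f x) (Set.Ioi 0) := by
  refine ⟨((measurable_subKer l t).mul (measurable_ouSemigroup_time hf x)).aestronglyMeasurable, ?_⟩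
  refine lt_of_le_of_lt (lintegral_mono fun σ => ?_)
    (poissonPos_ne_top l ht hf.enorm hfi.2.ne x).lt_top
  rw [enorm_mul]
  gcongr
  exact enorm_ouSemigroup_le σ f x

theorem hasDerivAt_poissonD (l : ℕ) {t : ℝ} (ht : 0 < t) (hf : Measurable f)
    (hfi : Integrable f (gauss d)) (x : E d) :
    HasDerivAt (fun t => poissonD l t f x) (poissonD (l + 1) t f x) t :=
  (integrableOn_subKer_mul_and_hasDerivAt (measurable_ouSemigroup_time hf x)
    (fun _ hs => integrableOn_poissonD 0 hs hf hfi x) l ht).2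

/-- Replaces iterated derivatives by integrals against derivatives of the kernel. Equality holds
only for `t > 0`, so the induction differentiates an identity on a neighbourhood of `t`. -/
theorem poissonDeriv_eq_poissonD (l : ℕ) {t : ℝ} (ht : 0 < t) (hf : Measurable f)
    (hfi : Integrable f (gauss d)) (x : E d) : poissonDeriv l t f x = poissonD l t f x := by
  induction l generalizing t with
  | zero =>
    rw [poissonDeriv, iteratedDeriv_zero, poisson_eq_poissonD ht]
  | succ l ih =>
    rw [poissonDeriv, iteratedDeriv_succ]
    refine HasDerivAt.deriv ?_
    refine (hasDerivAt_poissonD l ht hf hfi x).congr_of_eventuallyEq ?_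
    filter_upwards [lt_mem_nhds ht] with s hs
    exact ih hs

/-! ### Exchange of integrals -/

section Exchange

variable {S : Type*} [MeasurableSpace S] {ν : Measure S} {g : S → E d → ℝ}

theorem lintegral_ouPos_family_le (hg : Measurable (Function.uncurry g)) {σ : ℝ} (hσ : 0 < σ)
    (x : E d) : ∫⁻ s, ouPos σ (fun y => ‖g s y‖ₑ) x ∂ν ≤
      ENNReal.ofReal ((ouStd σ ^ d)⁻¹ * Real.exp (‖x‖ ^ 2)) *
        ∫⁻ s, ∫⁻ y, ‖g s y‖ₑ ∂(gauss d) ∂ν := by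
  rw [← lintegral_const_mul' _ _ ENNReal.ofReal_ne_top]
  exact lintegral_mono fun s => ouPos_le_exp_mul_lintegral hg.of_uncurry_left.enorm hσ x

/-- Fubini at a fixed point `x`. The pointwise `L¹` bound makes joint integrability in `L¹(γ_d)`
sufficient at every `x`. -/
theorem ouSemigroup_integral [SFinite ν] (hg : Measurable (Function.uncurry g))
    (hgi : ∫⁻ s, ∫⁻ y, ‖g s y‖ₑ ∂(gauss d) ∂ν ≠ ⊤) {σ : ℝ} (hσ : 0 < σ) (x : E d) :
    ouSemigroup σ (fun y => ∫ s, g s y ∂ν) x = ∫ s, ouSemigroup σ (g s) x ∂ν := by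
  have hm : Measurable fun w : E d × S =>
      Function.uncurry g (w.2, ouStd σ • w.1 + Real.exp (-σ) • x) := by fun_prop
  refine integral_integral_swap (f := fun u s => g s (ouStd σ • u + Real.exp (-σ) • x))
    ⟨hm.aestronglyMeasurable, ?_⟩
  rw [hasFiniteIntegral_iff_enorm]
  refine (lintegral_prod_symm _ hm.enorm.aemeasurable).trans_lt ?_
  exact (lintegral_ouPos_family_le hg hσ x).trans_lt
    (ENNReal.mul_lt_top ENNReal.ofReal_lt_top hgi.lt_top)

theorem poissonD_integral [SFinite ν] (hg : Measurable (Function.uncurry g))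
    (hgi : ∫⁻ s, ∫⁻ y, ‖g s y‖ₑ ∂(gauss d) ∂ν ≠ ⊤) (l : ℕ) {t : ℝ} (ht : 0 < t) (x : E d) :
    poissonD l t (fun y => ∫ s, g s y ∂ν) x = ∫ s, poissonD l t (g s) x ∂ν := by
  have hm : Measurable fun w : ℝ × S => subKer l t w.1 * ouSemigroup w.1 (g w.2) x :=
    ((measurable_subKer l t).comp measurable_fst).mul ((measurable_ouSemigroup_family hg).comp
      (f := fun w : ℝ × S => ((w.2, w.1), x)) (by fun_prop))
  have hmK : Measurable fun σ => ‖subKer l t σ‖ₑ * ENNReal.ofReal ((ouStd σ ^ d)⁻¹) := by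
    have := measurable_subKer l t
    fun_prop
  have h1 : ∫ σ in Set.Ioi 0, ∫ s, subKer l t σ * ouSemigroup σ (g s) x ∂ν =
      ∫ s, (∫ σ in Set.Ioi 0, subKer l t σ * ouSemigroup σ (g s) x) ∂ν := by
    refine integral_integral_swap (f := fun σ s => subKer l t σ * ouSemigroup σ (g s) x)
      ⟨hm.aestronglyMeasurable, ?_⟩
    rw [hasFiniteIntegral_iff_enorm]
    refine (lintegral_prod _ hm.enorm.aemeasurable).trans_lt ?_
    calc ∫⁻ σ in Set.Ioi 0, ∫⁻ s, ‖subKer l t σ * ouSemigroup σ (g s) x‖ₑ ∂ν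
        ≤ ∫⁻ σ in Set.Ioi 0, (‖subKer l t σ‖ₑ * ENNReal.ofReal ((ouStd σ ^ d)⁻¹)) *
            (ENNReal.ofReal (Real.exp (‖x‖ ^ 2)) * ∫⁻ s, ∫⁻ y, ‖g s y‖ₑ ∂(gauss d) ∂ν) := by
          refine setLIntegral_mono' measurableSet_Ioi fun σ hσ => ?_
          have hs := ouStd_pos hσ
          simp only [enorm_mul]
          rw [lintegral_const_mul' _ _ enorm_ne_top, mul_assoc]
          gcongr
          rw [← mul_assoc, ← ENNReal.ofReal_mul (by positivity)]
          exact (lintegral_mono fun s => enorm_ouSemigroup_le σ (g s) x).trans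
            (lintegral_ouPos_family_le hg hσ x)
      _ < ⊤ := by
          rw [lintegral_mul_const _ hmK]
          exact ENNReal.mul_lt_top (lintegral_subKer_mul_inv_ouStd_ne_top d l ht).lt_top
            (ENNReal.mul_lt_top ENNReal.ofReal_lt_top hgi.lt_top)
  refine Eq.trans ?_ h1
  refine setIntegral_congr_fun measurableSet_Ioi fun σ hσ => ?_
  rw [ouSemigroup_integral hg hgi hσ, integral_const_mul]

end Exchange

theorem ouSemigroup_const_mul (c σ : ℝ) (f : E d → ℝ) (x : E d) :
    ouSemigroup σ (fun y => c * f y) x = c * ouSemigroup σ f x :=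
  integral_const_mul _ _

theorem poissonD_const_mul (c : ℝ) (l : ℕ) (t : ℝ) (f : E d → ℝ) (x : E d) :
    poissonD l t (fun y => c * f y) x = c * poissonD l t f x := by
  simp only [poissonD, ouSemigroup_const_mul, mul_left_comm _ c]
  exact integral_const_mul _ _

theorem poissonD_sum {ι : Type*} (s : Finset ι) {g : ι → E d → ℝ} (hg : ∀ i ∈ s, Measurable (g i))
    (hgi : ∀ i ∈ s, Integrable (g i) (gauss d)) (l : ℕ) {t : ℝ} (ht : 0 < t) (x : E d) :
    poissonD l t (fun y => ∑ i ∈ s, g i y) x = ∑ i ∈ s, poissonD l t (g i) x := by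
  unfold poissonD
  rw [← integral_finsetSum _ fun i hi => integrableOn_poissonD l ht (hg i hi) (hgi i hi) x]
  refine setIntegral_congr_fun measurableSet_Ioi fun σ hσ => ?_
  simp only [← Finset.mul_sum]
  congr 1
  refine integral_finsetSum _ fun i hi => ?_
  have := hg i hi
  refine ⟨(by fun_prop : Measurable _).aestronglyMeasurable, ?_⟩
  exact (ouPos_le_exp_mul_lintegral (hg i hi).enorm hσ x).trans_lt
    (ENNReal.mul_lt_top ENNReal.ofReal_lt_top (hgi i hi).2)

/-! ### The semigroup property -/

theorem map_gauss_add {a b c : ℝ} (ha : 0 < a) (hc : 0 < c) (habc : a ^ 2 + b ^ 2 = c ^ 2) :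
    ((gauss d).prod (gauss d)).map (fun z => a • z.2 + b • z.1) =
      (gauss d).map (fun u => c • u) := by
  refine Measure.ext_of_lintegral _ fun F hF => ?_
  rw [lintegral_map hF (by fun_prop), lintegral_map hF (by fun_prop),
    lintegral_prod _ (by fun_prop), lintegral_gauss_add ha hc habc hF]

theorem ouSemigroup_ouSemigroup (hf : Measurable f) (hfi : Integrable f (gauss d)) {σ ρ : ℝ}
    (hσ : 0 < σ) (hρ : 0 < ρ) (x : E d) :
    ouSemigroup σ (ouSemigroup ρ f) x = ouSemigroup (σ + ρ) f x := by
  have h := map_gauss_add (d := d) (ouStd_pos hρ) (ouStd_pos (add_pos hσ hρ)) (ouStd_comp hσ hρ)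
  set G : E d → ℝ := fun y => f (y + Real.exp (-(σ + ρ)) • x) with hG
  have hGm : Measurable G := by fun_prop
  have hsmul : ∀ u v : E d, ouStd ρ • v + Real.exp (-ρ) • (ouStd σ • u + Real.exp (-σ) • x) =
      ouStd ρ • v + (Real.exp (-ρ) * ouStd σ) • u + Real.exp (-(σ + ρ)) • x := by
    intro u v
    rw [smul_add, smul_smul, smul_smul, ← Real.exp_add, add_assoc, neg_add_rev]
  have h1 : ∫ u, G (ouStd (σ + ρ) • u) ∂(gauss d) = ∫ z, G (ouStd ρ • z.2 +
      (Real.exp (-ρ) * ouStd σ) • z.1) ∂((gauss d).prod (gauss d)) := by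
    rw [← integral_map (φ := fun u : E d => ouStd (σ + ρ) • u) (by fun_prop)
      hGm.aestronglyMeasurable, ← h, integral_map (by fun_prop) hGm.aestronglyMeasurable]
  have hmz : Measurable fun z : E d × E d => G (ouStd ρ • z.2 +
      (Real.exp (-ρ) * ouStd σ) • z.1) := by fun_prop
  have hint : Integrable (fun z : E d × E d => G (ouStd ρ • z.2 +
      (Real.exp (-ρ) * ouStd σ) • z.1)) ((gauss d).prod (gauss d)) := by
    refine ⟨hmz.aestronglyMeasurable, ?_⟩
    rw [hasFiniteIntegral_iff_enorm, lintegral_prod _ hmz.enorm.aemeasurable]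
    have h2 := ouPos_ouPos (d := d) hf.enorm hσ hρ x
    have h3 := ouPos_le_exp_mul_lintegral (d := d) hf.enorm (add_pos hσ hρ) x
    rw [← h2] at h3
    simp only [ouPos, hsmul] at h3
    exact h3.trans_lt (ENNReal.mul_lt_top ENNReal.ofReal_lt_top hfi.2)
  rw [ouSemigroup_eq (σ + ρ)]
  refine Eq.trans ?_ h1.symm
  rw [integral_prod _ hint, ouSemigroup_eq σ]
  refine integral_congr_ae (.of_forall fun u => ?_)
  simp only [ouSemigroup_eq ρ, hsmul, hG]

theorem lintegral_poissonPos {F : E d → ℝ≥0∞} (hF : Measurable F) (l : ℕ) (t : ℝ) :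
    ∫⁻ x, poissonPos l t F x ∂(gauss d) =
      (∫⁻ σ in Set.Ioi 0, ‖subKer l t σ‖ₑ) * ∫⁻ x, F x ∂(gauss d) := by
  have hm : Measurable fun w : E d × ℝ => ‖subKer l t w.2‖ₑ * ouPos w.2 F w.1 :=
    ((measurable_subKer l t).comp measurable_snd).enorm.mul
      ((measurable_ouPos_uncurry hF).comp (f := fun w : E d × ℝ => (w.2, w.1)) (by fun_prop))
  have hswap := lintegral_lintegral_swap (μ := gauss d) (ν := volume.restrict (Set.Ioi 0))
    (f := fun x σ => ‖subKer l t σ‖ₑ * ouPos σ F x) hm.aemeasurable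
  unfold poissonPos
  rw [hswap, ← lintegral_mul_const _ (measurable_subKer l t).enorm]
  refine setLIntegral_congr_fun measurableSet_Ioi fun σ hσ => ?_
  rw [lintegral_const_mul' _ _ enorm_ne_top, lintegral_ouPos hF hσ]

theorem lintegral_subKer_ne_top (l : ℕ) {t : ℝ} (ht : 0 < t) :
    ∫⁻ σ in Set.Ioi 0, ‖subKer l t σ‖ₑ ≠ ⊤ := by
  obtain ⟨C, hC⟩ := exists_lintegral_subKer_le l
  exact ne_top_of_le_ne_top (by finiteness) (hC t ht)

theorem integrable_poissonD (l : ℕ) {t : ℝ} (ht : 0 < t) (hf : Measurable f)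
    (hfi : Integrable f (gauss d)) : Integrable (poissonD l t f) (gauss d) := by
  refine ⟨(measurable_poissonD l t hf).aestronglyMeasurable, ?_⟩
  refine lt_of_le_of_lt (lintegral_mono fun x => enorm_poissonD_le l t f x) ?_
  rw [lintegral_poissonPos hf.enorm]
  exact ENNReal.mul_lt_top (lintegral_subKer_ne_top l ht).lt_top hfi.2

theorem poissonD_poissonD_eq_integral (hf : Measurable f) (hfi : Integrable f (gauss d)) (l j : ℕ)
    {s t : ℝ} (ht : 0 < t) (hs : 0 < s) (x : E d) :
    poissonD l t (poissonD j s f) x = ∫ ρ in Set.Ioi 0, subKer j s ρ *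
      ∫ σ in Set.Ioi 0, subKer l t σ * ouSemigroup (σ + ρ) f x := by
  have hm : Measurable (Function.uncurry fun ρ y => subKer j s ρ * ouSemigroup ρ f y) :=
    ((measurable_subKer j s).comp measurable_fst).mul (measurable_ouSemigroup_uncurry hf)
  have hgi : ∫⁻ ρ in Set.Ioi 0, ∫⁻ y, ‖subKer j s ρ * ouSemigroup ρ f y‖ₑ ∂(gauss d) ≠ ⊤ := by
    refine ne_top_of_le_ne_top (ENNReal.mul_ne_top (lintegral_subKer_ne_top j hs) hfi.2.ne) ?_
    rw [← lintegral_mul_const _ (measurable_subKer j s).enorm]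
    refine setLIntegral_mono' measurableSet_Ioi fun ρ hρ => ?_
    simp only [enorm_mul]
    rw [lintegral_const_mul' _ _ enorm_ne_top, ← lintegral_ouPos hf.enorm hρ]
    gcongr with y
    exact enorm_ouSemigroup_le ρ f y
  refine (poissonD_integral (ν := volume.restrict (Set.Ioi 0)) hm hgi l ht x).trans ?_
  refine setIntegral_congr_fun measurableSet_Ioi fun ρ hρ => ?_
  rw [poissonD_const_mul]
  congr 1
  refine setIntegral_congr_fun measurableSet_Ioi fun σ hσ => ?_
  rw [ouSemigroup_ouSemigroup hf hfi hσ hρ]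

/-- Both sides are double integrals of `T_{σ+ρ} f` against the two kernels, so only Fubini is
needed. The domination puts the singular kernel bound on `T_σ` and uses invariance of `γ_d` for
`T_ρ`. -/
theorem poissonD_comm (hf : Measurable f) (hfi : Integrable f (gauss d)) (l j : ℕ)
    {s t : ℝ} (ht : 0 < t) (hs : 0 < s) (x : E d) :
    poissonD l t (poissonD j s f) x = poissonD j s (poissonD l t f) x := by
  rw [poissonD_poissonD_eq_integral hf hfi l j ht hs, poissonD_poissonD_eq_integral hf hfi j l hs ht]
  simp only [← integral_const_mul]
  have hm : Measurable fun w : ℝ × ℝ =>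
      subKer j s w.1 * (subKer l t w.2 * ouSemigroup (w.2 + w.1) f x) := by
    have h1 := measurable_subKer j s
    have h2 := measurable_subKer l t
    have h3 := measurable_ouSemigroup_time hf x
    fun_prop
  rw [integral_integral_swap (f := fun ρ σ =>
    subKer j s ρ * (subKer l t σ * ouSemigroup (σ + ρ) f x))]
  · refine setIntegral_congr_fun measurableSet_Ioi fun σ hσ => ?_
    refine integral_congr_ae (.of_forall fun ρ => ?_)
    simp only
    rw [add_comm σ ρ]
    ring
  refine ⟨hm.aestronglyMeasurable, ?_⟩
  rw [hasFiniteIntegral_iff_enorm]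
  refine (lintegral_prod _ hm.enorm.aemeasurable).trans_lt ?_
  have hfin := lintegral_subKer_mul_inv_ouStd_ne_top d l ht
  have hmK : Measurable fun σ => ‖subKer l t σ‖ₑ * ENNReal.ofReal ((ouStd σ ^ d)⁻¹) := by
    have := measurable_subKer l t
    fun_prop
  set K := (∫⁻ σ in Set.Ioi 0, ‖subKer l t σ‖ₑ * ENNReal.ofReal ((ouStd σ ^ d)⁻¹)) *
    (ENNReal.ofReal (Real.exp (‖x‖ ^ 2)) * ∫⁻ y, ‖f y‖ₑ ∂(gauss d)) with hK
  have hKT : K ≠ ⊤ := ENNReal.mul_ne_top hfin (ENNReal.mul_ne_top ENNReal.ofReal_ne_top hfi.2.ne)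
  calc ∫⁻ ρ in Set.Ioi 0, ∫⁻ σ in Set.Ioi 0,
        ‖subKer j s ρ * (subKer l t σ * ouSemigroup (σ + ρ) f x)‖ₑ
      ≤ ∫⁻ ρ in Set.Ioi 0, ‖subKer j s ρ‖ₑ * K := by
        refine setLIntegral_mono' measurableSet_Ioi fun ρ hρ => ?_
        simp only [enorm_mul]
        rw [lintegral_const_mul' _ _ enorm_ne_top]
        gcongr
        rw [hK, ← lintegral_mul_const _ hmK]
        refine setLIntegral_mono' measurableSet_Ioi fun σ hσ => ?_
        have hs := ouStd_pos hσ
        rw [mul_assoc]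
        gcongr
        rw [← mul_assoc, ← ENNReal.ofReal_mul (by positivity), ← lintegral_ouPos hf.enorm hρ]
        refine (enorm_ouSemigroup_le _ _ _).trans ?_
        rw [← ouPos_ouPos hf.enorm hσ hρ]
        exact ouPos_le_exp_mul_lintegral (measurable_ouPos hf.enorm ρ) hσ x
    _ < ⊤ := by
        rw [lintegral_mul_const _ (measurable_subKer j s).enorm]
        exact ENNReal.mul_lt_top (lintegral_subKer_ne_top j hs).lt_top hKT.lt_top

theorem poissonD_zero_zero (hf : Measurable f) (hfi : Integrable f (gauss d)) {s t : ℝ}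
    (ht : 0 < t) (hs : 0 < s) (x : E d) :
    poissonD 0 t (poissonD 0 s f) x = poissonD 0 (t + s) f x := by
  rw [poissonD_poissonD_eq_integral hf hfi 0 0 ht hs]
  simp only [fun ρ σ : ℝ => add_comm ρ σ]
  refine (integral_subKer_zero_conv hs ht (measurable_ouSemigroup_time hf x) ?_)
  exact integrableOn_poissonD 0 (add_pos hs ht) hf hfi x

/-- An identity valid for all `t > 0` may be differentiated in `t`; both derivatives are known, and
derivatives are unique. -/
theorem poissonD_succ_of_eq {h : E d → ℝ} (hf : Measurable f) (hfi : Integrable f (gauss d))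
    (hh : Measurable h) (hhi : Integrable h (gauss d)) {i j : ℕ} {s : ℝ} (hs : 0 < s) {x : E d}
    (heq : ∀ t > 0, poissonD i t h x = poissonD j (t + s) f x) {t : ℝ} (ht : 0 < t) :
    poissonD (i + 1) t h x = poissonD (j + 1) (t + s) f x := by
  have h1 := hasDerivAt_poissonD i ht hh hhi x
  have h2 := (hasDerivAt_poissonD j (add_pos ht hs) hf hfi x).comp_add_const t s
  refine h1.unique (h2.congr_of_eventuallyEq ?_)
  filter_upwards [lt_mem_nhds ht] with r hr using heq r hr

/-- Differentiating in `t` raises only the order of the outer operator. So the order `j` is first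
produced on the outside of `P_s f`, commuted to the inside, and then the outer order is raised to
`l`. -/
theorem poissonD_poissonD (hf : Measurable f) (hfi : Integrable f (gauss d)) (l j : ℕ)
    {s t : ℝ} (ht : 0 < t) (hs : 0 < s) (x : E d) :
    poissonD l t (poissonD j s f) x = poissonD (l + j) (t + s) f x := by
  have h0 : ∀ j, ∀ t > 0, ∀ s > 0, poissonD j t (poissonD 0 s f) x = poissonD j (t + s) f x := by
    intro j
    induction j with
    | zero => exact fun t ht s hs => poissonD_zero_zero hf hfi ht hs x
    | succ j ih =>
      intro t ht s hs
      exact poissonD_succ_of_eq hf hfi (measurable_poissonD 0 s hf) (integrable_poissonD 0 hs hf hfi)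
        hs (fun t ht => ih t ht s hs) ht
  induction l generalizing t with
  | zero =>
    rw [poissonD_comm hf hfi 0 j ht hs, h0 j s hs t ht, zero_add, add_comm]
  | succ l ih =>
    rw [add_right_comm]
    exact poissonD_succ_of_eq hf hfi (measurable_poissonD j s hf) (integrable_poissonD j hs hf hfi)
      hs (fun t ht => ih ht) ht

/-! ### Norm bounds -/

/-- By Minkowski and the bound on `T_σ` uniform in `σ`, only the `L¹` mass of the differentiated
density enters, and that is `O(t^{-l})`. -/
theorem exists_luxNorm_poissonPos_le {p : E d → ℝ} (hp : IsAdmissible p) (l : ℕ) :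
    ∃ C : ℝ≥0, ∀ t > 0, ∀ F : E d → ℝ≥0∞, Measurable F →
      luxNorm (gauss d) p (poissonPos l t F) ≤
        C * ENNReal.ofReal ((t ^ l)⁻¹) * luxNorm (gauss d) p F := by
  obtain ⟨C1, h1⟩ := exists_luxNorm_ouPos_le hp
  obtain ⟨C2, h2⟩ := exists_lintegral_subKer_le l
  refine ⟨C2 * C1, fun t ht F hF => ?_⟩
  have hm : Measurable (Function.uncurry fun σ x => ‖subKer l t σ‖ₑ * ouPos σ F x) :=
    ((measurable_subKer l t).comp measurable_fst).enorm.mul (measurable_ouPos_uncurry hF)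
  refine (luxNorm_lintegral_le hp.measurable hp.ae_one_le (volume.restrict (Set.Ioi 0)) hm
    (B := fun σ => ‖subKer l t σ‖ₑ * (C1 * luxNorm (gauss d) p F))
    ((measurable_subKer l t).enorm.mul_const _).aemeasurable ?_).trans ?_
  · filter_upwards [ae_restrict_mem measurableSet_Ioi] with σ hσ
    refine (luxNorm_const_mul_le hp.ae_one_le _ enorm_ne_top).trans ?_
    gcongr
    exact h1 σ hσ F hF
  · rw [lintegral_mul_const _ (measurable_subKer l t).enorm]
    calc _ ≤ C2 * ENNReal.ofReal ((t ^ l)⁻¹) * (C1 * luxNorm (gauss d) p F) := by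
          gcongr
          exact h2 t ht
      _ = _ := by push_cast; ring

theorem exists_luxNorm_poissonD_le {p : E d → ℝ} (hp : IsAdmissible p) (l : ℕ) :
    ∃ C : ℝ≥0, ∀ t > 0, ∀ f : E d → ℝ, Measurable f →
      varLpNorm (gauss d) p (poissonD l t f) ≤
        C * ENNReal.ofReal ((t ^ l)⁻¹) * varLpNorm (gauss d) p f := by
  obtain ⟨C, h⟩ := exists_luxNorm_poissonPos_le hp l
  refine ⟨C, fun t ht f hf => ?_⟩
  exact (luxNorm_mono hp.ae_one_le (.of_forall fun x => enorm_poissonD_le l t f x)).trans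
    (h t ht _ hf.enorm)

end Poisson

end GaussianBesov

end

noncomputable section

namespace GaussianBesov

/-! ### Approximation of the identity -/

variable {d : ℕ} {f : E d → ℝ}

theorem poissonD_sub {g : E d → ℝ} (hf : Measurable f) (hfi : Integrable f (gauss d))
    (hg : Measurable g) (hgi : Integrable g (gauss d)) (l : ℕ) {t : ℝ} (ht : 0 < t) (x : E d) :
    poissonD l t (fun y => f y - g y) x = poissonD l t f x - poissonD l t g x := by
  have h := poissonD_sum Finset.univ (g := ![f, fun y => -1 * g y])
    (by intro i _; fin_cases i <;> simp <;> fun_prop)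
    (by intro i _; fin_cases i <;> simp; exacts [hfi, hgi]) l ht x
  simp only [Fin.sum_univ_two, Matrix.cons_val_zero, Matrix.cons_val_one, poissonD_const_mul] at h
  simpa [← sub_eq_add_neg] using h

theorem lintegral_enorm_poissonD_zero_le (hf : Measurable f) {t : ℝ} (ht : 0 < t) :
    ∫⁻ x, ‖poissonD 0 t f x‖ₑ ∂(gauss d) ≤ ∫⁻ x, ‖f x‖ₑ ∂(gauss d) := by
  refine (lintegral_mono fun x => enorm_poissonD_le 0 t f x).trans_eq ?_
  have h : ∫⁻ σ in Set.Ioi 0, ‖subKer 0 t σ‖ₑ = 1 := by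
    rw [← lintegral_subKer_zero ht]
    refine setLIntegral_congr_fun measurableSet_Ioi fun σ hσ => ?_
    exact Real.enorm_eq_ofReal (subKer_zero_pos ht hσ).le
  rw [lintegral_poissonPos hf.enorm, h, one_mul]

theorem continuous_ouSemigroup (g : BoundedContinuousFunction (E d) ℝ) (x : E d) :
    Continuous fun σ => ouSemigroup σ g x := by
  unfold ouSemigroup
  refine continuous_of_dominated (bound := fun _ => ‖g‖) (fun σ => ?_)
    (fun σ => ae_of_all _ fun u => g.norm_coe_le_norm _) (integrable_const _)
    (ae_of_all _ fun u => ?_)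
  · have := g.continuous
    exact (by fun_prop : Continuous _).aestronglyMeasurable
  · exact g.continuous.comp (by fun_prop)

theorem enorm_ouSemigroup_bounded_le (g : BoundedContinuousFunction (E d) ℝ) (σ : ℝ) (x : E d) :
    ‖ouSemigroup σ g x‖ ≤ ‖g‖ := by
  refine (norm_integral_le_of_norm_le_const (ae_of_all _ fun u => g.norm_coe_le_norm _)).trans ?_
  simp

theorem integrableOn_exp_neg_div_sqrt :
    IntegrableOn (fun u : ℝ => Real.exp (-u) / Real.sqrt u) (Set.Ioi 0) := by
  refine (Real.GammaIntegral_convergent (s := 1 / 2) (by norm_num)).congr_fun (fun u hu => ?_)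
    measurableSet_Ioi
  simp only
  rw [Real.sqrt_eq_rpow, show (1 / 2 : ℝ) - 1 = -(1 / 2) by norm_num, Real.rpow_neg (le_of_lt hu),
    ← div_eq_mul_inv]

theorem integral_Ioi_exp_neg_div_sqrt :
    ∫ u in Set.Ioi (0 : ℝ), Real.exp (-u) / Real.sqrt u = Real.sqrt Real.pi := by
  rw [← Real.Gamma_one_half_eq, Real.Gamma_eq_integral (by norm_num)]
  refine setIntegral_congr_fun measurableSet_Ioi fun u hu => ?_
  rw [Real.sqrt_eq_rpow, show (1 / 2 : ℝ) - 1 = -(1 / 2) by norm_num, Real.rpow_neg (le_of_lt hu),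
    ← div_eq_mul_inv]

theorem norm_poisson_le (g : BoundedContinuousFunction (E d) ℝ) (t : ℝ) (x : E d) :
    ‖poisson t g x‖ ≤ ‖g‖ := by
  have h : ‖∫ u in Set.Ioi (0 : ℝ), Real.exp (-u) / Real.sqrt u *
      ouSemigroup (t ^ 2 / (4 * u)) g x‖ ≤
      ∫ u in Set.Ioi (0 : ℝ), Real.exp (-u) / Real.sqrt u * ‖g‖ := by
    refine norm_integral_le_of_norm_le (integrableOn_exp_neg_div_sqrt.mul_const _)
      (ae_of_all _ fun u => ?_)
    rw [norm_mul, Real.norm_of_nonneg (by positivity)]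
    exact mul_le_mul_of_nonneg_left (enorm_ouSemigroup_bounded_le g _ x) (by positivity)
  rw [integral_mul_const, integral_Ioi_exp_neg_div_sqrt] at h
  have hpi : 0 < Real.sqrt Real.pi := Real.sqrt_pos.2 Real.pi_pos
  rw [poisson, norm_mul, Real.norm_of_nonneg (by positivity), one_div, inv_mul_le_iff₀ hpi]
  exact h

theorem continuous_poisson (g : BoundedContinuousFunction (E d) ℝ) (x : E d) :
    Continuous fun t => poisson t g x := by
  unfold poisson
  refine continuous_const.mul ?_
  refine continuous_of_dominated (bound := fun u => Real.exp (-u) / Real.sqrt u * ‖g‖)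
    (fun t => ?_) (fun t => ae_of_all _ fun u => ?_) (integrableOn_exp_neg_div_sqrt.mul_const _)
    (ae_of_all _ fun u => ?_)
  · have := (continuous_ouSemigroup g x).measurable
    exact (by fun_prop : Measurable _).aestronglyMeasurable
  · rw [norm_mul, Real.norm_of_nonneg (by positivity)]
    exact mul_le_mul_of_nonneg_left (enorm_ouSemigroup_bounded_le g _ x) (by positivity)
  · exact continuous_const.mul ((continuous_ouSemigroup g x).comp (by fun_prop))

theorem poisson_zero (f : E d → ℝ) (x : E d) : poisson 0 f x = f x := by
  have hpi : 0 < Real.sqrt Real.pi := Real.sqrt_pos.2 Real.pi_pos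
  have h : ouSemigroup 0 f x = f x := by simp [ouSemigroup]
  simp only [poisson, ne_eq, OfNat.ofNat_ne_zero, not_false_eq_true, zero_pow, zero_div, h]
  rw [integral_mul_const, integral_Ioi_exp_neg_div_sqrt]
  field_simp

theorem tendsto_lintegral_poisson_sub_bounded (g : BoundedContinuousFunction (E d) ℝ) :
    Tendsto (fun t => ∫⁻ x, ‖poissonD 0 t g x - g x‖ₑ ∂(gauss d)) (𝓝[>] 0) (𝓝 0) := by
  have hgm : Measurable g := g.continuous.measurable
  have h0 : ∫⁻ _, (0 : ℝ≥0∞) ∂(gauss d) = 0 := by simp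
  rw [← h0]
  refine tendsto_lintegral_filter_of_dominated_convergence (fun _ => 2 * ‖g‖ₑ)
    (Eventually.of_forall fun t => ((measurable_poissonD 0 t hgm).sub hgm).enorm) ?_
    (by simp; finiteness) (ae_of_all _ fun x => ?_)
  · filter_upwards [self_mem_nhdsWithin] with t ht
    refine ae_of_all _ fun x => ?_
    rw [← poisson_eq_poissonD ht, two_mul]
    refine (enorm_sub_le).trans (add_le_add ?_ ?_)
    · exact enorm_le_iff_norm_le.2 (norm_poisson_le g t x)
    · exact enorm_le_iff_norm_le.2 (g.norm_coe_le_norm x)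
  · have h1 : Tendsto (fun t => ‖poisson t g x - g x‖ₑ) (𝓝[>] 0) (𝓝 0) := by
      have h2 : Tendsto (fun t => ‖poisson t g x - g x‖ₑ) (𝓝 0) (𝓝 ‖poisson 0 g x - g x‖ₑ) :=
        ((continuous_poisson g x).sub (continuous_const (y := g x))).enorm.tendsto 0
      rw [poisson_zero, sub_self, enorm_zero] at h2
      exact h2.mono_left nhdsWithin_le_nhds
    refine h1.congr' ?_
    filter_upwards [self_mem_nhdsWithin] with t ht
    rw [poisson_eq_poissonD ht]

/-- Bounded continuous functions are dense in `L¹(γ_d)`, the convergence is clear for them by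
domination, and `P_t` contracts `L¹`. -/
theorem tendsto_lintegral_poissonD_sub (hf : Measurable f) (hfi : Integrable f (gauss d)) :
    Tendsto (fun t => ∫⁻ x, ‖poissonD 0 t f x - f x‖ₑ ∂(gauss d)) (𝓝[>] 0) (𝓝 0) := by
  rw [ENNReal.tendsto_nhds_zero]
  intro ε hε
  obtain ⟨g, hg, hgi⟩ := hfi.exists_boundedContinuous_lintegral_sub_le
    (ε := ε / 3) (ENNReal.div_pos hε.ne' (by simp)).ne'
  have hgm : Measurable g := g.continuous.measurable
  have h3 := (ENNReal.tendsto_nhds_zero.1 (tendsto_lintegral_poisson_sub_bounded g)) (ε / 3)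
    (ENNReal.div_pos hε.ne' (by simp))
  filter_upwards [h3, self_mem_nhdsWithin] with t h ht
  have hfg : Measurable fun y => f y - g y := hf.sub hgm
  have e1 := (lintegral_enorm_poissonD_zero_le hfg ht).trans hg
  have hmg := measurable_poissonD 0 t hgm
  calc ∫⁻ x, ‖poissonD 0 t f x - f x‖ₑ ∂(gauss d)
      ≤ ∫⁻ x, (‖poissonD 0 t (fun y => f y - g y) x‖ₑ + ‖poissonD 0 t g x - g x‖ₑ +
          ‖f x - g x‖ₑ) ∂(gauss d) := by
        refine lintegral_mono fun x => ?_
        rw [poissonD_sub hf hfi hgm hgi 0 ht]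
        have : poissonD 0 t f x - f x = (poissonD 0 t f x - poissonD 0 t g x) +
          (poissonD 0 t g x - g x) - (f x - g x) := by ring
        rw [this]
        exact enorm_sub_le.trans (add_le_add_left (enorm_add_le _ _) _)
    _ ≤ ε / 3 + ε / 3 + ε / 3 := by
        have hd : Measurable fun x => ‖poissonD 0 t g x - g x‖ₑ := (hmg.sub hgm).enorm
        rw [lintegral_add_right _ hfg.enorm, lintegral_add_right _ hd]
        exact add_le_add (add_le_add e1 h) hg
    _ = ε := ENNReal.add_thirds ε

/-- Needed to reach the base point `0`: differences of the path at `0` are limits of differences at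
positive times, where the path is smooth. Almost everywhere convergence along a sequence is enough
for Fatou's lemma. -/
theorem exists_seq_tendsto_poissonD (hf : Measurable f) (hfi : Integrable f (gauss d)) :
    ∃ t : ℕ → ℝ, (∀ i, 0 < t i) ∧ (∀ i, t i ≤ 1) ∧ Tendsto t atTop (𝓝 0) ∧
      ∀ᵐ x ∂(gauss d), Tendsto (fun i => poissonD 0 (t i) f x) atTop (𝓝 (f x)) := by
  set u : ℕ → ℝ := fun i => 1 / ((i : ℝ) + 1) with hu
  have hu0 : ∀ i, 0 < u i := fun i => by positivity
  have hu1 : ∀ i, u i ≤ 1 := fun i => by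
    rw [hu, div_le_one (by positivity)]
    linarith [(Nat.cast_nonneg i : (0 : ℝ) ≤ i)]
  have hut : Tendsto u atTop (𝓝 0) := tendsto_one_div_add_atTop_nhds_zero_nat
  have hut' : Tendsto u atTop (𝓝[>] 0) :=
    tendsto_nhdsWithin_iff.2 ⟨hut, Eventually.of_forall hu0⟩
  have h := (tendsto_lintegral_poissonD_sub hf hfi).comp hut'
  have hM : TendstoInMeasure (gauss d) (fun i => poissonD 0 (u i) f) atTop f := by
    refine tendstoInMeasure_of_tendsto_eLpNorm one_ne_zero
      (fun i => (measurable_poissonD 0 (u i) hf).aestronglyMeasurable) hf.aestronglyMeasurable ?_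
    simp only [eLpNorm_one_eq_lintegral_enorm, Pi.sub_apply]
    exact h
  obtain ⟨ns, hns, hae⟩ := hM.exists_seq_tendsto_ae
  exact ⟨fun i => u (ns i), fun i => hu0 _, fun i => hu1 _, hut.comp hns.tendsto_atTop, hae⟩

end GaussianBesov

end

noncomputable section

namespace GaussianBesov

/-! ### Hermite polynomials in one variable -/

open Polynomial in
/-- The (physicists') Hermite polynomials. -/
def hermitePoly : ℕ → Polynomial ℝ
  | 0 => 1
  | n + 1 => 2 * X * hermitePoly n - derivative (hermitePoly n)

theorem hasDerivAt_eval_mul_exp (Q : Polynomial ℝ) (s : ℝ) :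
    HasDerivAt (fun s => Q.eval s * Real.exp (-s ^ 2))
      ((Q.derivative.eval s - 2 * s * Q.eval s) * Real.exp (-s ^ 2)) s := by
  have h : HasDerivAt (fun s : ℝ => Real.exp (-s ^ 2)) (Real.exp (-s ^ 2) * (-(2 * s))) s := by
    have := ((hasDerivAt_pow 2 s).neg).exp
    simpa using this
  convert! (Q.hasDerivAt s).mul h using 1
  ring

theorem iteratedDeriv_exp_neg_sq (n : ℕ) :
    iteratedDeriv n (fun s : ℝ => Real.exp (-s ^ 2)) =
      fun s => (-1) ^ n * ((hermitePoly n).eval s * Real.exp (-s ^ 2)) := by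
  induction n with
  | zero => simp [hermitePoly]
  | succ n ih =>
    rw [iteratedDeriv_succ, ih]
    funext s
    rw [((hasDerivAt_eval_mul_exp (hermitePoly n) s).const_mul ((-1) ^ n)).deriv]
    simp [hermitePoly]
    ring

theorem derivative_hermitePoly (n : ℕ) :
    (hermitePoly (n + 1)).derivative = (2 * (n + 1) : ℝ) • hermitePoly n := by
  induction n with
  | zero =>
    simp [hermitePoly, Polynomial.smul_eq_C_mul]
    exact (map_ofNat Polynomial.C 2).symm
  | succ n ih =>
    have h : hermitePoly (n + 1) = 2 * Polynomial.X * hermitePoly n -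
      (hermitePoly n).derivative := rfl
    have h2 : hermitePoly (n + 2) = 2 * Polynomial.X * hermitePoly (n + 1) -
      (hermitePoly (n + 1)).derivative := rfl
    have h3 : (hermitePoly n).derivative = 2 * Polynomial.X * hermitePoly n - hermitePoly (n + 1) := by
      rw [h]; ring
    rw [h2]
    simp only [Polynomial.derivative_sub, Polynomial.derivative_mul, Polynomial.derivative_X, ih,
      Polynomial.derivative_smul, h3, Polynomial.derivative_ofNat]
    simp only [Polynomial.smul_eq_C_mul]
    push_cast
    simp only [map_mul, map_add, map_ofNat, map_natCast, map_one]
    ring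

theorem integrable_eval_mul_exp (Q : Polynomial ℝ) :
    Integrable fun s : ℝ => Q.eval s * Real.exp (-s ^ 2) := by
  induction Q using Polynomial.induction_on' with
  | add P Q hP hQ =>
    simp only [Polynomial.eval_add, add_mul]
    exact hP.add hQ
  | monomial n a =>
    have h := (integrable_rpow_mul_exp_neg_mul_sq one_pos (s := (n : ℝ))
      (by have : (0 : ℝ) ≤ n := n.cast_nonneg
          linarith)).const_mul a
    simpa [Polynomial.eval_monomial, mul_assoc] using h

theorem integral_eval_mul_exp_by_parts (Q : Polynomial ℝ) :
    ∫ s : ℝ, 2 * s * Q.eval s * Real.exp (-s ^ 2) =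
      ∫ s : ℝ, Q.derivative.eval s * Real.exp (-s ^ 2) := by
  have h1 := integrable_eval_mul_exp (2 * Polynomial.X * Q)
  have h2 := integrable_eval_mul_exp Q.derivative
  simp only [Polynomial.eval_mul, Polynomial.eval_X, Polynomial.eval_ofNat] at h1
  have h := integral_eq_zero_of_hasDerivAt_of_integrable (hasDerivAt_eval_mul_exp Q)
    (by simp only [sub_mul]; exact h2.sub h1) (integrable_eval_mul_exp Q)
  simp only [sub_mul] at h
  rw [integral_sub h2 h1] at h
  linarith

/-- Put `φ(Q) = ∫ Q(b s + r x) e^{-s²} ds`. The recursion `H_{n+1} = 2X H_n - H_n'` and Gaussian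
integration by parts, with `b² = 1 - r²`, give `φ(H_{n+1}) = 2 r x φ(H_n) - r² φ(H_n')`. This is the
Hermite recursion for `r^n H_n(x)`. -/
theorem integral_hermitePoly {r b : ℝ} (hrb : b ^ 2 + r ^ 2 = 1) (n : ℕ) (x : ℝ) :
    ∫ s : ℝ, (hermitePoly n).eval (b * s + r * x) * (Real.exp (-s ^ 2) / Real.sqrt Real.pi) =
      r ^ n * (hermitePoly n).eval x := by
  have hpi : 0 < Real.sqrt Real.pi := Real.sqrt_pos.2 Real.pi_pos
  set φ : Polynomial ℝ → ℝ := fun Q => ∫ s : ℝ, Q.eval (b * s + r * x) * Real.exp (-s ^ 2) with hφ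
  have hcomp : ∀ (Q : Polynomial ℝ) (s : ℝ), Q.eval (b * s + r * x) =
      (Q.comp (Polynomial.C b * Polynomial.X + Polynomial.C (r * x))).eval s := by
    intro Q s; simp
  have hint : ∀ Q : Polynomial ℝ, Integrable fun s : ℝ => Q.eval (b * s + r * x) * Real.exp (-s ^ 2) := by
    intro Q
    simp only [hcomp]
    exact integrable_eval_mul_exp _
  have hstep : ∀ n, φ (hermitePoly (n + 1)) =
      2 * (r * x) * φ (hermitePoly n) - r ^ 2 * φ (hermitePoly n).derivative := by
    intro n
    have hp := integral_eval_mul_exp_by_parts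
      ((hermitePoly n).comp (Polynomial.C b * Polynomial.X + Polynomial.C (r * x)))
    have hq := integrable_eval_mul_exp (2 * Polynomial.X *
      ((hermitePoly n).comp (Polynomial.C b * Polynomial.X + Polynomial.C (r * x))))
    simp only [Polynomial.derivative_comp, Polynomial.eval_mul, ← hcomp, Polynomial.derivative_add,
      Polynomial.derivative_C_mul, Polynomial.derivative_X, Polynomial.derivative_C,
      Polynomial.eval_C, Polynomial.eval_X, Polynomial.eval_ofNat, mul_one, add_zero, mul_assoc] at hp hq
    rw [integral_const_mul, integral_const_mul] at hp
    calc φ (hermitePoly (n + 1))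
        = ∫ s : ℝ, (b * (2 * (s * ((hermitePoly n).eval (b * s + r * x) * Real.exp (-s ^ 2)))) +
            2 * (r * x) * ((hermitePoly n).eval (b * s + r * x) * Real.exp (-s ^ 2)) -
            (hermitePoly n).derivative.eval (b * s + r * x) * Real.exp (-s ^ 2)) := by
          simp only [hφ, hermitePoly]
          congr 1
          funext s
          simp
          ring
      _ = b * (b * φ (hermitePoly n).derivative) + 2 * (r * x) * φ (hermitePoly n) -
            φ (hermitePoly n).derivative := by
          have hadd : Integrable fun s : ℝ =>
              b * (2 * (s * ((hermitePoly n).eval (b * s + r * x) * Real.exp (-s ^ 2)))) +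
              2 * (r * x) * ((hermitePoly n).eval (b * s + r * x) * Real.exp (-s ^ 2)) :=
            (hq.const_mul b).add ((hint _).const_mul _)
          rw [integral_sub hadd (hint _), integral_add (hq.const_mul b) ((hint _).const_mul _), integral_const_mul,
            integral_const_mul, integral_const_mul, hp]
      _ = _ := by
          have : b * b = 1 - r ^ 2 := by linarith [sq b]
          linear_combination φ (hermitePoly n).derivative * this
  have h0 : φ (hermitePoly 0) = Real.sqrt Real.pi := by
    have := integral_gaussian 1
    simpa [hφ, hermitePoly] using this
  -- Since `H_{n+1}'` is a multiple of `H_n`, the recursion has order two, and two consecutive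
  -- indices are carried.
  have key : ∀ n, φ (hermitePoly n) = Real.sqrt Real.pi * (r ^ n * (hermitePoly n).eval x) ∧
      φ (hermitePoly (n + 1)) =
        Real.sqrt Real.pi * (r ^ (n + 1) * (hermitePoly (n + 1)).eval x) := by
    intro n
    induction n with
    | zero =>
      refine ⟨by rw [h0]; simp [hermitePoly], ?_⟩
      rw [hstep 0, h0]
      simp [hermitePoly, hφ]
      ring
    | succ n ih =>
      refine ⟨ih.2, ?_⟩
      have hd : φ (hermitePoly (n + 1)).derivative = 2 * (n + 1) * φ (hermitePoly n) := by
        rw [derivative_hermitePoly]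
        simp only [hφ, Polynomial.eval_smul, smul_eq_mul, mul_assoc, integral_const_mul]
      have h2 : (hermitePoly (n + 1 + 1)).eval x = 2 * x * (hermitePoly (n + 1)).eval x -
          2 * (n + 1) * (hermitePoly n).eval x := by
        have : hermitePoly (n + 1 + 1) = 2 * Polynomial.X * hermitePoly (n + 1) -
          (hermitePoly (n + 1)).derivative := rfl
        rw [this, derivative_hermitePoly]
        simp
      rw [hstep (n + 1), hd, ih.1, ih.2, h2]
      ring
  simp only [mul_div_assoc', integral_div]
  rw [div_eq_iff hpi.ne', mul_comm _ (Real.sqrt _)]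
  exact (key n).1

theorem exists_abs_eval_le (Q : Polynomial ℝ) :
    ∃ C : ℝ, 0 ≤ C ∧ ∃ m : ℕ, ∀ s : ℝ, |Q.eval s| ≤ C * (1 + |s|) ^ m := by
  induction Q using Polynomial.induction_on' with
  | add P Q hP hQ =>
    obtain ⟨A, hA, m, hPm⟩ := hP
    obtain ⟨B, hB, k, hQk⟩ := hQ
    refine ⟨A + B, by positivity, m + k, fun s => ?_⟩
    have h1 : 1 ≤ 1 + |s| := by linarith [abs_nonneg s]
    have e1 : (1 + |s|) ^ m ≤ (1 + |s|) ^ (m + k) := pow_le_pow_right₀ h1 (by omega)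
    have e2 : (1 + |s|) ^ k ≤ (1 + |s|) ^ (m + k) := pow_le_pow_right₀ h1 (by omega)
    rw [Polynomial.eval_add, add_mul]
    refine (abs_add_le _ _).trans (add_le_add ((hPm s).trans ?_) ((hQk s).trans ?_))
    · exact mul_le_mul_of_nonneg_left e1 hA
    · exact mul_le_mul_of_nonneg_left e2 hB
  | monomial n a =>
    refine ⟨|a|, abs_nonneg a, n, fun s => ?_⟩
    rw [Polynomial.eval_monomial, abs_mul, abs_pow]
    refine mul_le_mul_of_nonneg_left (pow_le_pow_left₀ (abs_nonneg s) (by linarith) n) (abs_nonneg a)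

/-! ### Hermite polynomials in several variables -/

variable {d : ℕ}

theorem hermiteH_eq (ν : Fin d → ℕ) (x : E d) :
    hermiteH ν x = 1 / Real.sqrt (2 ^ (∑ i, ν i) * ∏ i, ((ν i).factorial : ℝ)) *
      ∏ i, (hermitePoly (ν i)).eval (x i) := by
  unfold hermiteH
  congr 1
  refine Finset.prod_congr rfl fun i _ => ?_
  rw [iteratedDeriv_exp_neg_sq]
  have h : ((-1 : ℝ) ^ ν i) * (-1) ^ ν i = 1 := by rw [← mul_pow]; simp
  have h' : Real.exp (x i ^ 2) * Real.exp (-x i ^ 2) = 1 := by rw [← Real.exp_add]; simp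
  linear_combination ((hermitePoly (ν i)).eval (x i)) * h +
    ((-1 : ℝ) ^ ν i * (-1) ^ ν i * (hermitePoly (ν i)).eval (x i)) * h'

theorem measurable_hermiteH (ν : Fin d → ℕ) : Measurable (hermiteH ν) := by
  have h : hermiteH ν = fun x => 1 / Real.sqrt (2 ^ (∑ i, ν i) * ∏ i, ((ν i).factorial : ℝ)) *
      ∏ i, (hermitePoly (ν i)).eval (x i) := funext (hermiteH_eq ν)
  rw [h]
  have h2 : Continuous fun x : E d => ∏ i, (hermitePoly (ν i)).eval (x i) :=
    continuous_finsetProd _ fun i _ => (hermitePoly (ν i)).continuous.comp (by fun_prop)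
  exact (continuous_const.mul h2).measurable

theorem exists_abs_hermiteH_le (ν : Fin d → ℕ) :
    ∃ C : ℝ, 0 ≤ C ∧ ∃ m : ℕ, ∀ x : E d, |hermiteH ν x| ≤ C * (1 + ‖x‖) ^ m := by
  choose A hA m hm using fun i => exists_abs_eval_le (hermitePoly (ν i))
  refine ⟨|1 / Real.sqrt (2 ^ (∑ i, ν i) * ∏ i, ((ν i).factorial : ℝ))| * ∏ i, A i,
    mul_nonneg (abs_nonneg _) (Finset.prod_nonneg fun i _ => hA i), ∑ i, m i, fun x => ?_⟩
  have e : (∏ i, A i) * (1 + ‖x‖) ^ ∑ i, m i = ∏ i, (A i * (1 + ‖x‖) ^ m i) := by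
    rw [Finset.prod_mul_distrib, Finset.prod_pow_eq_pow_sum]
  rw [hermiteH_eq, abs_mul, mul_assoc, Finset.abs_prod, e]
  refine mul_le_mul_of_nonneg_left (Finset.prod_le_prod (fun i _ => abs_nonneg _) fun i _ => ?_)
    (abs_nonneg _)
  refine (hm i (x i)).trans (mul_le_mul_of_nonneg_left (pow_le_pow_left₀ (by positivity) ?_ _) (hA i))
  have h : |x i| ≤ ‖x‖ := by simpa using PiLp.norm_apply_le x i
  linarith

theorem integral_gauss_prod (g : Fin d → ℝ → ℝ) :
    ∫ u, ∏ i, g i (u i) ∂(gauss d) =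
      ∏ i, ∫ s : ℝ, g i s * (Real.exp (-s ^ 2) / Real.sqrt Real.pi) := by
  rw [← integral_fintype_prod_volume_eq_prod, gauss,
    integral_withDensity_eq_integral_toReal_smul (by fun_prop) (by simp),
    ← (EuclideanSpace.volume_preserving_symm_measurableEquiv_toLp (Fin d)).symm.integral_comp']
  refine integral_congr_ae (.of_forall fun u => ?_)
  have hpi : (0 : ℝ) < Real.pi ^ ((d : ℝ) / 2) := by positivity
  simp only [smul_eq_mul, Finset.prod_mul_distrib]
  rw [ENNReal.toReal_ofReal (by positivity), Finset.prod_div_distrib, ← Real.exp_sum,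
    EuclideanSpace.norm_sq_eq, mul_comm]
  congr 2
  · simp
  · rw [Finset.prod_const, Finset.card_univ, Fintype.card_fin, Real.sqrt_eq_rpow,
      ← Real.rpow_natCast, ← Real.rpow_mul Real.pi_pos.le]
    congr 1
    ring

theorem ouSemigroup_hermiteH {σ : ℝ} (hσ : 0 < σ) (ν : Fin d → ℕ) (x : E d) :
    ouSemigroup σ (hermiteH ν) x = Real.exp (-σ) ^ (∑ i, ν i) * hermiteH ν x := by
  simp only [ouSemigroup_eq, hermiteH_eq, integral_const_mul]
  have h := integral_gauss_prod (fun i s =>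
    (hermitePoly (ν i)).eval (ouStd σ * s + Real.exp (-σ) * x i))
  simp only [integral_hermitePoly (ouStd_sq_add hσ), Finset.prod_mul_distrib,
    Finset.prod_pow_eq_pow_sum] at h
  simp only [PiLp.add_apply, PiLp.smul_apply, smul_eq_mul]
  rw [h]
  ring

end GaussianBesov

end

noncomputable section

namespace GaussianBesov

variable {d : ℕ} {f : E d → ℝ}

/-! ### Polynomial weights -/

/-- The weight `(1 + |x|)^m`. -/
def polyWeight (m : ℕ) (x : E d) : ℝ≥0∞ := ENNReal.ofReal ((1 + ‖x‖) ^ m)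

theorem measurable_polyWeight (m : ℕ) : Measurable (polyWeight m : E d → ℝ≥0∞) := by
  unfold polyWeight; fun_prop

theorem polyWeight_ne_top (m : ℕ) (x : E d) : polyWeight m x ≠ ⊤ := ENNReal.ofReal_ne_top

theorem one_le_polyWeight (m : ℕ) (x : E d) : 1 ≤ polyWeight m x := by
  rw [polyWeight, ← ENNReal.ofReal_one]
  exact ENNReal.ofReal_le_ofReal (one_le_pow₀ (by linarith [norm_nonneg x]))

theorem lintegral_polyWeight_ne_top (m : ℕ) : ∫⁻ x : E d, polyWeight m x ∂(gauss d) ≠ ⊤ := by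
  obtain ⟨C, hC⟩ := exists_eval_mul_exp_neg_sq_le ((1 + Polynomial.X) ^ m) (c := 1 / 2)
    (by norm_num)
  have h : ∀ x : E d, polyWeight m x ≤
      ENNReal.ofReal C * ENNReal.ofReal (Real.exp (‖x‖ ^ 2 / 2)) := by
    intro x
    rw [← ENNReal.ofReal_mul' (Real.exp_pos _).le]
    refine ENNReal.ofReal_le_ofReal ?_
    have := hC ‖x‖ (norm_nonneg x)
    simp only [Polynomial.eval_pow, Polynomial.eval_add, Polynomial.eval_one, Polynomial.eval_X] at this
    rw [abs_of_nonneg (by positivity), Real.exp_neg, ← div_eq_mul_inv, div_le_iff₀ (Real.exp_pos _)]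
      at this
    rwa [show ‖x‖ ^ 2 / 2 = 1 / 2 * ‖x‖ ^ 2 by ring]
  refine ne_top_of_le_ne_top ?_ (lintegral_mono h)
  rw [lintegral_const_mul' _ _ ENNReal.ofReal_ne_top]
  exact ENNReal.mul_ne_top ENNReal.ofReal_ne_top lintegral_exp_half_sq_norm_ne_top

/-- The weight is submultiplicative: `1 + ‖u‖ + ‖x‖ ≤ (1 + ‖u‖)(1 + ‖x‖)`. Both coefficients in
Mehler's formula are at most `1`, so the bound is uniform in `σ`. -/
theorem ouPos_polyWeight_le (m : ℕ) {σ : ℝ} (hσ : 0 < σ) (x : E d) :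
    ouPos σ (polyWeight m) x ≤ (∫⁻ u : E d, polyWeight m u ∂(gauss d)) * polyWeight m x := by
  rw [← lintegral_mul_const _ (measurable_polyWeight m)]
  refine lintegral_mono fun u => ?_
  rw [polyWeight, polyWeight, polyWeight, ← ENNReal.ofReal_mul (by positivity), ← mul_pow]
  refine ENNReal.ofReal_le_ofReal (pow_le_pow_left₀ (by positivity) ?_ m)
  have h1 : ouStd σ ≤ 1 := by nlinarith [ouStd_sq_add hσ, ouStd_pos hσ, sq_nonneg (Real.exp (-σ))]
  have h2 : Real.exp (-σ) ≤ 1 := Real.exp_le_one_iff.2 (by linarith)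
  have h3 : ‖ouStd σ • u + Real.exp (-σ) • x‖ ≤ ‖u‖ + ‖x‖ := by
    refine (norm_add_le _ _).trans ?_
    rw [norm_smul, norm_smul, Real.norm_of_nonneg (ouStd_pos hσ).le,
      Real.norm_of_nonneg (Real.exp_pos _).le]
    exact add_le_add (mul_le_of_le_one_left (norm_nonneg u) h1)
      (mul_le_of_le_one_left (norm_nonneg x) h2)
  nlinarith [norm_nonneg u, norm_nonneg x, mul_nonneg (norm_nonneg u) (norm_nonneg x)]

/-- An exponent bounded below by `r > 1` leaves room for Hölder, and polynomial weights have all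
Gaussian moments. It makes Hermite coefficients of `L^{p(·)}` functions finite. -/
theorem exists_lintegral_mul_polyWeight_le {p : E d → ℝ} (hp : IsAdmissible p) (m : ℕ) :
    ∃ C : ℝ≥0, ∀ F : E d → ℝ≥0∞,
      ∫⁻ x, F x * polyWeight m x ∂(gauss d) ≤ C * luxNorm (gauss d) p F := by
  obtain ⟨r, hr, hrp⟩ := hp.lower
  have hc := Real.HolderConjugate.conjExponent hr
  set s := r.conjExponent
  have hW : ∫⁻ x : E d, polyWeight m x ^ s ∂(gauss d) ≠ ⊤ := by
    refine ne_top_of_le_ne_top (lintegral_polyWeight_ne_top (m * ⌈s⌉₊)) (lintegral_mono fun x => ?_)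
    calc polyWeight m x ^ s ≤ polyWeight m x ^ (⌈s⌉₊ : ℝ) :=
          ENNReal.rpow_le_rpow_of_exponent_le (one_le_polyWeight m x) (Nat.le_ceil s)
      _ = polyWeight (m * ⌈s⌉₊) x := by
          rw [ENNReal.rpow_natCast, polyWeight, polyWeight, ← ENNReal.ofReal_pow (by positivity),
            pow_mul]
  have hT : 2 + ∫⁻ x : E d, polyWeight m x ^ s ∂(gauss d) ≠ ⊤ := by finiteness
  refine ⟨(2 + ∫⁻ x : E d, polyWeight m x ^ s ∂(gauss d)).toNNReal, fun F => ?_⟩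
  rw [ENNReal.coe_toNNReal hT]
  exact lintegral_mul_le_luxNorm hc hrp (measurable_polyWeight m) hW

theorem exists_enorm_hermiteH_le (ν : Fin d → ℕ) :
    ∃ C : ℝ≥0, ∃ m : ℕ, ∀ x : E d, ‖hermiteH ν x‖ₑ ≤ C * polyWeight m x := by
  obtain ⟨C, hC, m, h⟩ := exists_abs_hermiteH_le ν
  refine ⟨C.toNNReal, m, fun x => ?_⟩
  rw [polyWeight, ← ENNReal.ofReal, ← ENNReal.ofReal_mul hC, Real.enorm_eq_ofReal_abs]
  exact ENNReal.ofReal_le_ofReal (h x)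

/-! ### Symmetry of the semigroups -/

/-- The rotation takes the pair (noise, `x`) to a pair whose first entry is `y = ouStd σ • u +
e^{-σ} • x`, and applying Mehler's formula to the new pair returns `x`. The roles of `x` and `y` are
therefore interchangeable. -/
theorem lintegral_ouPos_mul {F G : E d → ℝ≥0∞} (hF : Measurable F) (hG : Measurable G) {σ : ℝ}
    (hσ : 0 < σ) :
    ∫⁻ x, ouPos σ F x * G x ∂(gauss d) = ∫⁻ y, F y * ouPos σ G y ∂(gauss d) := by
  have hrot := measurePreserving_rotation (d := d) (ouStd_pos hσ) (ouStd_sq_add hσ)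
  set H : E d × E d → ℝ≥0∞ := fun w =>
    F w.1 * G (ouStd σ • w.2 + Real.exp (-σ) • w.1) with hH
  have hHm : Measurable H := by fun_prop
  have h1 : ∫⁻ y, F y * ouPos σ G y ∂(gauss d) =
      ∫⁻ w, H w ∂((gauss d).prod (gauss d)) := by
    rw [lintegral_prod _ hHm.aemeasurable]
    refine lintegral_congr fun y => ?_
    exact (lintegral_const_mul _ (by fun_prop)).symm
  rw [h1, ← hrot.lintegral_comp hHm, lintegral_prod_symm _ (by fun_prop)]
  refine lintegral_congr fun x => ?_
  unfold ouPos
  rw [← lintegral_mul_const _ (by fun_prop)]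
  refine lintegral_congr fun u => ?_
  simp only [hH]
  congr 2
  have := ouStd_sq_add hσ
  have e : ouStd σ • (-Real.exp (-σ) • u + ouStd σ • x) +
      Real.exp (-σ) • (ouStd σ • u + Real.exp (-σ) • x) =
      (ouStd σ ^ 2 + Real.exp (-σ) ^ 2) • x := by module
  rw [e, this, one_smul]

theorem integral_ouSemigroup_mul {h : E d → ℝ} (hf : Measurable f) (hh : Measurable h) {σ : ℝ}
    (hσ : 0 < σ) (hi : ∫⁻ y, ‖f y‖ₑ * ouPos σ (fun z => ‖h z‖ₑ) y ∂(gauss d) ≠ ⊤) :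
    ∫ x, ouSemigroup σ f x * h x ∂(gauss d) = ∫ y, f y * ouSemigroup σ h y ∂(gauss d) := by
  have hrot := measurePreserving_rotation (d := d) (ouStd_pos hσ) (ouStd_sq_add hσ)
  set H : E d × E d → ℝ := fun w =>
    f w.1 * h (ouStd σ • w.2 + Real.exp (-σ) • w.1) with hH
  have hHm : Measurable H := by fun_prop
  have hHi : Integrable H ((gauss d).prod (gauss d)) := by
    refine ⟨hHm.aestronglyMeasurable, ?_⟩
    rw [hasFiniteIntegral_iff_enorm]
    refine (lintegral_prod _ hHm.enorm.aemeasurable).trans_lt (lt_of_eq_of_lt ?_ hi.lt_top)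
    refine lintegral_congr fun y => ?_
    simp only [hH, enorm_mul]
    exact lintegral_const_mul _ (by fun_prop)
  have h1 : ∫ y, f y * ouSemigroup σ h y ∂(gauss d) = ∫ w, H w ∂((gauss d).prod (gauss d)) := by
    rw [integral_prod _ hHi]
    refine integral_congr_ae (.of_forall fun y => ?_)
    exact (integral_const_mul _ _).symm
  have h2 : ∫ w, H w ∂((gauss d).prod (gauss d)) = ∫ w, H ((fun z : E d × E d =>
      (ouStd σ • z.1 + Real.exp (-σ) • z.2, -Real.exp (-σ) • z.1 + ouStd σ • z.2)) w)
      ∂((gauss d).prod (gauss d)) := by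
    conv_lhs => rw [← hrot.map_eq]
    exact integral_map hrot.measurable.aemeasurable hHm.aestronglyMeasurable
  rw [h1, h2]
  refine Eq.trans ?_ (integral_prod_symm _ (hrot.integrable_comp_of_integrable hHi)).symm
  refine integral_congr_ae (.of_forall fun x => ?_)
  simp only [ouSemigroup_eq]
  rw [← integral_mul_const]
  refine integral_congr_ae (.of_forall fun u => ?_)
  simp only [hH, Function.comp_apply]
  congr 2
  have := ouStd_sq_add hσ
  have e : ouStd σ • (-Real.exp (-σ) • u + ouStd σ • x) +
      Real.exp (-σ) • (ouStd σ • u + Real.exp (-σ) • x) =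
      (ouStd σ ^ 2 + Real.exp (-σ) ^ 2) • x := by module
  rw [e, this, one_smul]

/-! ### Hermite coefficients -/

/-- Measurable functions that are integrable against all polynomial weights. -/
structure PolyIntegrable (f : E d → ℝ) : Prop where
  measurable : Measurable f
  ne_top : ∀ m, ∫⁻ x, ‖f x‖ₑ * polyWeight m x ∂(gauss d) ≠ ⊤

theorem PolyIntegrable.of_luxNorm {p : E d → ℝ} (hp : IsAdmissible p) (hf : Measurable f)
    (hN : varLpNorm (gauss d) p f ≠ ⊤) : PolyIntegrable f := by
  refine ⟨hf, fun m => ?_⟩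
  obtain ⟨C, hC⟩ := exists_lintegral_mul_polyWeight_le hp m
  exact ne_top_of_le_ne_top (ENNReal.mul_ne_top ENNReal.coe_ne_top hN) (hC _)

theorem PolyIntegrable.integrable (hf : PolyIntegrable f) : Integrable f (gauss d) := by
  refine ⟨hf.measurable.aestronglyMeasurable, lt_of_le_of_lt ?_ (hf.ne_top 0).lt_top⟩
  refine lintegral_mono fun x => ?_
  simp [polyWeight]

theorem PolyIntegrable.integrable_mul_hermiteH (hf : PolyIntegrable f) (ν : Fin d → ℕ) :
    Integrable (fun x => f x * hermiteH ν x) (gauss d) := by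
  obtain ⟨C, m, h⟩ := exists_enorm_hermiteH_le ν
  refine ⟨(hf.measurable.mul (measurable_hermiteH ν)).aestronglyMeasurable, ?_⟩
  refine lt_of_le_of_lt (lintegral_mono (g := fun x => C * (‖f x‖ₑ * polyWeight m x)) fun x => ?_) ?_
  · simp only [enorm_mul]
    rw [mul_left_comm]
    gcongr
    exact h x
  · rw [lintegral_const_mul' _ _ ENNReal.coe_ne_top]
    exact ENNReal.mul_lt_top ENNReal.coe_lt_top (hf.ne_top m).lt_top

theorem lintegral_poissonPos_mul_polyWeight_le {F : E d → ℝ≥0∞} (hF : Measurable F) (l m : ℕ)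
    (t : ℝ) : ∫⁻ x, poissonPos l t F x * polyWeight m x ∂(gauss d) ≤
      (∫⁻ σ in Set.Ioi 0, ‖subKer l t σ‖ₑ) * ((∫⁻ u : E d, polyWeight m u ∂(gauss d)) *
        ∫⁻ x, F x * polyWeight m x ∂(gauss d)) := by
  have hmF : Measurable fun w : E d × ℝ => ouPos w.2 F w.1 :=
    (measurable_ouPos_uncurry hF).comp (f := fun w : E d × ℝ => (w.2, w.1)) (by fun_prop)
  have hm : Measurable fun w : E d × ℝ =>
      ‖subKer l t w.2‖ₑ * (ouPos w.2 F w.1 * polyWeight m w.1) :=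
    ((measurable_subKer l t).comp measurable_snd).enorm.mul
      (hmF.mul ((measurable_polyWeight m).comp measurable_fst))
  have hswap := lintegral_lintegral_swap (μ := gauss d) (ν := volume.restrict (Set.Ioi 0))
    (f := fun x σ => ‖subKer l t σ‖ₑ * (ouPos σ F x * polyWeight m x)) hm.aemeasurable
  have h1 : ∀ x : E d, poissonPos l t F x * polyWeight m x =
      ∫⁻ σ in Set.Ioi 0, ‖subKer l t σ‖ₑ * (ouPos σ F x * polyWeight m x) := by
    intro x
    unfold poissonPos
    rw [← lintegral_mul_const' _ _ (polyWeight_ne_top m x)]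
    simp only [mul_assoc]
  simp only [h1]
  rw [hswap, ← lintegral_mul_const _ (measurable_subKer l t).enorm]
  refine setLIntegral_mono' measurableSet_Ioi fun σ hσ => ?_
  rw [lintegral_const_mul' _ _ enorm_ne_top, lintegral_ouPos_mul hF (measurable_polyWeight m) hσ,
    ← lintegral_const_mul' _ _ (lintegral_polyWeight_ne_top m)]
  refine mul_le_mul_right (lintegral_mono fun y => ?_) _
  rw [mul_left_comm]
  gcongr
  exact ouPos_polyWeight_le m hσ y

theorem PolyIntegrable.poissonD (hf : PolyIntegrable f) (l : ℕ) {t : ℝ} (ht : 0 < t) :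
    PolyIntegrable (poissonD l t f) := by
  refine ⟨measurable_poissonD l t hf.measurable, fun m => ?_⟩
  refine ne_top_of_le_ne_top (ENNReal.mul_ne_top (lintegral_subKer_ne_top l ht)
    (ENNReal.mul_ne_top (lintegral_polyWeight_ne_top m) (hf.ne_top m)))
    ((lintegral_mono fun x => ?_).trans
      (lintegral_poissonPos_mul_polyWeight_le hf.measurable.enorm l m t))
  gcongr
  exact enorm_poissonD_le l t f x

/-- Symmetry moves `T_σ` onto `h_ν`, an eigenfunction with eigenvalue `e^{-|ν|σ}`, and the Laplace
transform of the stable density at `|ν|` gives the factor. Polynomial weights justify Fubini. -/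
theorem hermiteCoeff_poissonD (hf : PolyIntegrable f) {t : ℝ} (ht : 0 < t) (ν : Fin d → ℕ) :
    hermiteCoeff (poissonD 0 t f) ν =
      Real.exp (-(t * Real.sqrt ((∑ i, ν i : ℕ) : ℝ))) * hermiteCoeff f ν := by
  obtain ⟨C, m, hC⟩ := exists_enorm_hermiteH_le ν
  have hhm := measurable_hermiteH ν
  have hmf : Measurable fun w : E d × ℝ => ouSemigroup w.2 f w.1 :=
    (measurable_ouSemigroup_uncurry hf.measurable).comp (f := fun w : E d × ℝ => (w.2, w.1))
      (by fun_prop)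
  have hm : Measurable fun w : E d × ℝ =>
      subKer 0 t w.2 * (ouSemigroup w.2 f w.1 * hermiteH ν w.1) :=
    ((measurable_subKer 0 t).comp measurable_snd).mul (hmf.mul (hhm.comp measurable_fst))
  have hfin : ∫⁻ x, (∫⁻ σ in Set.Ioi (0 : ℝ),
      ‖subKer 0 t σ * (ouSemigroup σ f x * hermiteH ν x)‖ₑ) ∂(gauss d) < ⊤ := by
    refine lt_of_le_of_lt (b := ∫⁻ x, C * (poissonPos 0 t (fun y => ‖f y‖ₑ) x * polyWeight m x)
      ∂(gauss d)) (lintegral_mono fun x => ?_) ?_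
    · unfold poissonPos
      rw [← lintegral_mul_const' _ _ (polyWeight_ne_top m x),
        ← lintegral_const_mul' _ _ ENNReal.coe_ne_top]
      refine lintegral_mono fun σ => ?_
      rw [enorm_mul, enorm_mul]
      calc ‖subKer 0 t σ‖ₑ * (‖ouSemigroup σ f x‖ₑ * ‖hermiteH ν x‖ₑ)
          ≤ ‖subKer 0 t σ‖ₑ * (ouPos σ (fun y => ‖f y‖ₑ) x * (C * polyWeight m x)) := by
            gcongr
            · exact enorm_ouSemigroup_le σ f x
            · exact hC x
        _ = _ := by ring
    · rw [lintegral_const_mul' _ _ ENNReal.coe_ne_top]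
      refine ENNReal.mul_lt_top ENNReal.coe_lt_top
        ((lintegral_poissonPos_mul_polyWeight_le hf.measurable.enorm 0 m t).trans_lt ?_)
      exact ENNReal.mul_lt_top (lintegral_subKer_ne_top 0 ht).lt_top
        (ENNReal.mul_lt_top (lintegral_polyWeight_ne_top m).lt_top (hf.ne_top m).lt_top)
  have hint : Integrable (Function.uncurry fun x σ =>
      subKer 0 t σ * (ouSemigroup σ f x * hermiteH ν x))
      ((gauss d).prod (volume.restrict (Set.Ioi 0))) := by
    refine ⟨hm.aestronglyMeasurable, ?_⟩
    rw [hasFiniteIntegral_iff_enorm]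
    exact (lintegral_prod _ hm.enorm.aemeasurable).trans_lt hfin
  have h1 : hermiteCoeff (poissonD 0 t f) ν = ∫ x, (∫ σ in Set.Ioi (0 : ℝ),
      subKer 0 t σ * (ouSemigroup σ f x * hermiteH ν x)) ∂(gauss d) := by
    unfold hermiteCoeff
    refine integral_congr_ae (.of_forall fun x => ?_)
    simp only [GaussianBesov.poissonD]
    rw [← integral_mul_const]
    simp only [mul_assoc]
  have h2 : ∀ σ > 0, ∫ x, subKer 0 t σ * (ouSemigroup σ f x * hermiteH ν x) ∂(gauss d) =
      subKer 0 t σ * Real.exp (-(((∑ i, ν i : ℕ) : ℝ) * σ)) * hermiteCoeff f ν := by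
    intro σ hσ
    have hi : ∫⁻ y, ‖f y‖ₑ * ouPos σ (fun z => ‖hermiteH ν z‖ₑ) y ∂(gauss d) ≠ ⊤ := by
      refine ne_top_of_le_ne_top (ENNReal.mul_ne_top (ENNReal.mul_ne_top (b := C)
        (lintegral_polyWeight_ne_top (d := d) m) ENNReal.coe_ne_top) (hf.ne_top m)) ?_
      rw [← lintegral_const_mul' _ _ (ENNReal.mul_ne_top (lintegral_polyWeight_ne_top m)
        ENNReal.coe_ne_top)]
      refine lintegral_mono fun y => ?_
      calc ‖f y‖ₑ * ouPos σ (fun z => ‖hermiteH ν z‖ₑ) y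
          ≤ ‖f y‖ₑ * (C * ((∫⁻ u : E d, polyWeight m u ∂(gauss d)) * polyWeight m y)) := by
            gcongr
            refine (ouPos_mono hC σ y).trans ?_
            rw [ouPos_const_mul (measurable_polyWeight m)]
            gcongr
            exact ouPos_polyWeight_le m hσ y
        _ = _ := by ring
    rw [integral_const_mul, integral_ouSemigroup_mul hf.measurable hhm hσ hi]
    simp only [ouSemigroup_hermiteH hσ]
    have : ∀ y, f y * (Real.exp (-σ) ^ (∑ i, ν i) * hermiteH ν y) =
        Real.exp (-σ) ^ (∑ i, ν i) * (f y * hermiteH ν y) := fun y => by ring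
    simp only [this, integral_const_mul]
    rw [hermiteCoeff, ← Real.exp_nat_mul, mul_assoc]
    congr 3
    ring
  rw [h1, integral_integral_swap hint, setIntegral_congr_fun measurableSet_Ioi h2,
    integral_mul_const, integral_subKer_zero_mul_exp ht (by positivity)]

theorem PolyIntegrable.besselDiff (hf : PolyIntegrable f) {t : ℝ} (ht : 0 < t) :
    PolyIntegrable (besselDiff t f) := by
  have hP := hf.poissonD 0 ht
  have h : GaussianBesov.besselDiff t f =
      fun x => Real.exp (-t) * GaussianBesov.poissonD 0 t f x - f x := by
    funext x
    rw [GaussianBesov.besselDiff, poisson_eq_poissonD ht]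
  rw [h]
  refine ⟨(hP.measurable.const_mul _).sub hf.measurable, fun m => ?_⟩
  refine ne_top_of_le_ne_top (b := ∫⁻ x, (‖Real.exp (-t)‖ₑ *
    (‖GaussianBesov.poissonD 0 t f x‖ₑ * polyWeight m x) + ‖f x‖ₑ * polyWeight m x) ∂(gauss d))
    ?_ (lintegral_mono fun x => ?_)
  · have hw : Measurable fun x => ‖f x‖ₑ * polyWeight m x :=
      hf.measurable.enorm.mul (measurable_polyWeight m)
    rw [lintegral_add_right _ hw,
      lintegral_const_mul' _ _ enorm_ne_top]
    exact ENNReal.add_ne_top.2 ⟨ENNReal.mul_ne_top enorm_ne_top (hP.ne_top m), hf.ne_top m⟩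
  · rw [← mul_assoc, ← add_mul, ← enorm_mul]
    gcongr
    exact enorm_sub_le

theorem hermiteCoeff_besselDiff (hf : PolyIntegrable f) {t : ℝ} (ht : 0 < t) (ν : Fin d → ℕ) :
    hermiteCoeff (besselDiff t f) ν =
      (Real.exp (-(t * (1 + Real.sqrt ((∑ i, ν i : ℕ) : ℝ)))) - 1) * hermiteCoeff f ν := by
  have h1 := hermiteCoeff_poissonD hf ht ν
  have e : hermiteCoeff (besselDiff t f) ν =
      Real.exp (-t) * hermiteCoeff (poissonD 0 t f) ν - hermiteCoeff f ν := by
    unfold hermiteCoeff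
    rw [← integral_const_mul, ← integral_sub
      (((hf.poissonD 0 ht).integrable_mul_hermiteH ν).const_mul _) (hf.integrable_mul_hermiteH ν)]
    refine integral_congr_ae (.of_forall fun x => ?_)
    simp only [besselDiff, poisson_eq_poissonD ht]
    ring
  rw [e, h1, mul_add, mul_one, neg_add, Real.exp_add]
  ring

theorem PolyIntegrable.besselDiff_iterate (hf : PolyIntegrable f) {t : ℝ} (ht : 0 < t) (n : ℕ) :
    PolyIntegrable ((GaussianBesov.besselDiff t)^[n] f) := by
  induction n with
  | zero => exact hf
  | succ n ih => rw [Function.iterate_succ_apply']; exact ih.besselDiff ht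

theorem hermiteCoeff_besselDiff_iterate (hf : PolyIntegrable f) {t : ℝ} (ht : 0 < t) (n : ℕ)
    (ν : Fin d → ℕ) : hermiteCoeff ((besselDiff t)^[n] f) ν =
      (Real.exp (-(t * (1 + Real.sqrt ((∑ i, ν i : ℕ) : ℝ)))) - 1) ^ n * hermiteCoeff f ν := by
  induction n with
  | zero => simp
  | succ n ih =>
    rw [Function.iterate_succ_apply', hermiteCoeff_besselDiff (hf.besselDiff_iterate ht n) ht, ih,
      pow_succ']
    ring

end GaussianBesov

end

noncomputable section

namespace GaussianBesov

/-! ### Finite differences of smooth functions -/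

section Differences

variable {φ : ℕ → ℝ → ℝ}

theorem enorm_sub_le_lintegral (hφ : ∀ i, ∀ r > 0, HasDerivAt (φ i) (φ (i + 1) r) r) (i : ℕ)
    {s t : ℝ} (hst : t ≤ s) (ht : 0 < t) :
    ‖φ i s - φ i t‖ₑ ≤ ∫⁻ r in Set.Ioo t s, ‖φ (i + 1) r‖ₑ := by
  have hd : ∀ r ∈ Set.uIcc t s, HasDerivAt (φ i) (φ (i + 1) r) r := by
    intro r hr
    rw [Set.uIcc_of_le hst] at hr
    exact hφ i r (ht.trans_le hr.1)
  have hc : ContinuousOn (φ (i + 1)) (Set.uIcc t s) := by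
    intro r hr
    rw [Set.uIcc_of_le hst] at hr
    exact (hφ (i + 1) r (ht.trans_le hr.1)).continuousAt.continuousWithinAt
  rw [← intervalIntegral.integral_eq_sub_of_hasDerivAt hd hc.intervalIntegrable,
    intervalIntegral.integral_of_le hst, ← Measure.restrict_congr_set Ioo_ae_eq_Ioc]
  exact enorm_integral_le_lintegral_enorm _

/-- Forward differences commute with derivatives, so the induction is applied to the differenced
family; this is why `φ` is generalized. One more difference is an integral of one more derivative,
and Tonelli integrates `(r - t)^n` over `t < r < v`. The crude bound by length times maximum
suffices. -/
theorem enorm_fwdDiff_iterate_le (hφm : ∀ i, Measurable (φ i))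
    (hφ : ∀ i, ∀ r > 0, HasDerivAt (φ i) (φ (i + 1) r) r) (n : ℕ) {s t : ℝ} (hs : 0 < s)
    (ht : 0 < t) :
    ‖(fwdDiff s)^[n + 1] (φ 0) t‖ₑ ≤
      ∫⁻ r in Set.Ioo t (t + (n + 1) * s), ENNReal.ofReal ((r - t) ^ n) * ‖φ (n + 1) r‖ₑ := by
  induction n generalizing φ with
  | zero =>
    have h := enorm_sub_le_lintegral hφ 0 (s := t + s) (by linarith) ht
    simpa [fwdDiff] using h
  | succ n ih =>
    have hψ : ∀ i, ∀ r > 0, HasDerivAt (fwdDiff s (φ i)) (fwdDiff s (φ (i + 1)) r) r := by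
      intro i r hr
      exact (HasDerivAt.comp_add_const r s (hφ i (r + s) (by linarith [hr.lt]))).sub (hφ i r hr)
    have hψm : ∀ i, Measurable (fwdDiff s (φ i)) := fun i =>
      ((hφm i).comp (measurable_id.add_const s)).sub (hφm i)
    rw [Function.iterate_succ_apply]
    refine (ih (φ := fun i => fwdDiff s (φ i)) hψm hψ).trans ?_
    set T := t + ((n + 1 : ℕ) + 1) * s with hT
    have hTn : t + (n + 1) * s + s = T := by rw [hT]; push_cast; ring
    set K : ℝ → ℝ → ℝ≥0∞ := fun r v => ({w : ℝ × ℝ | w.1 < w.2}.indicator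
      (fun w => ENNReal.ofReal ((w.1 - t) ^ n) * ‖φ (n + 2) w.2‖ₑ) (r, v)) with hK
    have hKm : Measurable (Function.uncurry K) := by
      have h2 := hφm (n + 2)
      exact Measurable.indicator (by fun_prop) (measurableSet_lt measurable_fst measurable_snd)
    calc ∫⁻ r in Set.Ioo t (t + (n + 1) * s),
          ENNReal.ofReal ((r - t) ^ n) * ‖fwdDiff s (φ (n + 1)) r‖ₑ
        ≤ ∫⁻ r in Set.Ioo t (t + (n + 1) * s), ∫⁻ v in Set.Ioo t T, K r v := by
          refine setLIntegral_mono' measurableSet_Ioo fun r hr => ?_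
          have h1 := enorm_sub_le_lintegral hφ (n + 1) (s := r + s) (t := r) (by linarith)
            (ht.trans hr.1)
          calc ENNReal.ofReal ((r - t) ^ n) * ‖fwdDiff s (φ (n + 1)) r‖ₑ
              ≤ ENNReal.ofReal ((r - t) ^ n) * ∫⁻ v in Set.Ioo r (r + s), ‖φ (n + 2) v‖ₑ := by
                gcongr; exact h1
            _ = ∫⁻ v in Set.Ioo r (r + s), K r v := by
                rw [← lintegral_const_mul' _ _ ENNReal.ofReal_ne_top]
                refine setLIntegral_congr_fun measurableSet_Ioo fun v hv => ?_
                simp only [hK]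
                rw [Set.indicator_of_mem (show (r, v) ∈ {w : ℝ × ℝ | w.1 < w.2} from hv.1)]
            _ ≤ ∫⁻ v in Set.Ioo t T, K r v := by
                refine lintegral_mono_set (Set.Ioo_subset_Ioo hr.1.le ?_)
                rw [← hTn]
                linarith [hr.2]
      _ = ∫⁻ v in Set.Ioo t T, ∫⁻ r in Set.Ioo t (t + (n + 1) * s), K r v :=
          lintegral_lintegral_swap hKm.aemeasurable
      _ ≤ ∫⁻ v in Set.Ioo t T, ENNReal.ofReal ((v - t) ^ (n + 1)) * ‖φ (n + 2) v‖ₑ := by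
          refine setLIntegral_mono' measurableSet_Ioo fun v hv => ?_
          have hvt : 0 ≤ v - t := by linarith [hv.1]
          calc ∫⁻ r in Set.Ioo t (t + (n + 1) * s), K r v
              ≤ ∫⁻ r in Set.Ioo t (t + (n + 1) * s), (Set.Ioo t v).indicator
                  (fun _ => ENNReal.ofReal ((v - t) ^ n) * ‖φ (n + 2) v‖ₑ) r := by
                refine setLIntegral_mono' measurableSet_Ioo fun r hr => ?_
                by_cases hrv : r < v
                · simp only [hK]
                  rw [Set.indicator_of_mem (show (r, v) ∈ {w : ℝ × ℝ | w.1 < w.2} from hrv),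
                    Set.indicator_of_mem (show r ∈ Set.Ioo t v from ⟨hr.1, hrv⟩)]
                  refine mul_le_mul_left (ENNReal.ofReal_le_ofReal
                    (pow_le_pow_left₀ (by linarith [hr.1]) (by linarith) n)) _
                · simp only [hK]
                  rw [Set.indicator_of_notMem (show (r, v) ∉ {w : ℝ × ℝ | w.1 < w.2} from hrv)]
                  exact zero_le
            _ ≤ ∫⁻ r, (Set.Ioo t v).indicator
                  (fun _ => ENNReal.ofReal ((v - t) ^ n) * ‖φ (n + 2) v‖ₑ) r :=
                setLIntegral_le_lintegral _ _
            _ = ENNReal.ofReal ((v - t) ^ (n + 1)) * ‖φ (n + 2) v‖ₑ := by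
                rw [lintegral_indicator measurableSet_Ioo, setLIntegral_const, Real.volume_Ioo,
                  mul_right_comm, ← ENNReal.ofReal_mul (by positivity), pow_succ]

theorem lintegral_Ioi_rpow {β c : ℝ} (hβ : 0 < β) (hc : 0 < c) :
    ∫⁻ s in Set.Ioi c, ENNReal.ofReal (s ^ (-β - 1)) = ENNReal.ofReal (c ^ (-β) / β) := by
  have hi := integrableOn_Ioi_rpow_of_lt (a := -β - 1) (by linarith) hc
  rw [← ofReal_integral_eq_lintegral_ofReal hi, integral_Ioi_rpow_of_lt (by linarith) hc]
  · congr 1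
    rw [show -β - 1 + 1 = -β by ring, neg_div_neg_eq]
  · filter_upwards [ae_restrict_mem measurableSet_Ioi] with s hs
    exact Real.rpow_nonneg (hc.trans hs).le _

/-- For fixed `ρ` only steps `s > ρ/(n+1)` contribute, and the integral of `s^{-β-1}` over them is a
multiple of `ρ^{-β}`. Thus `ρ^n` becomes `ρ^{n-β}`. -/
theorem lintegral_rpow_mul_fwdDiff_le (hφm : ∀ i, Measurable (φ i))
    (hφ : ∀ i, ∀ r > 0, HasDerivAt (φ i) (φ (i + 1) r) r) (n : ℕ) {β : ℝ} (hβ : 0 < β) {t : ℝ}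
    (ht : 0 < t) :
    ∫⁻ s in Set.Ioo 0 1, ENNReal.ofReal (s ^ (-β - 1)) * ‖(fwdDiff s)^[n + 1] (φ 0) t‖ₑ ≤
      ENNReal.ofReal ((n + 1) ^ β / β) * ∫⁻ ρ in Set.Ioo 0 ((n : ℝ) + 1),
        ENNReal.ofReal (ρ ^ (n - β)) * ‖φ (n + 1) (t + ρ)‖ₑ := by
  set N : ℝ := (n : ℝ) + 1 with hN
  have hN0 : 0 < N := by positivity
  set K : ℝ → ℝ → ℝ≥0∞ := fun s ρ => ({w : ℝ × ℝ | w.2 < N * w.1}.indicator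
    (fun w => ENNReal.ofReal (w.1 ^ (-β - 1)) *
      (ENNReal.ofReal (w.2 ^ n) * ‖φ (n + 1) (t + w.2)‖ₑ)) (s, ρ)) with hK
  have hKm : Measurable (Function.uncurry K) := by
    have h2 := hφm (n + 1)
    exact Measurable.indicator (by fun_prop)
      (measurableSet_lt measurable_snd (measurable_fst.const_mul N))
  calc ∫⁻ s in Set.Ioo 0 1, ENNReal.ofReal (s ^ (-β - 1)) * ‖(fwdDiff s)^[n + 1] (φ 0) t‖ₑ
      ≤ ∫⁻ s in Set.Ioo 0 1, ∫⁻ ρ in Set.Ioo 0 N, K s ρ := by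
        refine setLIntegral_mono' measurableSet_Ioo fun s hs => ?_
        have h1 := enorm_fwdDiff_iterate_le hφm hφ n hs.1 ht
        have h2 : ∫⁻ r in Set.Ioo t (t + (n + 1) * s),
            ENNReal.ofReal ((r - t) ^ n) * ‖φ (n + 1) r‖ₑ =
            ∫⁻ ρ in Set.Ioo 0 (N * s), ENNReal.ofReal (ρ ^ n) * ‖φ (n + 1) (t + ρ)‖ₑ := by
          have hmp := measurePreserving_add_left volume t
          have := hmp.setLIntegral_comp_preimage_emb (measurableEmbedding_addLeft t)
            (fun r => ENNReal.ofReal ((r - t) ^ n) * ‖φ (n + 1) r‖ₑ) (Set.Ioo t (t + (n + 1) * s))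
          rw [← this]
          simp only [Set.preimage_const_add_Ioo, sub_self, add_sub_cancel_left, hN]
        calc ENNReal.ofReal (s ^ (-β - 1)) * ‖(fwdDiff s)^[n + 1] (φ 0) t‖ₑ
            ≤ ENNReal.ofReal (s ^ (-β - 1)) *
              ∫⁻ ρ in Set.Ioo 0 (N * s), ENNReal.ofReal (ρ ^ n) * ‖φ (n + 1) (t + ρ)‖ₑ := by
              gcongr
              exact h1.trans_eq h2
          _ = ∫⁻ ρ in Set.Ioo 0 (N * s), K s ρ := by
              rw [← lintegral_const_mul' _ _ ENNReal.ofReal_ne_top]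
              refine setLIntegral_congr_fun measurableSet_Ioo fun ρ hρ => ?_
              simp only [hK]
              rw [Set.indicator_of_mem (show (s, ρ) ∈ {w : ℝ × ℝ | w.2 < N * w.1} from hρ.2)]
          _ ≤ ∫⁻ ρ in Set.Ioo 0 N, K s ρ :=
              lintegral_mono_set (Set.Ioo_subset_Ioo le_rfl (by nlinarith [hs.2]))
    _ = ∫⁻ ρ in Set.Ioo 0 N, ∫⁻ s in Set.Ioo 0 1, K s ρ :=
        lintegral_lintegral_swap hKm.aemeasurable
    _ ≤ ∫⁻ ρ in Set.Ioo 0 N, ENNReal.ofReal (N ^ β / β) *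
          (ENNReal.ofReal (ρ ^ (n - β)) * ‖φ (n + 1) (t + ρ)‖ₑ) := by
        refine setLIntegral_mono' measurableSet_Ioo fun ρ hρ => ?_
        have hc : 0 < ρ / N := div_pos hρ.1 hN0
        calc ∫⁻ s in Set.Ioo 0 1, K s ρ
            ≤ ∫⁻ s in Set.Ioo 0 1, (Set.Ioi (ρ / N)).indicator (fun s =>
                ENNReal.ofReal (s ^ (-β - 1)) *
                  (ENNReal.ofReal (ρ ^ n) * ‖φ (n + 1) (t + ρ)‖ₑ)) s := by
              refine setLIntegral_mono' measurableSet_Ioo fun s hs => ?_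
              by_cases h : ρ < N * s
              · simp only [hK]
                rw [Set.indicator_of_mem (show (s, ρ) ∈ {w : ℝ × ℝ | w.2 < N * w.1} from h),
                  Set.indicator_of_mem (show s ∈ Set.Ioi (ρ / N) from
                    (div_lt_iff₀' hN0).2 h)]
              · simp only [hK]
                rw [Set.indicator_of_notMem (show (s, ρ) ∉ {w : ℝ × ℝ | w.2 < N * w.1} from h)]
                exact zero_le
          _ ≤ ∫⁻ s, (Set.Ioi (ρ / N)).indicator (fun s =>
                ENNReal.ofReal (s ^ (-β - 1)) *
                  (ENNReal.ofReal (ρ ^ n) * ‖φ (n + 1) (t + ρ)‖ₑ)) s :=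
              setLIntegral_le_lintegral _ _
          _ = ENNReal.ofReal (N ^ β / β) *
                (ENNReal.ofReal (ρ ^ (n - β)) * ‖φ (n + 1) (t + ρ)‖ₑ) := by
              rw [lintegral_indicator measurableSet_Ioi, lintegral_mul_const _ (by fun_prop),
                lintegral_Ioi_rpow hβ hc, ← mul_assoc, ← mul_assoc,
                ← ENNReal.ofReal_mul (by positivity), ← ENNReal.ofReal_mul (by positivity)]
              congr 2
              rw [Real.div_rpow hρ.1.le hN0.le, Real.rpow_sub hρ.1, Real.rpow_neg hρ.1.le,
                Real.rpow_neg hN0.le, Real.rpow_natCast]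
              have := Real.rpow_pos_of_pos hρ.1 β
              have := Real.rpow_pos_of_pos hN0 β
              field_simp
    _ = _ := lintegral_const_mul' _ _ ENNReal.ofReal_ne_top

end Differences

end GaussianBesov

end

noncomputable section

namespace GaussianBesov

variable {d : ℕ} {f : E d → ℝ}

/-! ### The path `r ↦ e^{-r} P_r f` -/

/-- The `i`-th derivative in `r` of `e^{-r} ∂_r^l P_r f(x)`. -/
def expPoissonD (i l : ℕ) (r : ℝ) (f : E d → ℝ) (x : E d) : ℝ :=
  Real.exp (-r) * (fwdDiff 1)^[i] (fun j : ℕ => poissonD j r f x) l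

theorem expPoissonD_zero (l : ℕ) (r : ℝ) (f : E d → ℝ) (x : E d) :
    expPoissonD 0 l r f x = Real.exp (-r) * poissonD l r f x := rfl

theorem hasDerivAt_fwdDiff_poissonD (hf : PolyIntegrable f) (i l : ℕ) {r : ℝ} (hr : 0 < r)
    (x : E d) :
    HasDerivAt (fun r => (fwdDiff 1)^[i] (fun j : ℕ => poissonD j r f x) l)
      ((fwdDiff 1)^[i] (fun j : ℕ => poissonD j r f x) (l + 1)) r := by
  induction i generalizing l with
  | zero => exact hasDerivAt_poissonD l hr hf.measurable hf.integrable x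
  | succ i ih =>
    simp only [Function.iterate_succ_apply', fwdDiff]
    exact (ih (l + 1)).sub (ih l)

/-- Because `(e^{-r} g)' = e^{-r}(g' - g)`, differentiating the product acts as a unit forward
difference in the order of the derivative of `P_r f`. -/
theorem hasDerivAt_expPoissonD (hf : PolyIntegrable f) (l : ℕ) (x : E d) (i : ℕ) (r : ℝ)
    (hr : 0 < r) :
    HasDerivAt (fun r => expPoissonD i l r f x) (expPoissonD (i + 1) l r f x) r := by
  have h1 : HasDerivAt (fun r : ℝ => Real.exp (-r)) (-Real.exp (-r)) r := by
    simpa using (hasDerivAt_neg r).exp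
  convert! h1.mul (hasDerivAt_fwdDiff_poissonD hf i l hr x) using 1
  rw [expPoissonD, Function.iterate_succ_apply', fwdDiff]
  ring

theorem measurable_expPoissonD_uncurry (hf : Measurable f) (i l : ℕ) :
    Measurable fun w : ℝ × E d => expPoissonD i l w.1 f w.2 := by
  have h : ∀ l, Measurable fun w : ℝ × E d =>
      (fwdDiff 1)^[i] (fun j : ℕ => poissonD j w.1 f w.2) l := by
    induction i with
    | zero => exact fun l => measurable_poissonD_uncurry l hf
    | succ i ih =>
      intro l
      simp only [Function.iterate_succ_apply', fwdDiff]
      exact (ih (l + 1)).sub (ih l)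
  exact (Real.measurable_exp.comp measurable_fst.neg).mul (h l)

theorem measurable_expPoissonD_time (hf : Measurable f) (l : ℕ) (x : E d) (i : ℕ) :
    Measurable fun r => expPoissonD i l r f x :=
  (measurable_expPoissonD_uncurry hf i l).comp (f := fun r => (r, x)) (by fun_prop)

theorem fwdDiff_iterate_eq_sum {M : Type*} [AddCommMonoid M] (s : M) (n : ℕ) (u : M → ℝ) (t : M) :
    (fwdDiff s)^[n] u t =
      ∑ k ∈ Finset.range (n + 1), ((-1 : ℝ) ^ (n - k) * n.choose k) * u (t + k • s) := by
  rw [fwdDiff_iter_eq_sum_shift]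
  refine Finset.sum_congr rfl fun k _ => ?_
  rw [zsmul_eq_mul]
  push_cast
  rfl

theorem enorm_fwdDiff_iterate_le_sum {M : Type*} [AddCommMonoid M] (s : M) (n : ℕ) (u : M → ℝ)
    (t : M) : ‖(fwdDiff s)^[n] u t‖ₑ ≤
      ∑ k ∈ Finset.range (n + 1), (n.choose k : ℝ≥0∞) * ‖u (t + k • s)‖ₑ := by
  rw [fwdDiff_iterate_eq_sum]
  refine (enorm_sum_le _ _).trans (Finset.sum_le_sum fun k _ => ?_)
  rw [enorm_mul, enorm_mul, enorm_pow]
  simp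

theorem enorm_expPoissonD_le {r : ℝ} (hr : 0 ≤ r) (i l : ℕ) (f : E d → ℝ) (x : E d) :
    ‖expPoissonD i l r f x‖ₑ ≤
      ∑ k ∈ Finset.range (i + 1), (i.choose k : ℝ≥0∞) * ‖poissonD (l + k) r f x‖ₑ := by
  rw [expPoissonD, enorm_mul]
  have h := enorm_fwdDiff_iterate_le_sum 1 i (fun j : ℕ => poissonD j r f x) l
  simp only [smul_eq_mul, mul_one] at h
  refine le_trans (mul_le_of_le_one_left zero_le ?_) h
  rw [Real.enorm_eq_ofReal (Real.exp_pos _).le, ← ENNReal.ofReal_one]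
  exact ENNReal.ofReal_le_ofReal (Real.exp_le_one_iff.2 (by linarith))

theorem luxNorm_expPoissonD_le {p : E d → ℝ} (hp : IsAdmissible p) (hf : Measurable f) {r : ℝ}
    (hr : 0 ≤ r) (i l : ℕ) :
    varLpNorm (gauss d) p (expPoissonD i l r f) ≤ ∑ k ∈ Finset.range (i + 1),
      (i.choose k : ℝ≥0∞) * varLpNorm (gauss d) p (poissonD (l + k) r f) := by
  refine (luxNorm_mono hp.ae_one_le (.of_forall fun x => enorm_expPoissonD_le hr i l f x)).trans ?_
  refine (luxNorm_sum_range_le hp.measurable hp.ae_one_le _ fun k =>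
    ((measurable_poissonD (l + k) r hf).enorm.const_mul _)).trans (Finset.sum_le_sum fun k _ => ?_)
  exact luxNorm_const_mul_le hp.ae_one_le _ (ENNReal.natCast_ne_top _)

/-! ### The path extended to time zero, and its finite differences. -/

/-- The path `r ↦ e^{-r} P_r f(x)`, with value `f(x)` at `r = 0`. -/
def besselPath (f : E d → ℝ) (x : E d) (r : ℝ) : ℝ :=
  Real.exp (-r) * (if r = 0 then f x else poissonD 0 r f x)

theorem besselPath_of_pos {r : ℝ} (hr : 0 < r) (f : E d → ℝ) (x : E d) :
    besselPath f x r = expPoissonD 0 0 r f x := by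
  rw [besselPath, if_neg hr.ne', expPoissonD_zero]

theorem besselPath_zero (f : E d → ℝ) (x : E d) : besselPath f x 0 = f x := by
  simp [besselPath]

theorem measurable_besselPath_uncurry (hf : Measurable f) :
    Measurable fun w : ℝ × E d => besselPath f w.2 w.1 := by
  refine (Real.measurable_exp.comp measurable_fst.neg).mul (Measurable.ite ?_
    (hf.comp measurable_snd) (measurable_poissonD_uncurry 0 hf))
  exact measurable_fst (measurableSet_singleton 0)

theorem measurable_fwdDiff_besselPath (hf : Measurable f) (n : ℕ) (t : ℝ) :
    Measurable fun w : ℝ × E d => (fwdDiff w.1)^[n] (besselPath f w.2) t := by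
  simp only [fwdDiff_iterate_eq_sum]
  refine Finset.measurable_sum _ fun k _ => Measurable.const_mul ?_ _
  exact (measurable_besselPath_uncurry hf).comp
    (f := fun w : ℝ × E d => (t + k • w.1, w.2)) (by fun_prop)

theorem fwdDiff_iterate_congr {u v : ℝ → ℝ} {s t : ℝ} (hs : 0 ≤ s) (h : ∀ r ≥ t, u r = v r) (n : ℕ) :
    (fwdDiff s)^[n] u t = (fwdDiff s)^[n] v t := by
  simp only [fwdDiff_iterate_eq_sum]
  refine Finset.sum_congr rfl fun k _ => ?_
  rw [h]
  have : 0 ≤ k • s := by positivity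
  linarith

theorem fwdDiff_besselPath_eq {s t : ℝ} (hs : 0 ≤ s) (ht : 0 < t) (n : ℕ) (f : E d → ℝ) (x : E d) :
    (fwdDiff s)^[n] (besselPath f x) t =
      (fwdDiff s)^[n] (fun r => expPoissonD 0 0 r f x) t :=
  fwdDiff_iterate_congr hs (fun _ hr => besselPath_of_pos (ht.trans_le hr) f x) n

/-- Only the node at the base point approaches `0` and needs the convergence hypothesis; all other
nodes tend to positive times, where the path is continuous. -/
theorem tendsto_fwdDiff_besselPath (hf : PolyIntegrable f) {u : ℕ → ℝ} (hu0 : ∀ i, 0 < u i)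
    (hu : Tendsto u atTop (𝓝 0)) {x : E d}
    (hx : Tendsto (fun i => poissonD 0 (u i) f x) atTop (𝓝 (f x))) {s : ℝ} (hs : 0 < s) (n : ℕ) :
    Tendsto (fun i => (fwdDiff s)^[n] (besselPath f x) (u i)) atTop
      (𝓝 ((fwdDiff s)^[n] (besselPath f x) 0)) := by
  simp only [fwdDiff_iterate_eq_sum]
  refine tendsto_finsetSum _ fun k _ => Tendsto.const_mul _ ?_
  rcases Nat.eq_zero_or_pos k with rfl | hk
  · simp only [zero_smul, add_zero, besselPath_zero]
    have h1 : Tendsto (fun i => Real.exp (-u i)) atTop (𝓝 1) := by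
      have := (Real.continuous_exp.tendsto _).comp hu.neg
      rwa [neg_zero, Real.exp_zero] at this
    have h2 := h1.mul hx
    rw [one_mul] at h2
    refine h2.congr fun i => ?_
    rw [besselPath_of_pos (hu0 i), expPoissonD_zero]
  · have hks : 0 < k • s := by positivity
    have hc := (hasDerivAt_expPoissonD hf 0 x 0 (k • s) hks).continuousAt.tendsto
    rw [zero_add, besselPath_of_pos hks]
    have h3 : Tendsto (fun i => u i + k • s) atTop (𝓝 (k • s)) := by
      simpa using hu.add_const (k • s)
    refine (hc.comp h3).congr fun i => ?_
    rw [besselPath_of_pos (add_pos (hu0 i) hks)]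
    rfl

theorem poissonD_poisson (hf : PolyIntegrable f) (l : ℕ) {r t : ℝ} (hr : 0 ≤ r) (ht : 0 < t)
    (x : E d) :
    poissonD l t (fun y => besselPath f y r) x = Real.exp t * expPoissonD 0 l (r + t) f x := by
  have he : Real.exp t * Real.exp (-(r + t)) = Real.exp (-r) := by rw [← Real.exp_add]; ring_nf
  rw [expPoissonD_zero, ← mul_assoc, he]
  rcases hr.eq_or_lt with rfl | hr
  · simp only [besselPath_zero, neg_zero, Real.exp_zero, one_mul, zero_add]
  · simp only [besselPath_of_pos hr, expPoissonD_zero]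
    rw [poissonD_const_mul]
    have := poissonD_poissonD hf.measurable hf.integrable l 0 ht hr x
    rw [add_zero, add_comm t] at this
    rw [← this]

theorem PolyIntegrable.besselPath (hf : PolyIntegrable f) {r : ℝ} (hr : 0 ≤ r) :
    Measurable (fun y => besselPath f y r) ∧ Integrable (fun y => besselPath f y r) (gauss d) := by
  refine ⟨(measurable_besselPath_uncurry hf.measurable).comp (f := fun y => (r, y)) (by fun_prop), ?_⟩
  rcases hr.eq_or_lt with rfl | hr
  · simpa only [besselPath_zero] using hf.integrable
  · simp only [besselPath_of_pos hr, expPoissonD_zero]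
    exact (hf.poissonD 0 hr).integrable.const_mul _

theorem poissonD_fwdDiff_besselPath (hf : PolyIntegrable f) (l n : ℕ) {r s t : ℝ} (hr : 0 ≤ r)
    (hs : 0 ≤ s) (ht : 0 < t) (x : E d) :
    poissonD l t (fun y => (fwdDiff s)^[n] (besselPath f y) r) x =
      Real.exp t * (fwdDiff s)^[n] (fun ρ => expPoissonD 0 l ρ f x) (r + t) := by
  simp only [fwdDiff_iterate_eq_sum]
  have hk : ∀ k : ℕ, 0 ≤ r + k • s := fun k => by positivity
  rw [poissonD_sum _ (fun k _ => ((hf.besselPath (hk k)).1.const_mul _))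
    (fun k _ => ((hf.besselPath (hk k)).2.const_mul _)) l ht, Finset.mul_sum]
  refine Finset.sum_congr rfl fun k _ => ?_
  rw [poissonD_const_mul, poissonD_poisson hf l (hk k) ht, add_right_comm]
  ring

/-- By the semigroup law `e^{-s} P_s` translates the path by `s`, so `e^{-s} P_s - I` acts on it as
the forward difference. -/
theorem besselDiff_iterate_eq (hf : PolyIntegrable f) {s : ℝ} (hs : 0 < s) (n : ℕ) (x : E d) :
    (besselDiff s)^[n] f x = (fwdDiff s)^[n] (besselPath f x) 0 := by
  induction n generalizing x with
  | zero => simp [besselPath_zero]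
  | succ n ih =>
    rw [Function.iterate_succ_apply', Function.iterate_succ_apply', besselDiff,
      poisson_eq_poissonD hs, funext ih, poissonD_fwdDiff_besselPath hf 0 n le_rfl hs.le hs,
      ← fwdDiff_besselPath_eq hs.le (by simpa using hs), ← mul_assoc, ← Real.exp_add, fwdDiff]
    simp

end GaussianBesov

end

noncomputable section

namespace GaussianBesov

variable {d : ℕ} {f : E d → ℝ} {p : E d → ℝ}

/-! ### The measure `dt / t` -/

theorem lintegral_haarPos {F : ℝ → ℝ≥0∞} (hF : Measurable F) :
    ∫⁻ t, F t ∂haarPos = ∫⁻ t in Set.Ioi 0, ENNReal.ofReal (1 / t) * F t :=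
  lintegral_withDensity_eq_lintegral_mul _ (by fun_prop) hF

theorem ae_haarPos_of_ae {P : ℝ → Prop} (h : ∀ᵐ t ∂(volume.restrict (Set.Ioi (0 : ℝ))), P t) :
    ∀ᵐ t ∂haarPos, P t :=
  (withDensity_absolutelyContinuous _ _).ae_le h

theorem ae_haarPos_pos : ∀ᵐ t ∂haarPos, 0 < t :=
  ae_haarPos_of_ae (ae_restrict_mem measurableSet_Ioi)

/-- The mass is `log 2`; the cruder value comes from `1/r ≥ 1/t` on an interval of length `t/2`. -/
theorem one_half_le_haarPos_Icc {t : ℝ} (ht : 0 < t) : 1 / 2 ≤ haarPos (Set.Icc (t / 2) t) := by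
  have hm : Measurable ((Set.Icc (t / 2) t).indicator (1 : ℝ → ℝ≥0∞)) :=
    measurable_one.indicator measurableSet_Icc
  rw [← lintegral_indicator_one measurableSet_Icc, lintegral_haarPos hm]
  calc (1 / 2 : ℝ≥0∞) = ∫⁻ _ in Set.Icc (t / 2) t, ENNReal.ofReal (1 / t) := by
        rw [setLIntegral_const, Real.volume_Icc, ← ENNReal.ofReal_mul (by positivity)]
        rw [show 1 / t * (t - t / 2) = 1 / 2 by field_simp; ring]
        rw [ENNReal.ofReal_div_of_pos (by norm_num)]
        simp
    _ = ∫⁻ r in Set.Ioi 0, (Set.Icc (t / 2) t).indicator (fun _ => ENNReal.ofReal (1 / t)) r := by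
        rw [lintegral_indicator measurableSet_Icc, Measure.restrict_restrict measurableSet_Icc]
        congr 2
        ext r
        simp only [Set.mem_Icc, Set.mem_inter_iff, Set.mem_Ioi]
        constructor
        · intro h; exact ⟨h, by linarith [h.1]⟩
        · exact fun h => h.1
    _ ≤ _ := by
        refine setLIntegral_mono' measurableSet_Ioi fun r hr => ?_
        by_cases h : r ∈ Set.Icc (t / 2) t
        · rw [Set.indicator_of_mem h, Set.indicator_of_mem h, Pi.one_apply, mul_one]
          exact ENNReal.ofReal_le_ofReal (one_div_le_one_div_of_le hr h.2)
        · rw [Set.indicator_of_notMem h]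
          exact zero_le

/-! ### Norms of the derivatives of the Poisson semigroup -/

/-- `‖∂_t^j P_t f‖_{p(·)}`. -/
def poissonNorm (p : E d → ℝ) (f : E d → ℝ) (j : ℕ) (t : ℝ) : ℝ≥0∞ :=
  varLpNorm (gauss d) p (poissonD j t f)

theorem exists_poissonNorm_le (hp : IsAdmissible p) (j : ℕ) : ∃ C : ℝ≥0, ∀ f : E d → ℝ,
    Measurable f → ∀ t > 0,
      poissonNorm p f j t ≤ C * ENNReal.ofReal ((t ^ j)⁻¹) * varLpNorm (gauss d) p f := by
  obtain ⟨C, hC⟩ := exists_luxNorm_poissonD_le hp j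
  exact ⟨C, fun f hf t ht => hC t ht f hf⟩

theorem exists_poissonNorm_add_le (hp : IsAdmissible p) (i : ℕ) : ∃ C : ℝ≥0, ∀ f : E d → ℝ,
    PolyIntegrable f → ∀ j, ∀ s > 0, ∀ t > 0, poissonNorm p f (i + j) (s + t) ≤
      C * ENNReal.ofReal ((s ^ i)⁻¹) * poissonNorm p f j t := by
  obtain ⟨C, hC⟩ := exists_luxNorm_poissonD_le hp i
  refine ⟨C, fun f hf j s hs t ht => ?_⟩
  have h : poissonD (i + j) (s + t) f = poissonD i s (poissonD j t f) :=
    funext fun x => (poissonD_poissonD hf.measurable hf.integrable i j hs ht x).symm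
  rw [poissonNorm, h]
  exact hC s hs _ (measurable_poissonD j t hf.measurable)

/-- The monotone majorant `sup_{s ≥ t} ‖∂_s^j P_s f‖_{p(·)}`. -/
def poissonNormSup (p : E d → ℝ) (f : E d → ℝ) (j : ℕ) (t : ℝ) : ℝ≥0∞ :=
  ⨆ s ∈ Set.Ici t, poissonNorm p f j s

theorem poissonNorm_le_sup (f : E d → ℝ) (j : ℕ) {s t : ℝ} (h : t ≤ s) :
    poissonNorm p f j s ≤ poissonNormSup p f j t :=
  le_iSup₂ (f := fun s (_ : s ∈ Set.Ici t) => poissonNorm p f j s) s h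

theorem antitone_poissonNormSup (f : E d → ℝ) (j : ℕ) : Antitone (poissonNormSup p f j) :=
  fun _ _ h => iSup₂_le fun _ hs => poissonNorm_le_sup f j (h.trans hs)

theorem measurable_poissonNormSup (f : E d → ℝ) (j : ℕ) : Measurable (poissonNormSup p f j) :=
  (antitone_poissonNormSup f j).measurable

/-- Uniform boundedness of `P_{s-t}` makes the norm almost decreasing in time. The supremum is a
comparable majorant which, being monotone, is measurable; the Hardy inequality is applied to it. -/
theorem exists_poissonNormSup_le (hp : IsAdmissible p) : ∃ C : ℝ≥0, 1 ≤ C ∧ ∀ f : E d → ℝ,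
    PolyIntegrable f → ∀ j, ∀ t > 0, poissonNormSup p f j t ≤ C * poissonNorm p f j t := by
  obtain ⟨C, hC⟩ := exists_poissonNorm_add_le hp 0
  refine ⟨C + 1, by simp, fun f hf j t ht => iSup₂_le fun s hs => ?_⟩
  push_cast
  rw [add_mul, one_mul]
  rcases (Set.mem_Ici.1 hs).eq_or_lt with rfl | h
  · exact le_add_self
  · refine le_add_right ?_
    have := hC f hf j (s - t) (by linarith) t ht
    simpa using this

/-! ### Pointwise in time consequences of a Besov bound. -/

/-- The hypotheses on `f` that are used: `f` is measurable with `‖f‖_{p(·)} ≤ M` and the modular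
of `t^{k-α} ‖∂_t^k P_t f‖_{p(·)} / M` is at most `1`. -/
structure BesovBound (α : ℝ) (p : E d → ℝ) (q : ℝ → ℝ) (f : E d → ℝ) (M : ℝ≥0∞) : Prop where
  measurable : Measurable f
  ne_zero : M ≠ 0
  ne_top : M ≠ ⊤
  norm_le : varLpNorm (gauss d) p f ≤ M
  modular_le : modular haarPos q (fun t => ENNReal.ofReal (t ^ ((nextInt α : ℝ) - α)) *
    poissonNorm p f (nextInt α) t / M) ≤ 1

variable {α : ℝ} {q : ℝ → ℝ} {M : ℝ≥0∞}

theorem BesovBound.polyIntegrable (hp : IsAdmissible p) (h : BesovBound α p q f M) :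
    PolyIntegrable f :=
  .of_luxNorm hp h.measurable (ne_top_of_le_ne_top h.ne_top h.norm_le)

theorem nextInt_sub_pos {a : ℝ} : 0 < (nextInt a : ℝ) - a := by
  have := Nat.lt_floor_add_one a
  rw [nextInt]; push_cast; linarith

theorem nextInt_sub_le {a : ℝ} (ha : 0 ≤ a) : (nextInt a : ℝ) - a ≤ 1 := by
  have := Nat.floor_le ha
  rw [nextInt]; push_cast; linarith

theorem rpow_le_two_mul_rpow {κ : ℝ} (hκ : 0 ≤ κ) (hκ1 : κ ≤ 1) {r t : ℝ} (ht : 0 < t) (hr : t / 2 ≤ r) :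
    t ^ κ ≤ 2 * r ^ κ := by
  have hr0 : 0 < r := by linarith
  calc t ^ κ ≤ (2 * r) ^ κ := Real.rpow_le_rpow ht.le (by linarith) hκ
    _ = 2 ^ κ * r ^ κ := Real.mul_rpow (by norm_num) hr0.le
    _ ≤ 2 * r ^ κ := by
        refine mul_le_mul_of_nonneg_right ?_ (Real.rpow_nonneg hr0.le _)
        calc (2 : ℝ) ^ κ ≤ 2 ^ (1 : ℝ) := Real.rpow_le_rpow_of_exponent_le (by norm_num) hκ1
          _ = 2 := Real.rpow_one 2

/-- The embedding from summability `q(·)` to summability `∞`. By almost monotonicity, a large value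
at `t` forces comparably large values on all of `[t/2, t]`. That interval has `dt/t`-mass at least
`1/2`, so a normalized value above `2` would push the modular above `1`. -/
theorem exists_rpow_mul_poissonNormSup_le (hp : IsAdmissible p) (hα : 0 ≤ α)
    (hq : ∀ᵐ t ∂haarPos, 1 ≤ q t) : ∃ C : ℝ≥0, 1 ≤ C ∧ ∀ f : E d → ℝ, ∀ M, BesovBound α p q f M →
      ∀ t > 0, ENNReal.ofReal (t ^ ((nextInt α : ℝ) - α)) *
        poissonNormSup p f (nextInt α) t ≤ C * M := by
  obtain ⟨A, hA1, hA⟩ := exists_poissonNormSup_le hp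
  refine ⟨4 * A, by
    calc (1 : ℝ≥0) ≤ A := hA1
      _ ≤ 4 * A := le_mul_of_one_le_left zero_le (by norm_num), fun f M h t ht => ?_⟩
  have hf := h.polyIntegrable hp
  set κ : ℝ := (nextInt α : ℝ) - α with hκ
  have hκ0 : 0 < κ := nextInt_sub_pos
  have hκ1 : κ ≤ 1 := nextInt_sub_le hα
  set k := nextInt α
  have hA0 : (A : ℝ≥0∞) ≠ 0 := by
    intro h0
    rw [ENNReal.coe_eq_zero] at h0
    rw [h0] at hA1
    exact absurd hA1 (by norm_num)
  set D : ℝ≥0∞ := 2 * A * M with hD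
  have hD0 : D ≠ 0 := mul_ne_zero (mul_ne_zero two_ne_zero hA0) h.ne_zero
  have hDT : D ≠ ⊤ := ENNReal.mul_ne_top (by finiteness) h.ne_top
  set y : ℝ≥0∞ := ENNReal.ofReal (t ^ κ) * poissonNormSup p f k t / D with hy
  have hle : ∀ r ∈ Set.Icc (t / 2) t, y ≤ ENNReal.ofReal (r ^ κ) * poissonNorm p f k r / M := by
    intro r hr
    have hr0 : 0 < r := by linarith [hr.1]
    rw [hy, ENNReal.div_le_iff hD0 hDT, hD, ← mul_assoc, mul_comm _ (2 * (A : ℝ≥0∞)), mul_assoc,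
      ENNReal.div_mul_cancel h.ne_zero h.ne_top]
    calc ENNReal.ofReal (t ^ κ) * poissonNormSup p f k t
        ≤ ENNReal.ofReal (2 * r ^ κ) * (A * poissonNorm p f k r) :=
          mul_le_mul' (ENNReal.ofReal_le_ofReal (rpow_le_two_mul_rpow hκ0.le hκ1 ht hr.1))
            ((antitone_poissonNormSup f k hr.2).trans (hA f hf k r hr0))
      _ = 2 * A * (ENNReal.ofReal (r ^ κ) * poissonNorm p f k r) := by
          rw [ENNReal.ofReal_mul (by norm_num), ENNReal.ofReal_ofNat]; ring
  have hy2 : y ≤ 2 := by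
    by_contra hcon
    rw [not_le] at hcon
    have h1 : y * haarPos (Set.Icc (t / 2) t) ≤ 1 := by
      refine le_trans ?_ h.modular_le
      rw [← setLIntegral_const, ← lintegral_indicator measurableSet_Icc]
      refine lintegral_mono_ae ?_
      filter_upwards [hq] with r hr
      by_cases hmem : r ∈ Set.Icc (t / 2) t
      · rw [Set.indicator_of_mem hmem]
        calc y = y ^ (1 : ℝ) := (ENNReal.rpow_one y).symm
          _ ≤ y ^ q r := ENNReal.rpow_le_rpow_of_exponent_le (by
              exact (by norm_num : (1 : ℝ≥0∞) ≤ 2).trans hcon.le) hr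
          _ ≤ _ := ENNReal.rpow_le_rpow (hle r hmem) (by linarith)
      · rw [Set.indicator_of_notMem hmem]
        exact zero_le
    have h2 : (1 : ℝ≥0∞) < y * (1 / 2) := by
      rw [one_div, ← div_eq_mul_inv, ENNReal.lt_div_iff_mul_lt (by simp) (by simp), one_mul]
      exact hcon
    exact absurd (h2.trans_le ((mul_le_mul_right (one_half_le_haarPos_Icc ht) y).trans h1))
      (lt_irrefl _)
  rw [hy, ENNReal.div_le_iff hD0 hDT] at hy2
  refine hy2.trans_eq ?_
  rw [hD]
  push_cast
  ring

/-- Integrate the derivative from `t` to `T`: the integral of `r^{-ε-1}` gives `t^{-ε}/ε`, and the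
term at `T` is controlled by the norm of `f`. Keeping `ε > 0` avoids logarithms. -/
theorem exists_poissonNorm_of_succ (hp : IsAdmissible p) {ε T : ℝ} (hε : 0 < ε) (hT : 0 < T)
    (j : ℕ) {C : ℝ≥0} (hC : ∀ f : E d → ℝ, ∀ M, BesovBound α p q f M → ∀ t, 0 < t → t ≤ T →
      poissonNorm p f (j + 1) t ≤ C * ENNReal.ofReal (t ^ (-ε - 1)) * M) :
    ∃ C : ℝ≥0, ∀ f : E d → ℝ, ∀ M, BesovBound α p q f M → ∀ t, 0 < t → t ≤ T →
      poissonNorm p f j t ≤ C * ENNReal.ofReal (t ^ (-ε)) * M := by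
  obtain ⟨A, hA⟩ := exists_poissonNorm_le hp j
  refine ⟨A * Real.toNNReal ((T ^ j)⁻¹ * T ^ ε) + C * Real.toNNReal (1 / ε),
    fun f M h t ht htT => ?_⟩
  have hf := h.polyIntegrable hp
  have hpt : ∀ x, ‖poissonD j t f x‖ₑ ≤ ‖poissonD j T f x‖ₑ +
      ∫⁻ r in Set.Ioo t T, ‖poissonD (j + 1) r f x‖ₑ := by
    intro x
    have h1 := enorm_sub_le_lintegral (φ := fun i r => poissonD i r f x)
      (fun i r hr => hasDerivAt_poissonD i hr hf.measurable hf.integrable x) j htT ht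
    calc ‖poissonD j t f x‖ₑ = ‖poissonD j T f x - (poissonD j T f x - poissonD j t f x)‖ₑ := by
          congr 1; ring
      _ ≤ _ := enorm_sub_le.trans (add_le_add_right h1 _)
  have hm : Measurable fun w : ℝ × E d => ‖poissonD (j + 1) w.1 f w.2‖ₑ :=
    (measurable_poissonD_uncurry (j + 1) hf.measurable).enorm
  have h2 : poissonNorm p f j t ≤ poissonNorm p f j T +
      ∫⁻ r in Set.Ioo t T, C * ENNReal.ofReal (r ^ (-ε - 1)) * M := by
    refine (luxNorm_mono hp.ae_one_le (.of_forall hpt)).trans ?_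
    refine (luxNorm_add_le hp.measurable hp.ae_one_le (measurable_poissonD j T hf.measurable).enorm
      (Measurable.lintegral_prod_left hm)).trans (add_le_add_right ?_ _)
    refine luxNorm_lintegral_le hp.measurable hp.ae_one_le _
      (F := fun r x => ‖poissonD (j + 1) r f x‖ₑ) hm (by fun_prop) ?_
    filter_upwards [ae_restrict_mem measurableSet_Ioo] with r hr
    exact hC f M h r (ht.trans hr.1) hr.2.le
  have h3 : ∫⁻ r in Set.Ioo t T, C * ENNReal.ofReal (r ^ (-ε - 1)) * M ≤
      C * ENNReal.ofReal (t ^ (-ε) / ε) * M := by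
    refine (lintegral_mono_set Set.Ioo_subset_Ioi_self).trans_eq ?_
    rw [lintegral_mul_const' _ _ h.ne_top, lintegral_const_mul' _ _ ENNReal.coe_ne_top,
      lintegral_Ioi_rpow hε ht]
  have h4 : poissonNorm p f j T ≤
      A * ENNReal.ofReal ((T ^ j)⁻¹ * T ^ ε) * ENNReal.ofReal (t ^ (-ε)) * M := by
    refine (hA f hf.measurable T hT).trans (mul_le_mul' ?_ h.norm_le)
    rw [mul_assoc]
    refine mul_le_mul_right ?_ _
    rw [← ENNReal.ofReal_mul (by positivity)]
    refine ENNReal.ofReal_le_ofReal ?_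
    rw [mul_assoc]
    refine le_mul_of_one_le_right (by positivity) ?_
    rw [Real.rpow_neg ht.le, ← div_eq_mul_inv, one_le_div (Real.rpow_pos_of_pos ht _)]
    exact Real.rpow_le_rpow ht.le htT hε.le
  refine h2.trans ((add_le_add h4 h3).trans_eq ?_)
  have e : t ^ (-ε) / ε = 1 / ε * t ^ (-ε) := by ring
  rw [e, ENNReal.ofReal_mul (p := 1 / ε) (by positivity)]
  push_cast
  simp only [ENNReal.ofReal]
  ring

theorem ofReal_rpow_le {a b t T : ℝ} (ht : 0 < t) (htT : t ≤ T) (hab : b ≤ a) :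
    ENNReal.ofReal (t ^ a) ≤ ENNReal.ofReal (T ^ (a - b)) * ENNReal.ofReal (t ^ b) := by
  have hT : 0 < T := ht.trans_le htT
  rw [← ENNReal.ofReal_mul (by positivity)]
  refine ENNReal.ofReal_le_ofReal ?_
  rw [show a = a - b + b by ring, Real.rpow_add ht, sub_add_cancel]
  exact mul_le_mul_of_nonneg_right (Real.rpow_le_rpow ht.le htT (by linarith))
    (Real.rpow_nonneg ht.le _)

theorem exists_poissonNorm_nextInt_le (hp : IsAdmissible p) (hα : 0 ≤ α)
    (hq : ∀ᵐ t ∂haarPos, 1 ≤ q t) :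
    ∃ C : ℝ≥0, ∀ f : E d → ℝ, ∀ M, BesovBound α p q f M → ∀ t, 0 < t →
      poissonNorm p f (nextInt α) t ≤
        C * ENNReal.ofReal (t ^ (-((nextInt α : ℝ) - α))) * M := by
  obtain ⟨C, _, hC⟩ := exists_rpow_mul_poissonNormSup_le (q := q) hp hα hq
  refine ⟨C, fun f M h t ht => ?_⟩
  have h1 := hC f M h t ht
  have h2 := (mul_le_mul_right (poissonNorm_le_sup (p := p) f (nextInt α) le_rfl) _).trans h1
  have hpos : 0 < t ^ ((nextInt α : ℝ) - α) := Real.rpow_pos_of_pos ht _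
  rw [mul_right_comm, Real.rpow_neg ht.le, ENNReal.ofReal_inv_of_pos hpos, ← div_eq_mul_inv,
    ENNReal.le_div_iff_mul_le (.inl (by simpa using hpos)) (.inl ENNReal.ofReal_ne_top), mul_comm]
  exact h2

/-- Descending induction on the order. At the top order the exponent `nextInt α - α` is at most `1`,
hence below the `1 + ε` required to start. -/
theorem exists_poissonNorm_lt_nextInt_le (hp : IsAdmissible p) (hα : 0 ≤ α)
    (hq : ∀ᵐ t ∂haarPos, 1 ≤ q t) {ε T : ℝ} (hε : 0 < ε) (hT : 0 < T) {j : ℕ}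
    (hj : j < nextInt α) :
    ∃ C : ℝ≥0, ∀ f : E d → ℝ, ∀ M, BesovBound α p q f M → ∀ t, 0 < t → t ≤ T →
      poissonNorm p f j t ≤ C * ENNReal.ofReal (t ^ (-ε)) * M := by
  obtain ⟨i, hi⟩ : ∃ i, j + (i + 1) = nextInt α := ⟨nextInt α - j - 1, by omega⟩
  induction i generalizing j with
  | zero =>
    obtain ⟨C, hC⟩ := exists_poissonNorm_nextInt_le (q := q) hp hα hq
    refine exists_poissonNorm_of_succ hp hε hT j
      (C := C * Real.toNNReal (T ^ (-((nextInt α : ℝ) - α) - (-ε - 1)))) fun f M h t ht htT => ?_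
    rw [show j + 1 = nextInt α by omega]
    refine (hC f M h t ht).trans (mul_le_mul_left ?_ M)
    push_cast
    rw [mul_assoc]
    exact mul_le_mul_right (ofReal_rpow_le ht htT (by linarith [nextInt_sub_le hα])) _
  | succ i ih =>
    obtain ⟨C, hC⟩ := ih (j := j + 1) (by omega) (by omega)
    refine exists_poissonNorm_of_succ hp hε hT j
      (C := C * Real.toNNReal (T ^ (-ε - (-ε - 1)))) fun f M h t ht htT => ?_
    refine (hC f M h t ht htT).trans (mul_le_mul_left ?_ M)
    push_cast
    rw [mul_assoc]
    exact mul_le_mul_right (ofReal_rpow_le ht htT (by linarith)) _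

end GaussianBesov

end

noncomputable section

namespace GaussianBesov

variable {d : ℕ} {f : E d → ℝ} {p : E d → ℝ} {α β : ℝ} {q : ℝ → ℝ}

/-! ### Norms of integrals of differences -/

theorem lintegral_Ioo_rpow_ne_top {a : ℝ} (ha : -1 < a) (T : ℝ) :
    ∫⁻ ρ in Set.Ioo 0 T, ENNReal.ofReal (ρ ^ a) ≠ ⊤ := by
  rcases le_or_gt T 0 with hT | hT
  · simp [Set.Ioo_eq_empty_of_le hT]
  · have h : IntegrableOn (fun ρ : ℝ => ρ ^ a) (Set.Ioo 0 T) :=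
      (intervalIntegral.integrableOn_Ioo_rpow_iff hT).2 ha
    have := h.2
    rw [hasFiniteIntegral_iff_ofReal] at this
    · exact this.ne
    · filter_upwards [ae_restrict_mem measurableSet_Ioo] with ρ hρ
      exact Real.rpow_nonneg hρ.1.le _

theorem luxNorm_lintegral_fwdDiff_le (hp : IsAdmissible p) (hf : PolyIntegrable f) (m l : ℕ)
    (hβ : 0 < β) {t : ℝ} (ht : 0 < t) {B : ℕ → ℝ → ℝ≥0∞} (hB : ∀ i, Measurable (B i))
    (h : ∀ i ≤ m + 1, ∀ ρ ∈ Set.Ioo 0 ((m : ℝ) + 1), poissonNorm p f (l + i) (t + ρ) ≤ B i ρ) :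
    luxNorm (gauss d) p (fun x => ∫⁻ s in Set.Ioo 0 1, ENNReal.ofReal (s ^ (-β - 1)) *
        ‖(fwdDiff s)^[m + 1] (fun r => expPoissonD 0 l r f x) t‖ₑ) ≤
      ENNReal.ofReal ((m + 1) ^ β / β) * ∑ i ∈ Finset.range (m + 2), ((m + 1).choose i : ℝ≥0∞) *
        ∫⁻ ρ in Set.Ioo 0 ((m : ℝ) + 1), ENNReal.ofReal (ρ ^ (m - β)) * B i ρ := by
  refine (luxNorm_mono hp.ae_one_le (.of_forall fun x => lintegral_rpow_mul_fwdDiff_le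
    (φ := fun i r => expPoissonD i l r f x)
    (fun i => measurable_expPoissonD_time hf.measurable l x i)
    (fun i r hr => hasDerivAt_expPoissonD hf l x i r hr) m hβ ht)).trans ?_
  refine (luxNorm_const_mul_le hp.ae_one_le _ ENNReal.ofReal_ne_top).trans
    (mul_le_mul_right ?_ _)
  have hm : Measurable fun w : ℝ × E d =>
      ENNReal.ofReal (w.1 ^ (m - β)) * ‖expPoissonD (m + 1) l (t + w.1) f w.2‖ₑ := by
    have := (measurable_expPoissonD_uncurry hf.measurable (m + 1) l).comp
      (f := fun w : ℝ × E d => (t + w.1, w.2)) (by fun_prop)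
    exact Measurable.mul (by fun_prop) this.enorm
  refine (luxNorm_lintegral_le hp.measurable hp.ae_one_le (volume.restrict (Set.Ioo 0 ((m : ℝ) + 1)))
    (F := fun ρ x => ENNReal.ofReal (ρ ^ (m - β)) * ‖expPoissonD (m + 1) l (t + ρ) f x‖ₑ) hm
    (B := fun ρ => ∑ i ∈ Finset.range (m + 2), ((m + 1).choose i : ℝ≥0∞) *
      (ENNReal.ofReal (ρ ^ (m - β)) * B i ρ)) ?_ ?_).trans_eq ?_
  · exact (Finset.measurable_sum _ fun i _ => by have := hB i; fun_prop).aemeasurable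
  · filter_upwards [ae_restrict_mem measurableSet_Ioo] with ρ hρ
    refine (luxNorm_const_mul_le hp.ae_one_le _ ENNReal.ofReal_ne_top).trans ?_
    have h1 := luxNorm_expPoissonD_le hp hf.measurable (add_pos ht hρ.1).le (m + 1) l
    refine (mul_le_mul_right h1 _).trans ?_
    rw [Finset.mul_sum]
    refine Finset.sum_le_sum fun i hi => ?_
    rw [mul_left_comm]
    gcongr
    exact h i (by simpa [Nat.lt_succ_iff] using hi) ρ hρ
  · rw [lintegral_finsetSum _ fun i _ => by have := hB i; fun_prop]
    refine Finset.sum_congr rfl fun i _ => ?_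
    rw [lintegral_const_mul' _ _ (ENNReal.natCast_ne_top _)]

/-- No smoothness is used for large steps: a difference of order `n` is a sum of translates with
total coefficient `2^n`, and `s^{-β-1}` is integrable at infinity. -/
theorem luxNorm_lintegral_fwdDiff_tail_le (hp : IsAdmissible p) (hβ : 0 < β) {u : ℝ → E d → ℝ}
    (hu : Measurable (Function.uncurry u)) {t : ℝ} {B : ℝ≥0∞}
    (h : ∀ r ≥ t, varLpNorm (gauss d) p (u r) ≤ B) (n : ℕ) :
    luxNorm (gauss d) p (fun x => ∫⁻ s in Set.Ioi (1 / 2), ENNReal.ofReal (s ^ (-β - 1)) *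
        ‖(fwdDiff s)^[n] (fun r => u r x) t‖ₑ) ≤
      ENNReal.ofReal ((1 / 2) ^ (-β) / β) * (2 ^ n * B) := by
  have hm : Measurable fun w : ℝ × E d =>
      ENNReal.ofReal (w.1 ^ (-β - 1)) * ‖(fwdDiff w.1)^[n] (fun r => u r w.2) t‖ₑ := by
    refine Measurable.mul (by fun_prop) (Measurable.enorm ?_)
    simp only [fwdDiff_iterate_eq_sum]
    refine Finset.measurable_sum _ fun k _ => Measurable.const_mul ?_ _
    exact hu.comp (f := fun w : ℝ × E d => (t + k • w.1, w.2)) (by fun_prop)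
  refine (luxNorm_lintegral_le hp.measurable hp.ae_one_le (volume.restrict (Set.Ioi (1 / 2)))
    (F := fun s x => ENNReal.ofReal (s ^ (-β - 1)) * ‖(fwdDiff s)^[n] (fun r => u r x) t‖ₑ) hm
    (B := fun s => ENNReal.ofReal (s ^ (-β - 1)) * (2 ^ n * B)) (by fun_prop) ?_).trans_eq ?_
  · filter_upwards [ae_restrict_mem measurableSet_Ioi] with s hs
    have hs0 : (0 : ℝ) < s := lt_trans (by norm_num) hs
    refine (luxNorm_const_mul_le hp.ae_one_le _ ENNReal.ofReal_ne_top).trans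
      (mul_le_mul_right ?_ _)
    refine (luxNorm_mono hp.ae_one_le (.of_forall fun x =>
      enorm_fwdDiff_iterate_le_sum s n (fun r => u r x) t)).trans ?_
    refine (luxNorm_sum_range_le hp.measurable hp.ae_one_le _ fun k =>
      (hu.of_uncurry_left.enorm.const_mul _)).trans ?_
    calc ∑ k ∈ Finset.range (n + 1), luxNorm (gauss d) p
          (fun x => (n.choose k : ℝ≥0∞) * ‖u (t + k • s) x‖ₑ)
        ≤ ∑ k ∈ Finset.range (n + 1), (n.choose k : ℝ≥0∞) * B := by
          refine Finset.sum_le_sum fun k _ => ?_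
          refine (luxNorm_const_mul_le hp.ae_one_le _ (ENNReal.natCast_ne_top _)).trans
            (mul_le_mul_right (h _ ?_) _)
          have : 0 ≤ k • s := by positivity
          linarith
      _ = 2 ^ n * B := by
          rw [← Finset.sum_mul, ← Nat.cast_sum, Nat.sum_range_choose]
          push_cast
          rfl
  · have hTop : Measurable fun s : ℝ => ENNReal.ofReal (s ^ (-β - 1)) := by fun_prop
    rw [lintegral_mul_const _ hTop, lintegral_Ioi_rpow hβ (by norm_num)]

theorem lintegral_Ioi_le_add (F : ℝ → ℝ≥0∞) : ∫⁻ s in Set.Ioi 0, F s ≤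
    (∫⁻ s in Set.Ioo 0 1, F s) + ∫⁻ s in Set.Ioi (1 / 2), F s := by
  refine (lintegral_mono_set ?_).trans (lintegral_union_le _ _ _)
  intro s hs
  rcases lt_or_ge s 1 with h | h
  · exact Or.inl ⟨hs, h⟩
  · exact Or.inr (lt_of_lt_of_le (by norm_num) h)

/-! ### The integral defining the fractional derivative -/

/-- `∫_0^∞ s^{-β-1} |(e^{-s} P_s - I)^n f(x)| ds`. -/
def besselAbs (β : ℝ) (f : E d → ℝ) (x : E d) : ℝ≥0∞ :=
  ∫⁻ s in Set.Ioi 0, ENNReal.ofReal (s ^ (-β - 1)) *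
    ‖(fwdDiff s)^[nextInt β] (besselPath f x) 0‖ₑ

theorem nextInt_mono (h : β ≤ α) : nextInt β ≤ nextInt α :=
  Nat.add_le_add_right (Nat.floor_mono h) 1

/-- The condition `e < nextInt β - β` is what makes `ρ^{nextInt β - 1 - β - e}` integrable at `0`.
Orders below `nextInt α` allow arbitrarily small `e`. Order `nextInt α` itself occurs only when
`nextInt α = nextInt β`, and then `β < α` gives the strict inequality. -/
theorem exists_poissonNorm_le_rpow (hp : IsAdmissible p) (hβ : 0 ≤ β) (hβα : β < α)
    (hq : ∀ᵐ t ∂haarPos, 1 ≤ q t) {T : ℝ} (hT : 0 < T) (i : ℕ) :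
    ∃ (C : ℝ≥0) (e : ℝ), 0 ≤ e ∧ e < nextInt β - β ∧ (i ≤ nextInt β → ∀ f : E d → ℝ, ∀ M,
      BesovBound α p q f M → ∀ t, 0 < t → t ≤ T →
        poissonNorm p f i t ≤ C * ENNReal.ofReal (t ^ (-e)) * M) := by
  have hb : 0 < (nextInt β : ℝ) - β := nextInt_sub_pos
  have hα : 0 ≤ α := hβ.trans hβα.le
  rcases lt_or_ge i (nextInt α) with hi | hi
  · obtain ⟨C, hC⟩ := exists_poissonNorm_lt_nextInt_le hp hα hq (half_pos hb) hT hi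
    exact ⟨C, _, (half_pos hb).le, half_lt_self hb, fun _ => hC⟩
  · rcases le_or_gt i (nextInt β) with hiβ | hiβ
    · have h1 : nextInt α = nextInt β := le_antisymm (hi.trans hiβ) (nextInt_mono hβα.le)
      have h2 : i = nextInt α := le_antisymm (hiβ.trans h1.ge) hi
      obtain ⟨C, hC⟩ := exists_poissonNorm_nextInt_le hp hα hq
      refine ⟨C, (nextInt α : ℝ) - α, nextInt_sub_pos.le, by rw [h1]; linarith, fun _ => ?_⟩
      rw [h2]
      exact fun f M h t ht _ => hC f M h t ht
    · exact ⟨0, 0, le_rfl, hb, fun h => absurd h (by omega)⟩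

/-- Yields both absolute convergence almost everywhere and the `L^{p(·)}` bound. The path need not
be smooth at `0`, so small steps are estimated at base points `u j → 0` with bounds independent of
`j`, followed by Fatou's lemma. -/
theorem exists_luxNorm_besselAbs_le (hp : IsAdmissible p) (hβ : 0 < β) (hβα : β < α)
    (hq : ∀ᵐ t ∂haarPos, 1 ≤ q t) : ∃ C : ℝ≥0, ∀ f : E d → ℝ, ∀ M, BesovBound α p q f M →
      luxNorm (gauss d) p (besselAbs β f) ≤ C * M := by
  set m := ⌊β⌋₊ with hm
  have hn : nextInt β = m + 1 := rfl
  choose C e he0 heb hC using fun i => exists_poissonNorm_le_rpow (q := q) hp hβ.le hβα hq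
    (T := (m : ℝ) + 2) (by positivity) i
  obtain ⟨A, hA⟩ := exists_poissonNorm_le hp 0
  have hfin : ∀ i, ∫⁻ ρ in Set.Ioo 0 ((m : ℝ) + 1), ENNReal.ofReal (ρ ^ ((m : ℝ) - β - e i)) ≠ ⊤ := by
    intro i
    refine lintegral_Ioo_rpow_ne_top ?_ _
    have := heb i
    rw [hn] at this
    push_cast at this
    linarith
  set K : ℝ≥0∞ := ENNReal.ofReal ((m + 1) ^ β / β) * ∑ i ∈ Finset.range (m + 2),
    ((m + 1).choose i : ℝ≥0∞) * (C i *
      ∫⁻ ρ in Set.Ioo 0 ((m : ℝ) + 1), ENNReal.ofReal (ρ ^ ((m : ℝ) - β - e i))) with hK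
  have hKT : K ≠ ⊤ := by
    refine ENNReal.mul_ne_top ENNReal.ofReal_ne_top (ENNReal.sum_ne_top.2 fun i _ => ?_)
    exact ENNReal.mul_ne_top (ENNReal.natCast_ne_top _)
      (ENNReal.mul_ne_top ENNReal.coe_ne_top (hfin i))
  set L : ℝ≥0∞ := ENNReal.ofReal ((1 / 2) ^ (-β) / β) * (2 ^ (m + 1) * (A + 1)) with hL
  have hLT : L ≠ ⊤ := by finiteness
  refine ⟨(K + L).toNNReal, fun f M h => ?_⟩
  rw [ENNReal.coe_toNNReal (by finiteness), add_mul]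
  have hf := h.polyIntegrable hp
  have hmd : ∀ t, Measurable fun w : ℝ × E d => ENNReal.ofReal (w.1 ^ (-β - 1)) *
      ‖(fwdDiff w.1)^[m + 1] (besselPath f w.2) t‖ₑ := fun t =>
    Measurable.mul (by fun_prop) (measurable_fwdDiff_besselPath hf.measurable (m + 1) t).enorm
  refine (luxNorm_mono hp.ae_one_le (.of_forall fun x => lintegral_Ioi_le_add _)).trans ?_
  refine (luxNorm_add_le hp.measurable hp.ae_one_le (Measurable.lintegral_prod_left (hmd 0))
    (Measurable.lintegral_prod_left (hmd 0))).trans (add_le_add ?_ ?_)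
  · obtain ⟨u, hu0, hu1, hut, hae⟩ := exists_seq_tendsto_poissonD hf.measurable hf.integrable
    refine luxNorm_le_of_tendsto hp.measurable hp.ae_one_le
      (F := fun j x => ∫⁻ s in Set.Ioo 0 1, ENNReal.ofReal (s ^ (-β - 1)) *
        ‖(fwdDiff s)^[m + 1] (besselPath f x) (u j)‖ₑ)
      (fun j => Measurable.lintegral_prod_left (hmd (u j))) ?_ fun j => ?_
    · filter_upwards [hae] with x hx
      refine le_trans ?_ (lintegral_liminf_le fun j =>
        (hmd (u j)).comp (f := fun s => (s, x)) (by fun_prop))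
      refine setLIntegral_mono' measurableSet_Ioo fun s hs => ?_
      refine le_of_eq (Tendsto.liminf_eq ?_).symm
      refine ENNReal.Tendsto.const_mul ?_ (.inr ENNReal.ofReal_ne_top)
      exact (tendsto_fwdDiff_besselPath hf hu0 hut hx hs.1 (m + 1)).enorm
    · have e1 : (fun x => ∫⁻ s in Set.Ioo 0 1, ENNReal.ofReal (s ^ (-β - 1)) *
          ‖(fwdDiff s)^[m + 1] (besselPath f x) (u j)‖ₑ) = fun x => ∫⁻ s in Set.Ioo 0 1,
          ENNReal.ofReal (s ^ (-β - 1)) *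
          ‖(fwdDiff s)^[m + 1] (fun r => expPoissonD 0 0 r f x) (u j)‖ₑ := by
        funext x
        refine setLIntegral_congr_fun measurableSet_Ioo fun s hs => ?_
        rw [fwdDiff_besselPath_eq hs.1.le (hu0 j)]
      rw [e1]
      refine (luxNorm_lintegral_fwdDiff_le hp hf m 0 hβ (hu0 j)
        (B := fun i ρ => C i * ENNReal.ofReal (ρ ^ (-e i)) * M) (by fun_prop) ?_).trans_eq ?_
      · intro i hi ρ hρ
        rw [zero_add]
        refine (hC i hi f M h (u j + ρ) (add_pos (hu0 j) hρ.1) (by linarith [hu1 j, hρ.2])).trans ?_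
        refine mul_le_mul_left (mul_le_mul_right (ENNReal.ofReal_le_ofReal ?_) _) M
        -- Dropping `u j` from the base of a nonpositive power makes the bound uniform in `j`.
        exact Real.rpow_le_rpow_of_nonpos hρ.1 (by linarith [hu0 j]) (by linarith [he0 i])
      · rw [hK, mul_assoc, Finset.sum_mul]
        congr 1
        refine Finset.sum_congr rfl fun i _ => ?_
        rw [mul_assoc, ← lintegral_const_mul' _ _ ENNReal.coe_ne_top,
          ← lintegral_mul_const' _ _ h.ne_top]
        congr 1
        refine setLIntegral_congr_fun measurableSet_Ioo fun ρ hρ => ?_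
        rw [sub_eq_add_neg _ (e i), Real.rpow_add hρ.1, ENNReal.ofReal_mul
          (Real.rpow_nonneg hρ.1.le _)]
        ring
  · have hu : Measurable (Function.uncurry fun r x => besselPath f x r) :=
      measurable_besselPath_uncurry hf.measurable
    refine (luxNorm_lintegral_fwdDiff_tail_le hp hβ hu (t := 0) (B := (A + 1) * M) ?_ (m + 1)).trans_eq
      (by rw [hL]; ring)
    intro r hr
    rcases (show (0 : ℝ) ≤ r from hr).eq_or_lt with rfl | hr0
    · have : (fun x => besselPath f x 0) = f := funext fun x => besselPath_zero f x
      rw [this]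
      refine h.norm_le.trans (le_mul_of_one_le_left zero_le ?_)
      exact le_add_self
    · have h1 := luxNorm_expPoissonD_le hp hf.measurable hr 0 0
      have e2 : (fun x => besselPath f x r) = expPoissonD 0 0 r f :=
        funext fun x => besselPath_of_pos hr0 f x
      rw [e2]
      refine h1.trans ?_
      have h2 := hA f hf.measurable r hr0
      simp only [poissonNorm, pow_zero, inv_one, ENNReal.ofReal_one, mul_one] at h2
      simp only [zero_add, Finset.range_one, Finset.sum_singleton, Nat.choose_self, Nat.cast_one,
        one_mul]
      refine h2.trans (mul_le_mul' le_self_add h.norm_le)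

end GaussianBesov

end

noncomputable section

namespace GaussianBesov

variable {d : ℕ} {f : E d → ℝ} {p : E d → ℝ} {α β : ℝ} {q : ℝ → ℝ}

/-! ### The constant `c_β` -/

theorem abs_exp_neg_sub_one_le {u : ℝ} (hu : 0 ≤ u) : |Real.exp (-u) - 1| ≤ min u 1 := by
  have h1 : Real.exp (-u) ≤ 1 := Real.exp_le_one_iff.2 (by linarith)
  rw [abs_of_nonpos (by linarith), neg_sub]
  refine le_min ?_ ?_
  · linarith [Real.add_one_le_exp (-u)]
  · linarith [Real.exp_pos (-u)]

theorem integrableOn_besselConst (hβ : 0 < β) :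
    IntegrableOn (fun u : ℝ => u ^ (-β - 1) * (Real.exp (-u) - 1) ^ nextInt β) (Set.Ioi 0) := by
  have hm : Measurable fun u : ℝ => u ^ (-β - 1) * (Real.exp (-u) - 1) ^ nextInt β := by fun_prop
  refine ⟨hm.aestronglyMeasurable, ?_⟩
  rw [hasFiniteIntegral_iff_enorm]
  refine (lintegral_Ioi_le_add _).trans_lt (ENNReal.add_lt_top.2 ⟨?_, ?_⟩)
  · have hb : -1 < (nextInt β : ℝ) - β - 1 := by linarith [nextInt_sub_pos (a := β)]
    refine lt_of_le_of_lt (setLIntegral_mono' measurableSet_Ioo fun u hu => ?_)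
      (lintegral_Ioo_rpow_ne_top hb 1).lt_top
    rw [Real.enorm_eq_ofReal_abs]
    refine ENNReal.ofReal_le_ofReal ?_
    rw [abs_mul, abs_pow, abs_of_nonneg (Real.rpow_nonneg hu.1.le _),
      show (nextInt β : ℝ) - β - 1 = (-β - 1) + nextInt β by ring, Real.rpow_add hu.1,
      Real.rpow_natCast]
    refine mul_le_mul_of_nonneg_left ?_ (Real.rpow_nonneg hu.1.le _)
    exact pow_le_pow_left₀ (abs_nonneg _) ((abs_exp_neg_sub_one_le hu.1.le).trans (min_le_left _ _)) _
  · refine lt_of_le_of_lt (b := ∫⁻ u in Set.Ioi (1 / 2 : ℝ), ENNReal.ofReal (u ^ (-β - 1)))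
      (setLIntegral_mono' measurableSet_Ioi fun u hu => ?_) ?_
    · have hu0 : (0 : ℝ) < u := lt_trans (by norm_num) hu
      rw [Real.enorm_eq_ofReal_abs]
      refine ENNReal.ofReal_le_ofReal ?_
      rw [abs_mul, abs_pow, abs_of_nonneg (Real.rpow_nonneg hu0.le _)]
      refine mul_le_of_le_one_right (Real.rpow_nonneg hu0.le _) ?_
      exact pow_le_one₀ (abs_nonneg _) ((abs_exp_neg_sub_one_le hu0.le).trans (min_le_right _ _))
    · rw [lintegral_Ioi_rpow hβ (by norm_num)]
      exact ENNReal.ofReal_lt_top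

/-- Up to the sign `(-1)^k` the integrand is strictly positive. -/
theorem besselConst_ne_zero (hβ : 0 < β) : besselConst β ≠ 0 := by
  have hsign : ∀ u : ℝ, u ^ (-β - 1) * (Real.exp (-u) - 1) ^ nextInt β =
      (-1) ^ nextInt β * (u ^ (-β - 1) * (1 - Real.exp (-u)) ^ nextInt β) := by
    intro u
    rw [show Real.exp (-u) - 1 = -1 * (1 - Real.exp (-u)) by ring, mul_pow]
    ring
  have hint := integrableOn_besselConst hβ
  have hpos : ∀ u : ℝ, 0 < u → 0 < u ^ (-β - 1) * (1 - Real.exp (-u)) ^ nextInt β := by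
    intro u hu
    have : Real.exp (-u) < 1 := by rw [Real.exp_lt_one_iff]; linarith
    exact mul_pos (Real.rpow_pos_of_pos hu _) (pow_pos (by linarith) _)
  have hint' : IntegrableOn (fun u : ℝ => u ^ (-β - 1) * (1 - Real.exp (-u)) ^ nextInt β)
      (Set.Ioi 0) := by
    refine (hint.const_mul ((-1) ^ nextInt β)).congr (.of_forall fun u => ?_)
    simp only [hsign u]
    rw [← mul_assoc, ← mul_pow]
    simp
  have h : 0 < ∫ u in Set.Ioi (0 : ℝ), u ^ (-β - 1) * (1 - Real.exp (-u)) ^ nextInt β := by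
    rw [setIntegral_pos_iff_support_of_nonneg_ae _ hint']
    · refine lt_of_lt_of_le (by simp : (0 : ℝ≥0∞) < volume (Set.Ioi (0 : ℝ)))
        (measure_mono fun u hu => ⟨(hpos u hu).ne', hu⟩)
    · filter_upwards [ae_restrict_mem measurableSet_Ioi] with u hu
      exact (hpos u hu).le
  rw [besselConst]
  simp only [hsign, integral_const_mul]
  exact mul_ne_zero (pow_ne_zero _ (by norm_num)) h.ne'

theorem integral_rpow_mul_exp_sub_one_pow (β : ℝ) {c : ℝ} (hc : 0 < c) :
    ∫ s in Set.Ioi (0 : ℝ), s ^ (-β - 1) * (Real.exp (-(s * c)) - 1) ^ nextInt β =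
      c ^ β * besselConst β := by
  have h := integral_comp_mul_left_Ioi
    (fun u : ℝ => u ^ (-β - 1) * (Real.exp (-u) - 1) ^ nextInt β) 0 hc
  rw [mul_zero] at h
  have e : ∫ s in Set.Ioi (0 : ℝ), s ^ (-β - 1) * (Real.exp (-(s * c)) - 1) ^ nextInt β =
      c ^ (β + 1) * ∫ s in Set.Ioi (0 : ℝ),
        (c * s) ^ (-β - 1) * (Real.exp (-(c * s)) - 1) ^ nextInt β := by
    rw [← integral_const_mul]
    refine setIntegral_congr_fun measurableSet_Ioi fun s hs => ?_
    have : c ^ (β + 1) * c ^ (-β - 1) = 1 := by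
      rw [← Real.rpow_add hc]; ring_nf; exact Real.rpow_zero c
    rw [Real.mul_rpow hc.le (le_of_lt hs), mul_comm s c]
    linear_combination (-(s ^ (-β - 1) * (Real.exp (-(c * s)) - 1) ^ nextInt β)) * this
  rw [e, h, besselConst, smul_eq_mul, Real.rpow_add hc, Real.rpow_one, ← mul_assoc,
    mul_assoc _ c, mul_inv_cancel₀ hc.ne', mul_one]

/-! ### The fractional derivative -/

theorem measurable_besselKernel (hf : Measurable f) (β : ℝ) : Measurable fun w : ℝ × E d =>
    w.1 ^ (-β - 1) * (fwdDiff w.1)^[nextInt β] (besselPath f w.2) 0 :=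
  Measurable.mul (by fun_prop) (measurable_fwdDiff_besselPath hf _ 0)

theorem besselIntegrand_eq (hf : PolyIntegrable f) (β : ℝ) (x : E d) {s : ℝ} (hs : 0 < s) :
    besselIntegrand β f x s = s ^ (-β - 1) * (fwdDiff s)^[nextInt β] (besselPath f x) 0 := by
  rw [besselIntegrand, besselDiff_iterate_eq hf hs]

theorem lintegral_enorm_besselKernel (β : ℝ) (f : E d → ℝ) (x : E d) :
    ∫⁻ s in Set.Ioi (0 : ℝ), ‖s ^ (-β - 1) * (fwdDiff s)^[nextInt β] (besselPath f x) 0‖ₑ =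
      besselAbs β f x := by
  refine setLIntegral_congr_fun measurableSet_Ioi fun s hs => ?_
  rw [enorm_mul, Real.enorm_eq_ofReal (Real.rpow_nonneg (le_of_lt hs) _)]

theorem measurable_besselAbs (hf : Measurable f) (β : ℝ) : Measurable (besselAbs β f) := by
  have hm : Measurable (Function.uncurry fun (s : ℝ) (x : E d) =>
      ‖s ^ (-β - 1) * (fwdDiff s)^[nextInt β] (besselPath f x) 0‖ₑ) :=
    (measurable_besselKernel hf β).enorm
  have h := Measurable.lintegral_prod_left (μ := volume.restrict (Set.Ioi (0 : ℝ))) hm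
  simpa only [lintegral_enorm_besselKernel] using h

theorem integrableOn_besselIntegrand (hf : PolyIntegrable f) {x : E d} (hx : besselAbs β f x ≠ ⊤) :
    IntegrableOn (besselIntegrand β f x) (Set.Ioi 0) := by
  refine IntegrableOn.congr_fun (f := fun s =>
    s ^ (-β - 1) * (fwdDiff s)^[nextInt β] (besselPath f x) 0) ⟨?_, ?_⟩
    (fun s hs => (besselIntegrand_eq hf β x hs).symm) measurableSet_Ioi
  · exact ((measurable_besselKernel hf.measurable β).comp (f := fun s => (s, x))
      (by fun_prop)).aestronglyMeasurable
  · rw [hasFiniteIntegral_iff_enorm, lintegral_enorm_besselKernel]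
    exact hx.lt_top

/-- The integral in the definition of the fractional derivative. -/
def besselInt (β : ℝ) (f : E d → ℝ) (x : E d) : ℝ :=
  ∫ s in Set.Ioi (0 : ℝ), s ^ (-β - 1) * (fwdDiff s)^[nextInt β] (besselPath f x) 0

theorem besselDeriv_eq (hf : PolyIntegrable f) (β : ℝ) (x : E d) :
    besselDeriv β f x = 1 / besselConst β * besselInt β f x := by
  rw [besselDeriv]
  congr 1
  exact setIntegral_congr_fun measurableSet_Ioi fun s hs => besselIntegrand_eq hf β x hs

theorem measurable_besselInt (hf : Measurable f) (β : ℝ) : Measurable (besselInt β f) :=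
  ((measurable_besselKernel hf β).stronglyMeasurable.integral_prod_left').measurable

theorem enorm_besselInt_le (β : ℝ) (f : E d → ℝ) (x : E d) :
    ‖besselInt β f x‖ₑ ≤ besselAbs β f x :=
  (enorm_integral_le_lintegral_enorm _).trans_eq (lintegral_enorm_besselKernel β f x)

theorem lintegral_besselAbs_mul_polyWeight_ne_top (hp : IsAdmissible p)
    (hN : luxNorm (gauss d) p (besselAbs β f) ≠ ⊤) (m : ℕ) :
    ∫⁻ x, besselAbs β f x * polyWeight m x ∂(gauss d) ≠ ⊤ := by
  obtain ⟨C, hC⟩ := exists_lintegral_mul_polyWeight_le hp m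
  exact ne_top_of_le_ne_top (ENNReal.mul_ne_top ENNReal.coe_ne_top hN) (hC _)

theorem lintegral_besselAbs_ne_top (hp : IsAdmissible p)
    (hN : luxNorm (gauss d) p (besselAbs β f) ≠ ⊤) : ∫⁻ x, besselAbs β f x ∂(gauss d) ≠ ⊤ := by
  simpa [polyWeight] using lintegral_besselAbs_mul_polyWeight_ne_top hp hN 0

theorem ae_besselAbs_ne_top (hp : IsAdmissible p) (hf : Measurable f)
    (hN : luxNorm (gauss d) p (besselAbs β f) ≠ ⊤) :
    ∀ᵐ x ∂(gauss d), besselAbs β f x ≠ ⊤ := by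
  filter_upwards [ae_lt_top (measurable_besselAbs hf β) (lintegral_besselAbs_ne_top hp hN)]
    with x hx using hx.ne

/-- For each `s` the coefficient is multiplied by `(e^{-sc} - 1)^k` with `c = 1 + √|ν|`; scaling in
`s` extracts `c^β`. Fubini holds because `besselAbs` is integrable against polynomial weights. -/
theorem hermiteCoeff_besselInt (hp : IsAdmissible p) (hf : PolyIntegrable f)
    (hN : luxNorm (gauss d) p (besselAbs β f) ≠ ⊤) (ν : Fin d → ℕ) :
    hermiteCoeff (besselInt β f) ν =
      (1 + Real.sqrt ((∑ i, ν i : ℕ) : ℝ)) ^ β * besselConst β * hermiteCoeff f ν := by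
  obtain ⟨C, m, hC⟩ := exists_enorm_hermiteH_le ν
  have hhm := measurable_hermiteH ν
  set c : ℝ := 1 + Real.sqrt ((∑ i, ν i : ℕ) : ℝ) with hc
  have hc0 : 0 < c := by positivity
  have hm : Measurable fun w : ℝ × E d =>
      w.1 ^ (-β - 1) * (fwdDiff w.1)^[nextInt β] (besselPath f w.2) 0 * hermiteH ν w.2 :=
    (measurable_besselKernel hf.measurable β).mul (hhm.comp measurable_snd)
  have hint : Integrable (Function.uncurry fun (x : E d) (s : ℝ) =>
      s ^ (-β - 1) * (fwdDiff s)^[nextInt β] (besselPath f x) 0 * hermiteH ν x)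
      ((gauss d).prod (volume.restrict (Set.Ioi 0))) := by
    have hm' := hm.comp (measurable_swap (α := E d) (β := ℝ))
    refine ⟨hm'.aestronglyMeasurable, ?_⟩
    rw [hasFiniteIntegral_iff_enorm]
    refine (lintegral_prod _ hm'.enorm.aemeasurable).trans_lt ?_
    refine lt_of_le_of_lt (b := ∫⁻ x, C * (besselAbs β f x * polyWeight m x) ∂(gauss d))
      (lintegral_mono fun x => ?_) ?_
    · simp only [Function.comp_apply, Prod.swap_prod_mk, enorm_mul (_ * _) (hermiteH ν x)]
      rw [lintegral_mul_const' _ _ enorm_ne_top, lintegral_enorm_besselKernel, mul_left_comm]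
      gcongr
      exact hC x
    · rw [lintegral_const_mul' _ _ ENNReal.coe_ne_top]
      exact ENNReal.mul_lt_top ENNReal.coe_lt_top
        (lintegral_besselAbs_mul_polyWeight_ne_top hp hN m).lt_top
  have h1 : hermiteCoeff (besselInt β f) ν = ∫ x, (∫ s in Set.Ioi (0 : ℝ),
      s ^ (-β - 1) * (fwdDiff s)^[nextInt β] (besselPath f x) 0 * hermiteH ν x) ∂(gauss d) := by
    unfold hermiteCoeff
    refine integral_congr_ae (.of_forall fun x => ?_)
    simp only [besselInt]
    rw [← integral_mul_const]
  have h2 : ∀ s > (0 : ℝ), ∫ x, s ^ (-β - 1) * (fwdDiff s)^[nextInt β] (besselPath f x) 0 *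
      hermiteH ν x ∂(gauss d) =
      s ^ (-β - 1) * (Real.exp (-(s * c)) - 1) ^ nextInt β * hermiteCoeff f ν := by
    intro s hs
    rw [mul_assoc, ← hermiteCoeff_besselDiff_iterate hf hs, hermiteCoeff, ← integral_const_mul]
    refine integral_congr_ae (.of_forall fun x => ?_)
    simp only [besselDiff_iterate_eq hf hs]
    ring
  rw [h1, integral_integral_swap hint, setIntegral_congr_fun measurableSet_Ioi h2,
    integral_mul_const, integral_rpow_mul_exp_sub_one_pow β hc0]

/-- The operator passes under the integral in `s` and moves the base point of the differences from
`0` to `t`, where the path is smooth. -/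
theorem enorm_poissonD_besselInt_le (hp : IsAdmissible p) (hf : PolyIntegrable f)
    (hN : luxNorm (gauss d) p (besselAbs β f) ≠ ⊤) (l : ℕ) {t : ℝ} (ht : 0 < t) (x : E d) :
    ‖poissonD l t (besselInt β f) x‖ₑ ≤ ENNReal.ofReal (Real.exp t) *
      ∫⁻ s in Set.Ioi 0, ENNReal.ofReal (s ^ (-β - 1)) *
        ‖(fwdDiff s)^[nextInt β] (fun ρ => expPoissonD 0 l ρ f x) t‖ₑ := by
  have hm := measurable_besselKernel hf.measurable β
  have hfin : ∫⁻ s in Set.Ioi (0 : ℝ), ∫⁻ y, ‖s ^ (-β - 1) *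
      (fwdDiff s)^[nextInt β] (besselPath f y) 0‖ₑ ∂(gauss d) ≠ ⊤ := by
    rw [lintegral_lintegral_swap hm.enorm.aemeasurable]
    simp only [lintegral_enorm_besselKernel]
    exact lintegral_besselAbs_ne_top hp hN
  have h := poissonD_integral (ν := volume.restrict (Set.Ioi (0 : ℝ)))
    (g := fun s y => s ^ (-β - 1) * (fwdDiff s)^[nextInt β] (besselPath f y) 0) hm hfin l ht x
  unfold besselInt
  rw [h, ← lintegral_const_mul' _ _ ENNReal.ofReal_ne_top]
  refine (enorm_integral_le_lintegral_enorm _).trans_eq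
    (setLIntegral_congr_fun measurableSet_Ioi fun s hs => ?_)
  rw [poissonD_const_mul, poissonD_fwdDiff_besselPath hf l _ le_rfl (le_of_lt hs) ht, zero_add,
    enorm_mul, enorm_mul, Real.enorm_eq_ofReal (Real.rpow_nonneg (le_of_lt hs) _),
    Real.enorm_eq_ofReal (Real.exp_pos t).le, mul_left_comm]

end GaussianBesov

end

noncomputable section

namespace GaussianBesov

/-! ### Dilations and the measure `dt / t` -/

theorem lintegral_Ioi_comp_mul {c : ℝ} (hc : 0 < c) (F : ℝ → ℝ≥0∞) :
    ∫⁻ r in Set.Ioi 0, F r = ∫⁻ s in Set.Ioi 0, ENNReal.ofReal c * F (c * s) := by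
  have himg : (fun s : ℝ => c * s) '' Set.Ioi 0 = Set.Ioi 0 := by
    rw [Set.image_mul_left_Ioi hc, mul_zero]
  have h := lintegral_image_eq_lintegral_abs_deriv_mul (f := fun s : ℝ => c * s) (f' := fun _ => c)
    (s := Set.Ioi 0) measurableSet_Ioi
    (fun s _ => by simpa using ((hasDerivAt_id s).const_mul c).hasDerivWithinAt)
    ((mul_right_injective₀ hc.ne').injOn) F
  rw [himg, abs_of_pos hc] at h
  exact h

theorem lintegral_haarPos_comp_mul {c : ℝ} (hc : 0 < c) {F : ℝ → ℝ≥0∞} (hF : Measurable F) :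
    ∫⁻ t, F (c * t) ∂haarPos = ∫⁻ t, F t ∂haarPos := by
  rw [lintegral_haarPos hF, lintegral_haarPos (by fun_prop),
    lintegral_Ioi_comp_mul hc fun t => ENNReal.ofReal (1 / t) * F t]
  refine setLIntegral_congr_fun measurableSet_Ioi fun t ht => ?_
  have ht : 0 < t := ht
  rw [← mul_assoc, ← ENNReal.ofReal_mul hc.le]
  congr 2
  field_simp

instance sigmaFinite_haarPos : SigmaFinite haarPos :=
  SigmaFinite.withDensity_of_ne_top (.of_forall fun _ => ENNReal.ofReal_ne_top)

/-- An integral inequality of Hardy type on `(0, ∞)` with the measure `dt / t`. -/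
theorem lintegral_haarPos_rpow_average_le {w η : ℝ → ℝ≥0∞} (hw : Measurable w) (hη : Measurable η)
    {r m : ℝ≥0∞} {q0 : ℝ} (hq0 : 1 ≤ q0) (hm0 : m ≠ 0)
    (hwm : ∫⁻ θ in Set.Ioi 0, w θ ≤ m) (hr : ∫⁻ t, η t ^ q0 ∂haarPos ≤ r) :
    ∫⁻ t, ((∫⁻ θ in Set.Ioi 0, w θ * η (t * (1 + θ))) / m) ^ q0 ∂haarPos ≤ r := by
  -- The normalized weight is a measure of mass at most `1`. Jensen takes the power inside, Tonelli
  -- exchanges the integrals, and `dt/t` does not see the dilation by `1 + θ`.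
  set ν : Measure ℝ := (volume.restrict (Set.Ioi 0)).withDensity fun θ => w θ / m with hν
  have hwm' : Measurable fun θ => w θ / m := hw.div_const m
  have hν1 : ν Set.univ ≤ 1 := by
    rw [hν, withDensity_apply _ MeasurableSet.univ, Measure.restrict_univ]
    simp only [div_eq_mul_inv]
    rw [lintegral_mul_const' _ _ (ENNReal.inv_ne_top.2 hm0), ← div_eq_mul_inv]
    exact ENNReal.div_le_of_le_mul (by rwa [one_mul])
  have hmη : ∀ t, Measurable fun θ => η (t * (1 + θ)) := fun t => by fun_prop
  have havg : ∀ t, (∫⁻ θ in Set.Ioi 0, w θ * η (t * (1 + θ))) / m =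
      ∫⁻ θ, η (t * (1 + θ)) ∂ν := by
    intro t
    rw [hν, lintegral_withDensity_eq_lintegral_mul _ hwm' (hmη t), div_eq_mul_inv,
      ← lintegral_mul_const' _ _ (ENNReal.inv_ne_top.2 hm0)]
    refine lintegral_congr fun θ => ?_
    simp only [Pi.mul_apply, div_eq_mul_inv]
    ring
  have hfinν : IsFiniteMeasure ν := ⟨hν1.trans_lt ENNReal.one_lt_top⟩
  have hjm : Measurable fun z : ℝ × ℝ => η (z.1 * (1 + z.2)) ^ q0 := by fun_prop
  calc ∫⁻ t, ((∫⁻ θ in Set.Ioi 0, w θ * η (t * (1 + θ))) / m) ^ q0 ∂haarPos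
      ≤ ∫⁻ t, ∫⁻ θ, η (t * (1 + θ)) ^ q0 ∂ν ∂haarPos := by
        refine lintegral_mono fun t => ?_
        rw [havg t]
        exact lintegral_rpow_le_of_mass_le_one ν hq0 hν1 (hmη t).aemeasurable
    _ = ∫⁻ θ, ∫⁻ t, η (t * (1 + θ)) ^ q0 ∂haarPos ∂ν := lintegral_lintegral_swap hjm.aemeasurable
    _ ≤ ∫⁻ _, r ∂ν := by
        refine lintegral_mono_ae ?_
        have hpos : ∀ᵐ θ ∂ν, 0 < θ :=
          (withDensity_absolutelyContinuous _ _).ae_le (ae_restrict_mem measurableSet_Ioi)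
        filter_upwards [hpos] with θ hθ
        have h1 := lintegral_haarPos_comp_mul (c := 1 + θ) (by linarith)
          (F := fun t => η t ^ q0) (by fun_prop)
        simp only [mul_comm (1 + θ)] at h1
        rw [h1]
        exact hr
    _ = r * ν Set.univ := lintegral_const _
    _ ≤ r := mul_le_of_le_one_right zero_le hν1

/-- If `y ≤ t`, then `y ^ q1 ≤ y ≤ t`. Otherwise `|log y| ≤ log(1/t)`, and the log-Hölder bound
limits the effect of changing the exponent to the factor `e^A`. The error `t` is integrable against
`dt/t` near `0`. -/
theorem rpow_le_exp_mul_rpow_add {y : ℝ≥0∞} (hy : y ≤ 1) {t q1 q2 A : ℝ} (ht : 0 < t)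
    (ht2 : t ≤ 1 / 2) (hq1 : 1 ≤ q1) (h : |q1 - q2| ≤ A / Real.log (1 / t)) :
    y ^ q1 ≤ ENNReal.ofReal (Real.exp A) * y ^ q2 + ENNReal.ofReal t := by
  rcases le_or_gt y (ENNReal.ofReal t) with hyt | hyt
  · refine le_add_left ((ENNReal.rpow_le_rpow_of_exponent_ge hy hq1).trans ?_)
    rwa [ENNReal.rpow_one]
  · refine le_add_right ?_
    have hyT : y ≠ ⊤ := ne_top_of_le_ne_top ENNReal.one_ne_top hy
    obtain ⟨c, hc0, rfl⟩ : ∃ c : ℝ, 0 ≤ c ∧ y = ENNReal.ofReal c :=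
      ⟨y.toReal, ENNReal.toReal_nonneg, (ENNReal.ofReal_toReal hyT).symm⟩
    have htc : t < c := (ENNReal.ofReal_lt_ofReal_iff_of_nonneg ht.le).1 hyt
    have hc1 : c ≤ 1 := by simpa using hy
    have hc : 0 < c := ht.trans htc
    rw [ENNReal.ofReal_rpow_of_pos hc, ENNReal.ofReal_rpow_of_pos hc,
      ← ENNReal.ofReal_mul (Real.exp_pos A).le]
    refine ENNReal.ofReal_le_ofReal ?_
    rw [Real.rpow_def_of_pos hc, Real.rpow_def_of_pos hc, ← Real.exp_add]
    refine Real.exp_le_exp.2 ?_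
    have hlog : 0 < Real.log (1 / t) := Real.log_pos (by rw [lt_div_iff₀ ht]; linarith)
    have hlc : Real.log c ≤ 0 := Real.log_nonpos hc.le hc1
    have hlt : -Real.log c ≤ Real.log (1 / t) := by
      rw [one_div, Real.log_inv]
      linarith [Real.log_le_log ht htc.le]
    rw [le_div_iff₀ hlog] at h
    have h1 : Real.log c * (q1 - q2) ≤ -Real.log c * |q1 - q2| := by
      nlinarith [neg_abs_le (q1 - q2)]
    have h2 : -Real.log c * |q1 - q2| ≤ Real.log (1 / t) * |q1 - q2| :=
      mul_le_mul_of_nonneg_right hlt (abs_nonneg _)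
    nlinarith

theorem lintegral_hardyWeight_ne_top {a b : ℝ} (ha : 0 < a) (hb : 0 < b) :
    ∫⁻ θ in Set.Ioi (0 : ℝ), ENNReal.ofReal (θ ^ (b - 1) * (1 + θ) ^ (-(a + b))) ≠ ⊤ := by
  refine ne_top_of_le_ne_top (ENNReal.add_ne_top.2
    ⟨lintegral_Ioo_rpow_ne_top (a := b - 1) (by linarith) 1, ?_⟩)
    ((lintegral_Ioi_le_add _).trans (add_le_add (setLIntegral_mono' measurableSet_Ioo fun θ hθ => ?_)
      (setLIntegral_mono' (g := fun θ => ENNReal.ofReal (θ ^ (-a - 1))) measurableSet_Ioi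
        fun θ hθ => ?_)))
  · rw [lintegral_Ioi_rpow ha (by norm_num)]
    exact ENNReal.ofReal_ne_top
  · refine ENNReal.ofReal_le_ofReal (mul_le_of_le_one_right (Real.rpow_nonneg hθ.1.le _) ?_)
    exact Real.rpow_le_one_of_one_le_of_nonpos (by linarith [hθ.1]) (by linarith)
  · have hθ0 : (0 : ℝ) < θ := lt_trans (by norm_num) hθ
    refine ENNReal.ofReal_le_ofReal ?_
    rw [show -a - 1 = (b - 1) + -(a + b) by ring, Real.rpow_add hθ0]
    exact mul_le_mul_of_nonneg_left
      (Real.rpow_le_rpow_of_nonpos hθ0 (by linarith) (by linarith)) (Real.rpow_nonneg hθ0.le _)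

/-! ### The exponent `q` -/

variable {q : ℝ → ℝ}

theorem ExponentZeroInfty.ae_one_le (hq : ExponentZeroInfty q) :
    ∀ᵐ t ∂(volume.restrict (Set.Ioi (0 : ℝ))), 1 ≤ q t := by
  filter_upwards [ae_essInf_le (f := fun t => (q t : EReal))
    (μ := volume.restrict (Set.Ioi (0 : ℝ)))] with t ht
  have := hq.one_le_inf.trans ht
  exact_mod_cast this

/-- The bound `q ≥ 1` holds only almost everywhere, but a limit below `1` would violate it on a
whole interval. -/
theorem ExponentZeroInfty.one_le_of_tendsto (hq : ExponentZeroInfty q) {q0 : ℝ}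
    (h : Tendsto q (𝓝[>] 0) (𝓝 q0)) : 1 ≤ q0 := by
  by_contra hcon
  rw [not_le] at hcon
  have h1 : ∀ᶠ t in 𝓝[>] (0 : ℝ), q t < 1 := h.eventually (gt_mem_nhds hcon)
  obtain ⟨u, hu, hsub⟩ := mem_nhdsGT_iff_exists_Ioo_subset.1 h1
  have hu : 0 < u := hu
  have h2 := (ae_restrict_iff' measurableSet_Ioi).1 hq.ae_one_le
  have h3 : ∀ᵐ t : ℝ, t ∉ Set.Ioo 0 u := by
    filter_upwards [h2] with t ht hmem
    exact absurd (ht hmem.1) (not_le.2 (hsub hmem))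
  have h4 : volume (Set.Ioo 0 u) = 0 := by
    rw [measure_eq_zero_iff_ae_notMem]; exact h3
  rw [Real.volume_Ioo, sub_zero] at h4
  simp at h4
  linarith

end GaussianBesov

end

noncomputable section

namespace GaussianBesov

variable {d : ℕ} {f : E d → ℝ} {p : E d → ℝ} {α β : ℝ} {q : ℝ → ℝ}

/-! ### Bounds for small times -/

/-- `r^{k-α} sup_{s ≥ r/2} ‖∂_s^k P_s f‖_{p(·)}`. -/
def besovProfile (α : ℝ) (p : E d → ℝ) (f : E d → ℝ) (r : ℝ) : ℝ≥0∞ :=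
  ENNReal.ofReal (r ^ ((nextInt α : ℝ) - α)) * poissonNormSup p f (nextInt α) (r / 2)

theorem measurable_besovProfile (α : ℝ) (p : E d → ℝ) (f : E d → ℝ) :
    Measurable (besovProfile α p f) := by
  have := (measurable_poissonNormSup (p := p) f (nextInt α)).comp
    (f := fun r : ℝ => r / 2) (by fun_prop)
  exact Measurable.mul (by fun_prop) this

/-- Half of the time `r` pays for the derivatives beyond order `nextInt α`, which is why the profile
looks back to `r/2`. On a bounded range all orders up to `e` may be given the same, worst power. -/
theorem exists_poissonNorm_le_besovProfile (hp : IsAdmissible p) {j : ℕ} (hj : nextInt α ≤ j)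
    {T e : ℝ} (hje : j ≤ e) : ∃ C : ℝ≥0, ∀ f : E d → ℝ, PolyIntegrable f →
      ∀ r, 0 < r → r ≤ T → poissonNorm p f j r ≤
        C * (ENNReal.ofReal (r ^ (-(e - α))) * besovProfile α p f r) := by
  obtain ⟨i, rfl⟩ : ∃ i, j = i + nextInt α := ⟨j - nextInt α, by omega⟩
  obtain ⟨C, hC⟩ := exists_poissonNorm_add_le hp i
  push_cast at hje
  refine ⟨C * Real.toNNReal (2 ^ i * T ^ (-(i : ℝ) - (-(e - α) + (nextInt α - α)))),
    fun f hf r hr hrT => ?_⟩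
  have h1 := hC f hf (nextInt α) (r / 2) (half_pos hr) (r / 2) (half_pos hr)
  rw [add_halves] at h1
  refine h1.trans ?_
  have h2 : ENNReal.ofReal (((r / 2) ^ i)⁻¹) ≤
      ENNReal.ofReal (2 ^ i * T ^ (-(i : ℝ) - (-(e - α) + (nextInt α - α)))) *
      (ENNReal.ofReal (r ^ (-(e - α))) * ENNReal.ofReal (r ^ ((nextInt α : ℝ) - α))) := by
    have h3 := ofReal_rpow_le (a := -(i : ℝ)) (b := -(e - α) + (nextInt α - α)) hr hrT
      (by linarith)
    rw [← ENNReal.ofReal_mul (Real.rpow_nonneg hr.le _), ← Real.rpow_add hr,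
      ENNReal.ofReal_mul (by positivity), mul_assoc]
    refine le_trans (le_of_eq ?_) (mul_le_mul_right h3 _)
    rw [← ENNReal.ofReal_mul (by positivity), Real.rpow_neg hr.le, Real.rpow_natCast, div_pow,
      inv_div, div_eq_mul_inv]
  calc (C : ℝ≥0∞) * ENNReal.ofReal (((r / 2) ^ i)⁻¹) * poissonNorm p f (nextInt α) (r / 2)
      ≤ C * (ENNReal.ofReal (2 ^ i * T ^ (-(i : ℝ) - (-(e - α) + (nextInt α - α)))) *
        (ENNReal.ofReal (r ^ (-(e - α))) * ENNReal.ofReal (r ^ ((nextInt α : ℝ) - α)))) *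
        poissonNormSup p f (nextInt α) (r / 2) :=
        mul_le_mul' (mul_le_mul_right h2 _) (poissonNorm_le_sup f _ le_rfl)
    _ = _ := by
        rw [besovProfile]
        push_cast
        simp only [ENNReal.ofReal]
        ring

theorem exists_poissonNorm_add_le_besovProfile (hp : IsAdmissible p) (hα : 0 ≤ α)
    (hq : ∀ᵐ t ∂haarPos, 1 ≤ q t) {ε T e : ℝ} (hε : 0 < ε) (hT : 0 < T) {j : ℕ} (hje : j ≤ e) :
    ∃ C : ℝ≥0, ∀ f : E d → ℝ, ∀ M, BesovBound α p q f M → ∀ t ρ, 0 < t → 0 < ρ → t + ρ ≤ T →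
      poissonNorm p f j (t + ρ) ≤ C * (ENNReal.ofReal (t ^ (-ε)) * M +
        ENNReal.ofReal ((t + ρ) ^ (-(e - α))) * besovProfile α p f (t + ρ)) := by
  rcases lt_or_ge j (nextInt α) with hj | hj
  · obtain ⟨C, hC⟩ := exists_poissonNorm_lt_nextInt_le (q := q) hp hα hq hε hT hj
    refine ⟨C, fun f M h t ρ ht hρ htρ => (hC f M h (t + ρ) (by positivity) htρ).trans ?_⟩
    rw [mul_assoc]
    refine mul_le_mul_right (le_add_right (mul_le_mul_left (ENNReal.ofReal_le_ofReal ?_) _)) _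
    exact Real.rpow_le_rpow_of_nonpos ht (by linarith) (by linarith)
  · obtain ⟨C, hC⟩ := exists_poissonNorm_le_besovProfile hp hj (T := T) hje
    exact ⟨C, fun f M h t ρ ht hρ htρ => (hC f (h.polyIntegrable hp) (t + ρ) (by positivity)
      htρ).trans (mul_le_mul_right le_add_self _)⟩

theorem nextInt_sub_le_nextInt (hβ : 0 ≤ β) : nextInt (α - β) ≤ nextInt α :=
  nextInt_mono (by linarith)

/-- If the order for `α - β` is below the order for `α`, the derivative grows at most like an
arbitrarily small negative power. If the orders agree, the weight gains `t^β` over the weight for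
`α`. -/
theorem exists_rpow_mul_poissonNormSup_sub_le (hp : IsAdmissible p) (hβ : 0 < β) (hβα : β < α)
    (hq : ∀ᵐ t ∂haarPos, 1 ≤ q t) {δ : ℝ} (hδ : δ < nextInt (α - β) - (α - β)) (hδβ : δ ≤ β) :
    ∃ C : ℝ≥0, ∀ f : E d → ℝ, ∀ M, BesovBound α p q f M → ∀ t, 0 < t → t ≤ 1 →
      ENNReal.ofReal (t ^ ((nextInt (α - β) : ℝ) - (α - β))) *
        poissonNormSup p f (nextInt (α - β)) t ≤ C * (ENNReal.ofReal (t ^ δ) * M) := by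
  have hα : 0 ≤ α := hβ.le.trans hβα.le
  set a : ℝ := (nextInt (α - β) : ℝ) - (α - β) with ha
  rcases (nextInt_sub_le_nextInt (α := α) hβ.le).lt_or_eq with hl | hl
  · obtain ⟨C, hC⟩ := exists_poissonNorm_lt_nextInt_le (q := q) hp hα hq (sub_pos.2 hδ) one_pos hl
    obtain ⟨A, _, hA⟩ := exists_poissonNormSup_le hp
    refine ⟨A * C, fun f M h t ht ht1 => ?_⟩
    have h1 := (hA f (h.polyIntegrable hp) (nextInt (α - β)) t ht).trans
      (mul_le_mul_right (hC f M h t ht ht1) _)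
    refine (mul_le_mul_right h1 _).trans_eq ?_
    have e : t ^ δ = t ^ a * t ^ (-(a - δ)) := by rw [← Real.rpow_add ht]; ring_nf
    rw [e, ENNReal.ofReal_mul (Real.rpow_nonneg ht.le _)]
    push_cast
    ring
  · obtain ⟨C, _, hC⟩ := exists_rpow_mul_poissonNormSup_le (q := q) hp hα hq
    refine ⟨C, fun f M h t ht ht1 => ?_⟩
    have h1 := hC f M h t ht
    have e : a = β + ((nextInt α : ℝ) - α) := by rw [ha, hl]; ring
    rw [e, Real.rpow_add ht, ENNReal.ofReal_mul (Real.rpow_nonneg ht.le _), mul_assoc, hl]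
    calc _ ≤ ENNReal.ofReal (t ^ β) * (C * M) := mul_le_mul_right h1 _
      _ ≤ ENNReal.ofReal (t ^ δ) * (C * M) := mul_le_mul_left (ENNReal.ofReal_le_ofReal
          (Real.rpow_le_rpow_of_exponent_ge ht ht1 hδβ)) _
      _ = _ := by ring

/-- The integral that bounds the high order part of the fractional derivative. -/
def hardyIntegral (α β : ℝ) (p : E d → ℝ) (f : E d → ℝ) (t : ℝ) : ℝ≥0∞ :=
  ∫⁻ ρ in Set.Ioo 0 (nextInt β : ℝ), ENNReal.ofReal (ρ ^ ((nextInt β : ℝ) - β - 1)) *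
    (ENNReal.ofReal ((t + ρ) ^ (-((nextInt (α - β) : ℝ) + nextInt β - α))) *
      besovProfile α p f (t + ρ))

theorem exists_poissonNorm_besselInt_le (hp : IsAdmissible p) (hβ : 0 < β) (hβα : β < α)
    (hq : ∀ᵐ t ∂haarPos, 1 ≤ q t) {δ : ℝ} (hδ : δ < nextInt (α - β) - (α - β)) (hδβ : δ ≤ β) :
    ∃ C : ℝ≥0, ∀ f : E d → ℝ, ∀ M, BesovBound α p q f M → ∀ t, 0 < t → t ≤ 1 →
      ENNReal.ofReal (t ^ ((nextInt (α - β) : ℝ) - (α - β))) *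
        poissonNorm p (besselInt β f) (nextInt (α - β)) t ≤
      C * (ENNReal.ofReal (t ^ δ) * M +
        ENNReal.ofReal (t ^ ((nextInt (α - β) : ℝ) - (α - β))) * hardyIntegral α β p f t) := by
  set a : ℝ := (nextInt (α - β) : ℝ) - (α - β) with ha
  set l := nextInt (α - β) with hl
  set m := ⌊β⌋₊ with hm
  have hn : nextInt β = m + 1 := rfl
  have hα : 0 ≤ α := hβ.le.trans hβα.le
  obtain ⟨N, hN⟩ := exists_luxNorm_besselAbs_le (q := q) hp hβ hβα hq
  obtain ⟨A, hA⟩ := exists_rpow_mul_poissonNormSup_sub_le (q := q) hp hβ hβα hq hδ hδβ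
  -- The restriction on `i` sits inside the existential, with a dummy constant outside the range, so
  -- that the constants form one function on `ℕ`.
  have hex : ∀ i, ∃ C : ℝ≥0, i ≤ m + 1 → ∀ f : E d → ℝ, ∀ M, BesovBound α p q f M → ∀ t ρ : ℝ,
      0 < t → 0 < ρ → t + ρ ≤ (m : ℝ) + 2 →
      poissonNorm p f (l + i) (t + ρ) ≤ C * (ENNReal.ofReal (t ^ (-(a - δ))) * M +
        ENNReal.ofReal ((t + ρ) ^ (-((l : ℝ) + nextInt β - α))) * besovProfile α p f (t + ρ)) := by
    intro i
    by_cases hi : i ≤ m + 1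
    · obtain ⟨C, hC⟩ := exists_poissonNorm_add_le_besovProfile (q := q) hp hα hq (ε := a - δ)
        (T := (m : ℝ) + 2) (e := (l : ℝ) + nextInt β) (j := l + i) (sub_pos.2 hδ) (by positivity) (by
          rw [hn]
          exact_mod_cast Nat.add_le_add_left hi l)
      exact ⟨C, fun _ => hC⟩
    · exact ⟨0, fun h => absurd h hi⟩
  choose C hC using hex
  set I : ℝ≥0∞ := ∫⁻ ρ in Set.Ioo 0 ((m : ℝ) + 1), ENNReal.ofReal (ρ ^ ((m : ℝ) - β)) with hI
  have hIT : I ≠ ⊤ := by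
    refine lintegral_Ioo_rpow_ne_top ?_ _
    have := nextInt_sub_pos (a := β)
    rw [hn] at this
    push_cast at this
    linarith
  set K1 : ℝ≥0∞ := ENNReal.ofReal ((m + 1) ^ β / β) * ∑ i ∈ Finset.range (m + 2),
    ((m + 1).choose i : ℝ≥0∞) * (C i * (I + 1)) with hK1
  have hK1T : K1 ≠ ⊤ := by
    refine ENNReal.mul_ne_top ENNReal.ofReal_ne_top (ENNReal.sum_ne_top.2 fun i _ => ?_)
    exact ENNReal.mul_ne_top (ENNReal.natCast_ne_top _) (by finiteness)
  set K2 : ℝ≥0∞ := ENNReal.ofReal ((1 / 2) ^ (-β) / β) * 2 ^ (m + 1) with hK2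
  have hK2T : K2 ≠ ⊤ := by finiteness
  set e1 : ℝ≥0∞ := ENNReal.ofReal (Real.exp 1) with he1
  have hKT : e1 * (K1 + K2 * A) ≠ ⊤ := by finiteness
  refine ⟨(e1 * (K1 + K2 * A)).toNNReal, fun f M h t ht ht1 => ?_⟩
  rw [ENNReal.coe_toNNReal hKT]
  have hf := h.polyIntegrable hp
  have hNT : luxNorm (gauss d) p (besselAbs β f) ≠ ⊤ :=
    ne_top_of_le_ne_top (ENNReal.mul_ne_top ENNReal.coe_ne_top h.ne_top) (hN f M h)
  have hexp : ∀ x, ‖poissonD l t (besselInt β f) x‖ₑ ≤ e1 *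
      ((∫⁻ s in Set.Ioo 0 1, ENNReal.ofReal (s ^ (-β - 1)) *
        ‖(fwdDiff s)^[m + 1] (fun r => expPoissonD 0 l r f x) t‖ₑ) +
      ∫⁻ s in Set.Ioi (1 / 2), ENNReal.ofReal (s ^ (-β - 1)) *
        ‖(fwdDiff s)^[m + 1] (fun r => expPoissonD 0 l r f x) t‖ₑ) := by
    intro x
    refine (enorm_poissonD_besselInt_le hp hf hNT l ht x).trans (mul_le_mul' ?_
      (lintegral_Ioi_le_add _))
    exact ENNReal.ofReal_le_ofReal (Real.exp_le_exp.2 ht1)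
  have hu : Measurable (Function.uncurry fun r x => expPoissonD 0 l r f x) :=
    measurable_expPoissonD_uncurry hf.measurable 0 l
  have hmd : Measurable fun w : ℝ × E d => ENNReal.ofReal (w.1 ^ (-β - 1)) *
      ‖(fwdDiff w.1)^[m + 1] (fun r => expPoissonD 0 l r f w.2) t‖ₑ := by
    refine Measurable.mul (by fun_prop) (Measurable.enorm ?_)
    simp only [fwdDiff_iterate_eq_sum]
    refine Finset.measurable_sum _ fun k _ => Measurable.const_mul ?_ _
    exact hu.comp (f := fun w : ℝ × E d => (t + k • w.1, w.2)) (by fun_prop)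
  have hv : poissonNorm p (besselInt β f) l t ≤ e1 * (K1 *
      (ENNReal.ofReal (t ^ (-(a - δ))) * M + hardyIntegral α β p f t) +
      K2 * poissonNormSup p f l t) := by
    refine (luxNorm_mono hp.ae_one_le (.of_forall hexp)).trans ?_
    refine (luxNorm_const_mul_le hp.ae_one_le _ ENNReal.ofReal_ne_top).trans (mul_le_mul_right ?_ _)
    refine (luxNorm_add_le hp.measurable hp.ae_one_le (Measurable.lintegral_prod_left hmd)
      (Measurable.lintegral_prod_left hmd)).trans (add_le_add ?_ ?_)
    · have hBm : ∀ i, Measurable fun ρ => (C i : ℝ≥0∞) * (ENNReal.ofReal (t ^ (-(a - δ))) * M +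
          ENNReal.ofReal ((t + ρ) ^ (-((l : ℝ) + nextInt β - α))) *
            besovProfile α p f (t + ρ)) := by
        intro i
        have := measurable_besovProfile α p f
        fun_prop
      refine (luxNorm_lintegral_fwdDiff_le hp hf m l hβ ht hBm fun i hi ρ hρ =>
        hC i hi f M h t ρ ht hρ.1 (by linarith [hρ.2])).trans ?_
      rw [hK1, mul_assoc, Finset.sum_mul]
      refine mul_le_mul_right (Finset.sum_le_sum fun i _ => ?_) _
      rw [mul_assoc]
      refine mul_le_mul_right ?_ _
      have hsplit : ∫⁻ ρ in Set.Ioo 0 ((m : ℝ) + 1), ENNReal.ofReal (ρ ^ (m - β)) *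
          ((C i : ℝ≥0∞) * (ENNReal.ofReal (t ^ (-(a - δ))) * M +
          ENNReal.ofReal ((t + ρ) ^ (-((l : ℝ) + nextInt β - α))) *
            besovProfile α p f (t + ρ))) =
          C i * (I * (ENNReal.ofReal (t ^ (-(a - δ))) * M) + hardyIntegral α β p f t) := by
        have hX : Measurable fun ρ : ℝ => ENNReal.ofReal (ρ ^ (m - β)) := by fun_prop
        rw [hI, ← lintegral_mul_const _ hX, hardyIntegral,
          show (nextInt β : ℝ) = (m : ℝ) + 1 by rw [hn]; push_cast; ring,
          show (m : ℝ) + 1 - β - 1 = m - β by ring,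
          ← lintegral_add_left (by fun_prop), ← lintegral_const_mul' _ _ ENNReal.coe_ne_top]
        refine lintegral_congr fun ρ => ?_
        ring
      rw [hsplit, mul_assoc]
      refine mul_le_mul_right ?_ _
      rw [add_mul, one_mul, mul_add]
      exact add_le_add le_self_add le_add_self
    · refine (luxNorm_lintegral_fwdDiff_tail_le hp hβ hu (t := t) (B := poissonNormSup p f l t)
        (fun r hr => ?_) (m + 1)).trans_eq (by rw [hK2, mul_assoc])
      have h1 := luxNorm_expPoissonD_le hp hf.measurable (ht.le.trans hr) 0 l
      simp only [zero_add, Finset.range_one, Finset.sum_singleton, Nat.choose_self, Nat.cast_one,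
        one_mul, add_zero] at h1
      exact h1.trans (poissonNorm_le_sup f l hr)
  refine (mul_le_mul_right hv _).trans ?_
  have e2 : ENNReal.ofReal (t ^ a) * ENNReal.ofReal (t ^ (-(a - δ))) = ENNReal.ofReal (t ^ δ) := by
    rw [← ENNReal.ofReal_mul (Real.rpow_nonneg ht.le _), ← Real.rpow_add ht]
    ring_nf
  have h5 := hA f M h t ht ht1
  set X := ENNReal.ofReal (t ^ δ) * M with hX
  set H := hardyIntegral α β p f t
  set S := poissonNormSup p f l t
  calc ENNReal.ofReal (t ^ a) * (e1 * (K1 * (ENNReal.ofReal (t ^ (-(a - δ))) * M + H) + K2 * S))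
      = e1 * (K1 * (ENNReal.ofReal (t ^ a) * ENNReal.ofReal (t ^ (-(a - δ))) * M +
          ENNReal.ofReal (t ^ a) * H) + K2 * (ENNReal.ofReal (t ^ a) * S)) := by ring
    _ ≤ e1 * (K1 * (X + ENNReal.ofReal (t ^ a) * H) + K2 * (A * X)) := by
        rw [e2]
        exact mul_le_mul_right (add_le_add le_rfl (mul_le_mul_right h5 _)) _
    _ ≤ e1 * (K1 * (X + ENNReal.ofReal (t ^ a) * H) +
          K2 * (A * (X + ENNReal.ofReal (t ^ a) * H))) :=
        mul_le_mul_right (add_le_add le_rfl (mul_le_mul_right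
          (mul_le_mul_right le_self_add _) _)) _
    _ = _ := by ring

/-- Under `ρ = tθ` the powers of `t` cancel: `a + 1 + (b - 1) - (a + b) = 0`. Truncating the profile
is harmless because `t + ρ` stays below `nextInt β + 1`. -/
theorem rpow_mul_hardyIntegral_le {a b : ℝ} (ha : a = (nextInt (α - β) : ℝ) - (α - β))
    (hb : b = (nextInt β : ℝ) - β) (f : E d → ℝ) {t : ℝ} (ht : 0 < t) (ht1 : t ≤ 1) :
    ENNReal.ofReal (t ^ a) * hardyIntegral α β p f t ≤
      ∫⁻ θ in Set.Ioi 0, ENNReal.ofReal (θ ^ (b - 1) * (1 + θ) ^ (-(a + b))) *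
        (Set.Iic ((nextInt β : ℝ) + 1)).indicator (besovProfile α p f) (t * (1 + θ)) := by
  have hab : (nextInt (α - β) : ℝ) + nextInt β - α = a + b := by rw [ha, hb]; ring
  set T : ℝ := (nextInt β : ℝ) + 1 with hT
  have h1 : hardyIntegral α β p f t ≤ ∫⁻ ρ in Set.Ioi 0, ENNReal.ofReal (ρ ^ (b - 1)) *
      (ENNReal.ofReal ((t + ρ) ^ (-(a + b))) *
        (Set.Iic T).indicator (besovProfile α p f) (t + ρ)) := by
    rw [hardyIntegral, hab, ← hb]
    refine le_trans (le_of_eq ?_) (lintegral_mono_set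
      (s := Set.Ioo 0 (nextInt β : ℝ)) Set.Ioo_subset_Ioi_self)
    refine setLIntegral_congr_fun measurableSet_Ioo fun ρ hρ => ?_
    have hmem : t + ρ ∈ Set.Iic T := by
      rw [Set.mem_Iic, hT]; linarith [hρ.2]
    rw [Set.indicator_of_mem hmem]
  refine (mul_le_mul_right h1 _).trans_eq ?_
  rw [lintegral_Ioi_comp_mul ht, ← lintegral_const_mul' _ _ ENNReal.ofReal_ne_top]
  refine setLIntegral_congr_fun measurableSet_Ioi fun θ hθ => ?_
  have hθ : 0 < θ := hθ
  have e : t * (1 + θ) = t + t * θ := by ring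
  have hid : θ ^ (b - 1) * (1 + θ) ^ (-(a + b)) =
      t ^ a * (t * ((t * θ) ^ (b - 1) * (t + t * θ) ^ (-(a + b)))) := by
    rw [← e, Real.mul_rpow ht.le hθ.le, Real.mul_rpow ht.le (by linarith)]
    have : t ^ a * (t ^ (1 : ℝ) * (t ^ (b - 1) * t ^ (-(a + b)))) = 1 := by
      rw [← Real.rpow_add ht, ← Real.rpow_add ht, ← Real.rpow_add ht]
      ring_nf
      exact Real.rpow_zero t
    rw [Real.rpow_one] at this
    linear_combination (-(θ ^ (b - 1) * (1 + θ) ^ (-(a + b)))) * this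
  rw [hid, e, ENNReal.ofReal_mul (Real.rpow_nonneg ht.le _), ENNReal.ofReal_mul ht.le,
    ENNReal.ofReal_mul (Real.rpow_nonneg (by positivity) _)]
  ring

end GaussianBesov

end

noncomputable section

namespace GaussianBesov

variable {d : ℕ} {f : E d → ℝ} {p : E d → ℝ} {α β : ℝ} {q : ℝ → ℝ}

/-! ### The seminorm of the fractional derivative -/

theorem exists_besovProfile_le (hp : IsAdmissible p) (hα : 0 ≤ α) (hq : ∀ᵐ t ∂haarPos, 1 ≤ q t) :
    ∃ D : ℝ≥0, 1 ≤ D ∧ ∀ f : E d → ℝ, ∀ M, BesovBound α p q f M → ∀ u > 0,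
      besovProfile α p f (2 * u) ≤ D * M ∧ besovProfile α p f (2 * u) ≤
        D * (ENNReal.ofReal (u ^ ((nextInt α : ℝ) - α)) * poissonNorm p f (nextInt α) u) := by
  obtain ⟨C, hC1, hC⟩ := exists_rpow_mul_poissonNormSup_le (q := q) hp hα hq
  obtain ⟨A, hA1, hA⟩ := exists_poissonNormSup_le hp
  refine ⟨2 * C * A, one_le_mul (one_le_mul (by norm_num) hC1) hA1, fun f M h u hu => ?_⟩
  have hC1' : (1 : ℝ≥0∞) ≤ C := by exact_mod_cast hC1
  have hA1' : (1 : ℝ≥0∞) ≤ A := by exact_mod_cast hA1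
  have h1 : besovProfile α p f (2 * u) ≤
      2 * (ENNReal.ofReal (u ^ ((nextInt α : ℝ) - α)) * poissonNormSup p f (nextInt α) u) := by
    rw [besovProfile, mul_div_cancel_left₀ u two_ne_zero, ← mul_assoc]
    refine mul_le_mul_left ?_ _
    rw [← ENNReal.ofReal_ofNat 2, ← ENNReal.ofReal_mul (by norm_num)]
    exact ENNReal.ofReal_le_ofReal (rpow_le_two_mul_rpow nextInt_sub_pos.le (nextInt_sub_le hα)
      (by positivity) (by linarith))
  push_cast
  constructor
  · refine h1.trans ((mul_le_mul_right (hC f M h u hu) 2).trans ?_)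
    rw [← mul_assoc]
    exact mul_le_mul_left (le_mul_of_one_le_right zero_le hA1') _
  · refine h1.trans ((mul_le_mul_right (mul_le_mul_right
      (hA f (h.polyIntegrable hp) (nextInt α) u hu) _) 2).trans ?_)
    set X := ENNReal.ofReal (u ^ ((nextInt α : ℝ) - α))
    set P := poissonNorm p f (nextInt α) u
    calc 2 * (X * (A * P)) = 2 * A * (X * P) * 1 := by ring
      _ ≤ 2 * A * (X * P) * C := mul_le_mul_right hC1' _
      _ = 2 * C * A * (X * P) := by ring

/-- The profile normalized by `N` and truncated at `T`. -/
def normProfile (α : ℝ) (p : E d → ℝ) (f : E d → ℝ) (N : ℝ≥0∞) (T r : ℝ) : ℝ≥0∞ :=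
  (Set.Iic T).indicator (fun r => besovProfile α p f r / N) r

theorem measurable_normProfile (α : ℝ) (p : E d → ℝ) (f : E d → ℝ) (N : ℝ≥0∞) (T : ℝ) :
    Measurable (normProfile α p f N T) :=
  ((measurable_besovProfile α p f).div_const N).indicator measurableSet_Iic

/-- Passes from the variable exponent `q(t)`, for which the hypothesis is given, to the constant
`q(0)`, for which Hardy's inequality is available. The normalized profile is at most `1`, so
freezing the exponent applies on `(0, 1/2]`, and the truncation leaves only a set of finite mass
beyond. -/
theorem exists_lintegral_normProfile_le (hq : ExponentZeroInfty q) {q0 A : ℝ} (hq0 : 1 ≤ q0)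
    (hA : ∀ t, 0 < t → t ≤ 1 / 2 → |q t - q0| ≤ A / Real.log (1 / t)) {D : ℝ≥0} (hD1 : 1 ≤ D)
    (hD : ∀ f : E d → ℝ, ∀ M, BesovBound α p q f M → ∀ u > 0,
      besovProfile α p f (2 * u) ≤ D * M ∧ besovProfile α p f (2 * u) ≤
        D * (ENNReal.ofReal (u ^ ((nextInt α : ℝ) - α)) * poissonNorm p f (nextInt α) u))
    {T : ℝ} (hT : 1 ≤ T) :
    ∃ R : ℝ≥0, ∀ f : E d → ℝ, ∀ M, BesovBound α p q f M →
      ∫⁻ t, normProfile α p f (D * M) T t ^ q0 ∂haarPos ≤ R := by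
  set e1 : ℝ≥0∞ := ENNReal.ofReal (Real.exp A) with he1
  refine ⟨(e1 + ENNReal.ofReal (2 * T)).toNNReal, fun f M h => ?_⟩
  rw [ENNReal.coe_toNNReal (by finiteness)]
  have hD0 : (D : ℝ≥0∞) ≠ 0 := by
    have : (1 : ℝ≥0∞) ≤ D := by exact_mod_cast hD1
    exact (lt_of_lt_of_le zero_lt_one this).ne'
  have hDM0 : (D : ℝ≥0∞) * M ≠ 0 := mul_ne_zero hD0 h.ne_zero
  have hDMT : (D : ℝ≥0∞) * M ≠ ⊤ := ENNReal.mul_ne_top ENNReal.coe_ne_top h.ne_top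
  set η := normProfile α p f (D * M) T with hη
  have hηm : Measurable η := measurable_normProfile _ _ _ _ _
  set z : ℝ → ℝ≥0∞ := fun t => ENNReal.ofReal (t ^ ((nextInt α : ℝ) - α)) *
    poissonNorm p f (nextInt α) t / M with hz
  have hη1 : ∀ u > 0, η (2 * u) ≤ 1 ∧ η (2 * u) ≤ z u := by
    intro u hu
    rw [hη, normProfile]
    by_cases hmem : 2 * u ∈ Set.Iic T
    · rw [Set.indicator_of_mem hmem]
      refine ⟨ENNReal.div_le_of_le_mul (by rw [one_mul]; exact (hD f M h u hu).1),
        ENNReal.div_le_of_le_mul ?_⟩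
      refine (hD f M h u hu).2.trans_eq ?_
      have hzM : z u * M = ENNReal.ofReal (u ^ ((nextInt α : ℝ) - α)) *
          poissonNorm p f (nextInt α) u := ENNReal.div_mul_cancel h.ne_zero h.ne_top
      rw [← hzM, mul_left_comm]
    · rw [Set.indicator_of_notMem hmem]
      exact ⟨zero_le, zero_le⟩
  -- One remainder for both ranges: `2u` dominates the error `u` for `u ≤ 1/2`, and the trivial
  -- bound `1` for `1/2 < u ≤ T`.
  set Rf : ℝ → ℝ≥0∞ := (Set.Ioc 0 T).indicator fun u => ENNReal.ofReal (2 * u) with hRf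
  have hRfm : Measurable Rf := Measurable.indicator (by fun_prop) measurableSet_Ioc
  have hRint : ∫⁻ u, Rf u ∂haarPos ≤ ENNReal.ofReal (2 * T) := by
    rw [lintegral_haarPos hRfm]
    calc ∫⁻ u in Set.Ioi 0, ENNReal.ofReal (1 / u) * Rf u
        ≤ ∫⁻ u in Set.Ioi 0, (Set.Ioc 0 T).indicator (fun _ => 2) u := by
          refine setLIntegral_mono' measurableSet_Ioi fun u hu => ?_
          have hu : 0 < u := hu
          by_cases hmem : u ∈ Set.Ioc 0 T
          · rw [hRf, Set.indicator_of_mem hmem, Set.indicator_of_mem hmem,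
              ← ENNReal.ofReal_mul (by positivity), show 1 / u * (2 * u) = 2 by field_simp,
              ENNReal.ofReal_ofNat]
          · rw [hRf, Set.indicator_of_notMem hmem, mul_zero]
            exact zero_le
      _ ≤ ∫⁻ u, (Set.Ioc 0 T).indicator (fun _ => 2) u := setLIntegral_le_lintegral _ _
      _ = ENNReal.ofReal (2 * T) := by
          rw [lintegral_indicator measurableSet_Ioc, setLIntegral_const, Real.volume_Ioc, sub_zero,
            ENNReal.ofReal_mul (by norm_num), ENNReal.ofReal_ofNat]
  have hpt : ∀ᵐ u ∂haarPos, η (2 * u) ^ q0 ≤ e1 * z u ^ q u + Rf u := by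
    filter_upwards [ae_haarPos_pos, ae_haarPos_of_ae hq.ae_one_le] with u hu hqu
    obtain ⟨h1, h2⟩ := hη1 u hu
    rcases le_or_gt u (1 / 2) with hu2 | hu2
    · have h3 := rpow_le_exp_mul_rpow_add h1 hu hu2 hq0
        (by rw [abs_sub_comm]; exact hA u hu hu2)
      refine h3.trans (add_le_add (mul_le_mul_right (ENNReal.rpow_le_rpow h2 (by linarith)) _) ?_)
      rw [hRf, Set.indicator_of_mem (show u ∈ Set.Ioc 0 T from ⟨hu, by linarith⟩)]
      exact ENNReal.ofReal_le_ofReal (by linarith)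
    · refine le_add_left ?_
      by_cases hmem : 2 * u ≤ T
      · rw [hRf, Set.indicator_of_mem (show u ∈ Set.Ioc 0 T from ⟨hu, by linarith⟩)]
        calc η (2 * u) ^ q0 ≤ 1 := ENNReal.rpow_le_one h1 (by linarith)
          _ ≤ ENNReal.ofReal (2 * u) := by
              rw [← ENNReal.ofReal_one]; exact ENNReal.ofReal_le_ofReal (by linarith)
      · rw [hη, normProfile, Set.indicator_of_notMem (by simpa using hmem),
          ENNReal.zero_rpow_of_pos (by linarith)]
        exact zero_le
  rw [← lintegral_haarPos_comp_mul two_pos (F := fun t => η t ^ q0) (by fun_prop)]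
  refine (lintegral_mono_ae hpt).trans ?_
  rw [lintegral_add_right _ hRfm, lintegral_const_mul' _ _ ENNReal.ofReal_ne_top]
  refine add_le_add (mul_le_of_le_one_right zero_le ?_) hRint
  exact h.modular_le

theorem lintegral_besovRemainder_ne_top {δ γ : ℝ} (hδ : 0 < δ) (hγ : 0 < γ) :
    ∫⁻ t, ((Set.Ioo 0 1).indicator (fun t => ENNReal.ofReal (t ^ δ) + ENNReal.ofReal t) t +
      (Set.Ioi (1 / 2)).indicator (fun t => ENNReal.ofReal ((2 * t) ^ (-γ))) t) ∂haarPos ≠ ⊤ := by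
  have hm1 : Measurable ((Set.Ioo (0 : ℝ) 1).indicator
      (fun t => ENNReal.ofReal (t ^ δ) + ENNReal.ofReal t)) :=
    Measurable.indicator (by fun_prop) measurableSet_Ioo
  have hm2 : Measurable ((Set.Ioi (1 / 2 : ℝ)).indicator (fun t => ENNReal.ofReal ((2 * t) ^ (-γ)))) :=
    Measurable.indicator (by fun_prop) measurableSet_Ioi
  rw [lintegral_add_left hm1, lintegral_haarPos hm1, lintegral_haarPos hm2]
  refine ENNReal.add_ne_top.2 ⟨?_, ?_⟩
  · refine ne_top_of_le_ne_top (b := ∫⁻ t in Set.Ioo (0 : ℝ) 1, (ENNReal.ofReal (t ^ (δ - 1)) + 1))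
      ?_ ?_
    · rw [lintegral_add_right _ measurable_const]
      refine ENNReal.add_ne_top.2 ⟨lintegral_Ioo_rpow_ne_top (by linarith) 1, by simp⟩
    · rw [← lintegral_indicator measurableSet_Ioo]
      refine (setLIntegral_mono' measurableSet_Ioi fun t ht => ?_).trans
        (setLIntegral_le_lintegral (Set.Ioi 0) _)
      have ht : 0 < t := ht
      by_cases hmem : t ∈ Set.Ioo (0 : ℝ) 1
      · rw [Set.indicator_of_mem hmem, Set.indicator_of_mem hmem, mul_add,
          ← ENNReal.ofReal_mul (by positivity), ← ENNReal.ofReal_mul (by positivity),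
          one_div_mul_cancel ht.ne', ENNReal.ofReal_one, Real.rpow_sub_one ht.ne',
          one_div, mul_comm, ← div_eq_mul_inv]
      · rw [Set.indicator_of_notMem hmem, mul_zero]
        exact zero_le
  · refine ne_top_of_le_ne_top
      (b := ENNReal.ofReal (2 ^ (-γ)) * ∫⁻ t in Set.Ioi (1 / 2 : ℝ), ENNReal.ofReal (t ^ (-γ - 1))) ?_ ?_
    · rw [lintegral_Ioi_rpow hγ (by norm_num)]
      finiteness
    · rw [← lintegral_const_mul' _ _ ENNReal.ofReal_ne_top,
        ← lintegral_indicator (s := Set.Ioi (1 / 2 : ℝ)) measurableSet_Ioi]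
      refine (setLIntegral_mono' measurableSet_Ioi fun t ht => ?_).trans
        (setLIntegral_le_lintegral (Set.Ioi 0) _)
      have ht : 0 < t := ht
      by_cases hmem : t ∈ Set.Ioi (1 / 2 : ℝ)
      · rw [Set.indicator_of_mem hmem, Set.indicator_of_mem hmem,
          ← ENNReal.ofReal_mul (by positivity), ← ENNReal.ofReal_mul (by positivity),
          Real.rpow_sub_one ht.ne', Real.mul_rpow (by norm_num) ht.le]
        refine ENNReal.ofReal_le_ofReal (le_of_eq ?_)
        ring
      · rw [Set.indicator_of_notMem hmem, mul_zero]
        exact zero_le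

theorem varLpNorm_besselInt_le (hp : IsAdmissible p) :
    varLpNorm (gauss d) p (besselInt β f) ≤ luxNorm (gauss d) p (besselAbs β f) :=
  luxNorm_mono hp.ae_one_le (.of_forall fun x => enorm_besselInt_le β f x)

/-- For `t ≤ 1/2` the normalized quantity is at most the larger of `t^δ` and an average of the
profile. The average is at most `1`, so its exponent can be frozen at `q(0)` before applying Hardy.
For `t > 1/2` it is at most `(2t)^{-(α-β)}`. Since `q ≥ 1`, the powers of quantities at most `1` can
be dropped. -/
theorem exists_luxNorm_haarPos_besselInt_le (hp : IsAdmissible p) (hβ : 0 < β) (hβα : β < α)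
    (hq : ExponentZeroInfty q) : ∃ C : ℝ≥0, ∀ f : E d → ℝ, ∀ M, BesovBound α p q f M →
      luxNorm haarPos q (fun t => ENNReal.ofReal (t ^ ((nextInt (α - β) : ℝ) - (α - β))) *
        poissonNorm p (besselInt β f) (nextInt (α - β)) t) ≤ C * M := by
  have hα : 0 ≤ α := hβ.le.trans hβα.le
  have hγ : 0 < α - β := sub_pos.2 hβα
  have hq1 := ae_haarPos_of_ae hq.ae_one_le
  obtain ⟨q0, hq0t, A, hA⟩ := hq.at_zero
  have hq0 := hq.one_le_of_tendsto hq0t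
  set a : ℝ := (nextInt (α - β) : ℝ) - (α - β) with ha
  set b : ℝ := (nextInt β : ℝ) - β with hb
  have ha0 : 0 < a := nextInt_sub_pos
  have hb0 : 0 < b := nextInt_sub_pos
  -- Positive, below `a`, and at most `β`, as the two small-time cases demand.
  set δ : ℝ := min (a / 2) β with hδ
  have hδ0 : 0 < δ := lt_min (half_pos ha0) hβ
  have hδa : δ < a := (min_le_left _ _).trans_lt (half_lt_self ha0)
  set T : ℝ := (nextInt β : ℝ) + 1 with hT
  have hT1 : 1 ≤ T := by
    have : (0 : ℝ) ≤ nextInt β := Nat.cast_nonneg _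
    linarith
  obtain ⟨D, hD1, hD⟩ := exists_besovProfile_le (q := q) hp hα hq1
  obtain ⟨R, hR⟩ := exists_lintegral_normProfile_le hq hq0 hA hD1 hD hT1
  obtain ⟨C1, hC1⟩ := exists_poissonNorm_besselInt_le (q := q) hp hβ hβα hq1 hδa (min_le_right _ _)
  obtain ⟨N, hN⟩ := exists_luxNorm_besselAbs_le (q := q) hp hβ hβα hq1
  obtain ⟨C2, hC2⟩ := exists_poissonNorm_le hp (nextInt (α - β))
  set w : ℝ → ℝ≥0∞ := fun θ => ENNReal.ofReal (θ ^ (b - 1) * (1 + θ) ^ (-(a + b))) with hw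
  have hwm : Measurable w := by fun_prop
  -- The added `1` only guarantees that division by `m0` is legitimate.
  set m0 : ℝ≥0∞ := (∫⁻ θ in Set.Ioi 0, w θ) + 1 with hm0
  have hm0T : m0 ≠ ⊤ := ENNReal.add_ne_top.2 ⟨lintegral_hardyWeight_ne_top ha0 hb0, by simp⟩
  have hm00 : m0 ≠ 0 := by rw [hm0]; positivity
  set Q : ℝ → ℝ≥0∞ := fun t =>
    (Set.Ioo 0 1).indicator (fun t => ENNReal.ofReal (t ^ δ) + ENNReal.ofReal t) t +
      (Set.Ioi (1 / 2)).indicator (fun t => ENNReal.ofReal ((2 * t) ^ (-(α - β)))) t with hQ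
  have hQm : Measurable Q := (Measurable.indicator (by fun_prop) measurableSet_Ioo).add
    (Measurable.indicator (by fun_prop) measurableSet_Ioi)
  have hQT : ∫⁻ t, Q t ∂haarPos ≠ ⊤ := lintegral_besovRemainder_ne_top hδ0 hγ
  set e1 : ℝ≥0∞ := ENNReal.ofReal (Real.exp A) with he1
  set K : ℝ≥0∞ := C1 * (1 + D * m0) + C2 * N * ENNReal.ofReal (2 ^ (α - β)) + 1 with hK
  have hKT : K ≠ ⊤ := by finiteness
  have hK0 : K ≠ 0 := by rw [hK]; positivity
  set L : ℝ≥0∞ := (∫⁻ t, Q t ∂haarPos) + e1 * R + 1 with hL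
  have hLT : L ≠ ⊤ := by finiteness
  refine ⟨(K * L).toNNReal, fun f M h => ?_⟩
  rw [ENNReal.coe_toNNReal (by finiteness)]
  have hf := h.polyIntegrable hp
  have hD0 : (D : ℝ≥0∞) ≠ 0 := by
    have : (1 : ℝ≥0∞) ≤ D := by exact_mod_cast hD1
    exact (lt_of_lt_of_le zero_lt_one this).ne'
  have hDM0 : (D : ℝ≥0∞) * M ≠ 0 := mul_ne_zero hD0 h.ne_zero
  have hDMT : (D : ℝ≥0∞) * M ≠ ⊤ := ENNReal.mul_ne_top ENNReal.coe_ne_top h.ne_top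
  have hKM0 : K * M ≠ 0 := mul_ne_zero hK0 h.ne_zero
  have hKMT : K * M ≠ ⊤ := ENNReal.mul_ne_top hKT h.ne_top
  set η := normProfile α p f (D * M) T with hη
  have hηm : Measurable η := measurable_normProfile _ _ _ _ _
  set S : ℝ → ℝ≥0∞ := fun t => (∫⁻ θ in Set.Ioi 0, w θ * η (t * (1 + θ))) with hS
  have hη1 : ∀ r > 0, η r ≤ 1 := by
    intro r hr
    have h1 := (hD f M h (r / 2) (half_pos hr)).1
    rw [mul_div_cancel₀ r two_ne_zero] at h1
    rw [hη, normProfile]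
    refine Set.indicator_apply_le' (fun _ => ?_) (fun _ => zero_le)
    exact ENNReal.div_le_of_le_mul (by rwa [one_mul])
  have hS1 : ∀ t > 0, S t / m0 ≤ 1 := by
    intro t ht
    refine ENNReal.div_le_of_le_mul ?_
    rw [one_mul, hm0]
    refine le_add_right (setLIntegral_mono' measurableSet_Ioi fun θ hθ => ?_)
    have hθ : 0 < θ := hθ
    exact mul_le_of_le_one_right zero_le (hη1 _ (by positivity))
  have hHS : ∀ t, 0 < t → t ≤ 1 → ENNReal.ofReal (t ^ a) * hardyIntegral α β p f t ≤
      D * M * m0 * (S t / m0) := by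
    intro t ht ht1
    refine (rpow_mul_hardyIntegral_le ha hb f ht ht1).trans_eq ?_
    rw [mul_assoc, ENNReal.mul_div_cancel hm00 hm0T, hS, ← lintegral_const_mul' _ _ hDMT]
    refine lintegral_congr fun θ => ?_
    rw [mul_left_comm]
    congr 1
    rw [hη, normProfile]
    by_cases hmem : t * (1 + θ) ∈ Set.Iic T
    · rw [Set.indicator_of_mem hmem, Set.indicator_of_mem hmem, ENNReal.mul_div_cancel hDM0 hDMT]
    · rw [Set.indicator_of_notMem hmem, Set.indicator_of_notMem hmem, mul_zero]
  set F : ℝ → ℝ≥0∞ := fun t => ENNReal.ofReal (t ^ a) *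
    poissonNorm p (besselInt β f) (nextInt (α - β)) t with hF
  have hsmall : ∀ t, 0 < t → t ≤ 1 / 2 → F t / (K * M) ≤ max (ENNReal.ofReal (t ^ δ)) (S t / m0) := by
    intro t ht ht2
    refine ENNReal.div_le_of_le_mul ?_
    set X := max (ENNReal.ofReal (t ^ δ)) (S t / m0) with hX
    calc F t ≤ C1 * (ENNReal.ofReal (t ^ δ) * M +
          ENNReal.ofReal (t ^ a) * hardyIntegral α β p f t) := hC1 f M h t ht (by linarith)
      _ ≤ C1 * (X * M + D * M * m0 * X) := by
          refine mul_le_mul_right (add_le_add (mul_le_mul_left (le_max_left _ _) _) ?_) _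
          exact (hHS t ht (by linarith)).trans (mul_le_mul_right (le_max_right _ _) _)
      _ = X * (C1 * (1 + D * m0) * M) := by ring
      _ ≤ X * (K * M) := by
          refine mul_le_mul_right (mul_le_mul_left ?_ _) _
          rw [hK, add_assoc]
          exact le_self_add
  have hlarge : ∀ t, 1 / 2 < t → F t / (K * M) ≤ ENNReal.ofReal ((2 * t) ^ (-(α - β))) := by
    intro t ht
    have ht0 : 0 < t := lt_trans (by norm_num) ht
    refine ENNReal.div_le_of_le_mul ?_
    have h1 := hC2 (besselInt β f) (measurable_besselInt hf.measurable β) t ht0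
    have h2 := (varLpNorm_besselInt_le (β := β) (f := f) hp).trans (hN f M h)
    have e2 : t ^ a * (t ^ nextInt (α - β))⁻¹ = 2 ^ (α - β) * (2 * t) ^ (-(α - β)) := by
      rw [Real.mul_rpow (by norm_num) ht0.le, ← mul_assoc, ← Real.rpow_add (by norm_num : (0 : ℝ) < 2),
        add_neg_cancel, Real.rpow_zero, one_mul, ← Real.rpow_natCast, ← Real.rpow_neg ht0.le,
        ← Real.rpow_add ht0, ha]
      congr 1
      ring
    calc F t ≤ ENNReal.ofReal (t ^ a) *
          (C2 * ENNReal.ofReal ((t ^ nextInt (α - β))⁻¹) * (N * M)) :=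
          mul_le_mul_right (h1.trans (mul_le_mul_right h2 _)) _
      _ = C2 * N * (ENNReal.ofReal (t ^ a) * ENNReal.ofReal ((t ^ nextInt (α - β))⁻¹)) * M := by
          ring
      _ = ENNReal.ofReal ((2 * t) ^ (-(α - β))) * (C2 * N * ENNReal.ofReal (2 ^ (α - β)) * M) := by
          rw [← ENNReal.ofReal_mul (by positivity), e2, ENNReal.ofReal_mul (by positivity)]
          ring
      _ ≤ ENNReal.ofReal ((2 * t) ^ (-(α - β))) * (K * M) := by
          refine mul_le_mul_right (mul_le_mul_left ?_ _) _
          rw [hK]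
          exact le_add_right le_add_self
  have hpt : ∀ᵐ t ∂haarPos, (F t / (K * M)) ^ q t ≤ Q t + e1 * (S t / m0) ^ q0 := by
    filter_upwards [ae_haarPos_pos, hq1] with t ht hqt
    rcases le_or_gt t (1 / 2) with ht2 | ht2
    · have hQt : ENNReal.ofReal (t ^ δ) + ENNReal.ofReal t ≤ Q t := by
        rw [hQ]
        simp only
        rw [Set.indicator_of_mem (show t ∈ Set.Ioo (0 : ℝ) 1 from ⟨ht, by linarith⟩)]
        exact le_self_add
      have htδ : ENNReal.ofReal (t ^ δ) ≤ 1 := by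
        rw [← ENNReal.ofReal_one]
        exact ENNReal.ofReal_le_ofReal (Real.rpow_le_one ht.le (by linarith) hδ0.le)
      have h1 : ENNReal.ofReal (t ^ δ) ^ q t ≤ ENNReal.ofReal (t ^ δ) := by
        simpa using ENNReal.rpow_le_rpow_of_exponent_ge htδ hqt
      have h2 := rpow_le_exp_mul_rpow_add (hS1 t ht) ht ht2 hqt (hA t ht ht2)
      have hqt0 : 0 ≤ q t := by linarith
      calc (F t / (K * M)) ^ q t ≤ max (ENNReal.ofReal (t ^ δ)) (S t / m0) ^ q t :=
            ENNReal.rpow_le_rpow (hsmall t ht ht2) hqt0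
        _ ≤ ENNReal.ofReal (t ^ δ) ^ q t + (S t / m0) ^ q t := by
            rcases max_cases (ENNReal.ofReal (t ^ δ)) (S t / m0) with ⟨hm, _⟩ | ⟨hm, _⟩
            · rw [hm]; exact le_self_add
            · rw [hm]; exact le_add_self
        _ ≤ ENNReal.ofReal (t ^ δ) + (e1 * (S t / m0) ^ q0 + ENNReal.ofReal t) :=
            add_le_add h1 h2
        _ = ENNReal.ofReal (t ^ δ) + ENNReal.ofReal t + e1 * (S t / m0) ^ q0 := by ring
        _ ≤ _ := add_le_add hQt le_rfl
    · refine le_add_right ?_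
      have h2t : (1 : ℝ) ≤ 2 * t := by linarith
      have h1 : ENNReal.ofReal ((2 * t) ^ (-(α - β))) ≤ 1 := by
        rw [← ENNReal.ofReal_one]
        exact ENNReal.ofReal_le_ofReal
          (Real.rpow_le_one_of_one_le_of_nonpos h2t (by linarith))
      calc (F t / (K * M)) ^ q t ≤ ENNReal.ofReal ((2 * t) ^ (-(α - β))) ^ q t :=
            ENNReal.rpow_le_rpow (hlarge t ht2) (by linarith)
        _ ≤ ENNReal.ofReal ((2 * t) ^ (-(α - β))) := by
            simpa using ENNReal.rpow_le_rpow_of_exponent_ge h1 hqt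
        _ ≤ Q t := by
            rw [hQ]
            simp only
            rw [Set.indicator_of_mem (show t ∈ Set.Ioi (1 / 2 : ℝ) from ht2)]
            exact le_add_self
  have hmod : modular haarPos q (fun t => F t / (K * M)) ≤ L := by
    refine (lintegral_mono_ae hpt).trans ?_
    rw [lintegral_add_left hQm, lintegral_const_mul' _ _ ENNReal.ofReal_ne_top, hL]
    refine le_add_right (add_le_add le_rfl (mul_le_mul_right ?_ _))
    exact lintegral_haarPos_rpow_average_le hwm hηm hq0 hm00 (by rw [hm0]; exact le_self_add)
      (hR f M h)
  have hFe : F = fun t => K * M * (F t / (K * M)) :=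
    funext fun t => (ENNReal.mul_div_cancel hKM0 hKMT).symm
  rw [hFe]
  refine (luxNorm_const_mul_le hq1 _ hKMT).trans ?_
  refine (mul_le_mul_right (luxNorm_le_of_modular_le_const hq1 (C := L) (by rw [hL]; exact le_add_self)
    hLT hmod) _).trans_eq ?_
  ring

end GaussianBesov

end

noncomputable section

namespace GaussianBesov

/-! ### Finiteness of the Luxemburg norm -/

section Luxemburg

variable {X : Type*} [MeasurableSpace X] {μ : Measure X} {p : X → ℝ}

theorem MemVarLp.varLpNorm_ne_top (hp : ∀ᵐ x ∂μ, 1 ≤ p x) {f : X → ℝ} (hf : MemVarLp μ p f) :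
    varLpNorm μ p f ≠ ⊤ := by
  obtain ⟨-, c, hc0, hc, hm⟩ := hf
  have h1 : luxNorm μ p (fun x => ‖f x‖ₑ / c) ≠ ⊤ :=
    ne_top_of_le_ne_top (by simpa using hm.ne) (luxNorm_le_of_modular_le_const hp
      (le_max_left 1 (modular μ p fun x => ‖f x‖ₑ / c)) (by simpa using hm.ne) (le_max_right _ _))
  refine ne_top_of_le_ne_top (ENNReal.mul_ne_top hc.ne h1)
    ((le_of_eq ?_).trans (luxNorm_const_mul_le hp _ hc.ne))
  simp only [varLpNorm, ENNReal.mul_div_cancel hc0.ne' hc.ne]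

theorem memVarLp_of_varLpNorm_ne_top {f : X → ℝ} (hf : AEMeasurable f μ)
    (h : varLpNorm μ p f ≠ ⊤) : MemVarLp μ p f := by
  obtain ⟨c, ⟨hc0, hc, hm⟩, -⟩ := sInf_lt_iff.1 h.lt_top
  exact ⟨hf, c, hc0, hc, hm.trans_lt ENNReal.one_lt_top⟩

end Luxemburg

variable {d : ℕ} {f g : E d → ℝ} {p : E d → ℝ} {α β : ℝ} {q : ℝ → ℝ}

/-! ### Independence of the representative -/

/-- For `σ > 0` the law in Mehler's formula has a density with respect to `γ_d`, so null sets are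
invisible at every point `x`. -/
theorem ouSemigroup_congr_ae (h : f =ᵐ[gauss d] g) {σ : ℝ} (hσ : 0 < σ) (x : E d) :
    ouSemigroup σ f x = ouSemigroup σ g x := by
  obtain ⟨N, hsub, hN, hN0⟩ := exists_measurable_superset_of_null h
  rw [ouSemigroup_eq, ouSemigroup_eq]
  refine integral_congr_ae ?_
  have hFm : Measurable (N.indicator (1 : E d → ℝ≥0∞)) := measurable_one.indicator hN
  have h0 : ouPos σ (N.indicator 1) x = 0 := by
    refine le_antisymm ((ouPos_le_exp_mul_lintegral hFm hσ x).trans ?_) zero_le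
    rw [lintegral_indicator_one hN, hN0, mul_zero]
  have hm : Measurable fun u : E d =>
      N.indicator (1 : E d → ℝ≥0∞) (ouStd σ • u + Real.exp (-σ) • x) := hFm.comp (by fun_prop)
  filter_upwards [(lintegral_eq_zero_iff hm).1 h0] with u hu
  by_contra hne
  have hmem : ouStd σ • u + Real.exp (-σ) • x ∈ N := hsub hne
  simp [hmem] at hu

theorem poisson_congr_ae (h : f =ᵐ[gauss d] g) {t : ℝ} (ht : 0 < t) (x : E d) :
    poisson t f x = poisson t g x := by
  rw [poisson, poisson]
  congr 1
  refine setIntegral_congr_fun measurableSet_Ioi fun u hu => ?_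
  have hu : 0 < u := hu
  simp only [ouSemigroup_congr_ae h (show 0 < t ^ 2 / (4 * u) by positivity) x]

theorem poissonDeriv_congr_ae (h : f =ᵐ[gauss d] g) (k : ℕ) {t : ℝ} (ht : 0 < t) :
    poissonDeriv k t f = poissonDeriv k t g := by
  funext x
  refine Filter.EventuallyEq.iteratedDeriv_eq k ?_
  filter_upwards [lt_mem_nhds ht] with s hs using poisson_congr_ae h hs x

theorem besovSeminorm_congr_ae (h : f =ᵐ[gauss d] g) (α : ℝ) (p : E d → ℝ) (q : ℝ → ℝ) :
    besovSeminorm α p q f = besovSeminorm α p q g := by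
  refine luxNorm_congr ?_
  filter_upwards [ae_haarPos_pos] with t ht
  rw [poissonDeriv_congr_ae h _ ht]

theorem varLpNorm_congr_ae (h : f =ᵐ[gauss d] g) (p : E d → ℝ) :
    varLpNorm (gauss d) p f = varLpNorm (gauss d) p g := by
  refine luxNorm_congr ?_
  filter_upwards [h] with x hx
  rw [hx]

theorem hermiteCoeff_congr_ae (h : f =ᵐ[gauss d] g) (ν : Fin d → ℕ) :
    hermiteCoeff f ν = hermiteCoeff g ν := by
  refine integral_congr_ae ?_
  filter_upwards [h] with x hx
  rw [hx]

/-- The term `-f` of the operator keeps the value at the point itself, so agreement at `x` is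
required besides agreement almost everywhere. -/
theorem besselDiff_iterate_congr_ae (h : f =ᵐ[gauss d] g) {t : ℝ} (ht : 0 < t) (n : ℕ) {x : E d}
    (hx : f x = g x) : (besselDiff t)^[n] f x = (besselDiff t)^[n] g x := by
  induction n generalizing x with
  | zero => exact hx
  | succ n ih =>
    have hae : (besselDiff t)^[n] f =ᵐ[gauss d] (besselDiff t)^[n] g := by
      filter_upwards [h] with y hy using ih hy
    rw [Function.iterate_succ_apply', Function.iterate_succ_apply', besselDiff, besselDiff, ih hx,
      poisson_congr_ae hae ht]

theorem besselIntegrand_congr_ae (h : f =ᵐ[gauss d] g) (β : ℝ) {x : E d} (hx : f x = g x) :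
    Set.EqOn (besselIntegrand β f x) (besselIntegrand β g x) (Set.Ioi 0) := fun t ht => by
  rw [besselIntegrand, besselIntegrand, besselDiff_iterate_congr_ae h ht _ hx]

theorem besselDeriv_congr_ae (h : f =ᵐ[gauss d] g) (β : ℝ) :
    besselDeriv β f =ᵐ[gauss d] besselDeriv β g := by
  filter_upwards [h] with x hx
  rw [besselDeriv, besselDeriv,
    setIntegral_congr_fun measurableSet_Ioi (besselIntegrand_congr_ae h β hx)]

/-! ### Boundedness of the Bessel fractional derivative -/

theorem besovSeminorm_eq_luxNorm_poissonNorm (hf : Measurable f) (hfi : Integrable f (gauss d))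
    (α : ℝ) (p : E d → ℝ) (q : ℝ → ℝ) :
    besovSeminorm α p q f = luxNorm haarPos q (fun t =>
      ENNReal.ofReal (t ^ ((nextInt α : ℝ) - α)) * poissonNorm p f (nextInt α) t) := by
  refine luxNorm_congr ?_
  filter_upwards [ae_haarPos_pos] with t ht
  rw [poissonNorm, funext fun x => poissonDeriv_eq_poissonD (nextInt α) ht hf hfi x]

/-- The inequality is strict because the infimum defining the Luxemburg norm need not be attained;
it also makes `M` positive when the norm is `0`. -/
theorem BesovBound.of_besovNorm_lt (hp : IsAdmissible p) (hq : ∀ᵐ t ∂haarPos, 1 ≤ q t)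
    (hf : Measurable f) {M : ℝ≥0∞} (hM : M ≠ ⊤) (h : besovNorm α p q f < M) :
    BesovBound α p q f M := by
  have h1 : varLpNorm (gauss d) p f < M := le_self_add.trans_lt h
  have h2 : besovSeminorm α p q f < M := le_add_self.trans_lt h
  refine ⟨hf, (pos_of_gt h).ne', hM, h1.le, ?_⟩
  rw [besovSeminorm_eq_luxNorm_poissonNorm hf (PolyIntegrable.of_luxNorm hp hf h1.ne_top).integrable]
    at h2
  exact modular_le_of_luxNorm_lt hq h2

theorem poissonNorm_const_mul_le (hp : IsAdmissible p) (c : ℝ) (f : E d → ℝ) (j : ℕ) (t : ℝ) :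
    poissonNorm p (fun x => c * f x) j t ≤ ‖c‖ₑ * poissonNorm p f j t := by
  rw [poissonNorm, varLpNorm]
  simp only [poissonD_const_mul, enorm_mul]
  exact luxNorm_const_mul_le hp.ae_one_le _ enorm_ne_top

theorem exists_besovNorm_besselInt_le (hp : IsAdmissible p) (hβ : 0 < β) (hβα : β < α)
    (hq : ExponentZeroInfty q) (c : ℝ) : ∃ C : ℝ≥0, ∀ f : E d → ℝ, ∀ M, BesovBound α p q f M →
      besovNorm (α - β) p q (fun x => c * besselInt β f x) ≤ C * M := by
  have hq1 := ae_haarPos_of_ae hq.ae_one_le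
  obtain ⟨A, hA⟩ := exists_luxNorm_besselAbs_le hp hβ hβα hq1
  obtain ⟨B, hB⟩ := exists_luxNorm_haarPos_besselInt_le (d := d) hp hβ hβα hq
  refine ⟨‖c‖₊ * (A + B), fun f M h => ?_⟩
  have h1 : varLpNorm (gauss d) p (besselInt β f) ≤ A * M :=
    (varLpNorm_besselInt_le hp).trans (hA f M h)
  have hm := measurable_besselInt h.measurable β
  have hint : Integrable (besselInt β f) (gauss d) := (PolyIntegrable.of_luxNorm hp hm
    (ne_top_of_le_ne_top (ENNReal.mul_ne_top ENNReal.coe_ne_top h.ne_top) h1)).integrable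
  have h2 : varLpNorm (gauss d) p (fun x => c * besselInt β f x) ≤ ‖c‖ₑ * (A * M) := by
    rw [varLpNorm]
    simp only [enorm_mul]
    exact (luxNorm_const_mul_le hp.ae_one_le _ enorm_ne_top).trans (mul_le_mul_right h1 _)
  have h3 : besovSeminorm (α - β) p q (fun x => c * besselInt β f x) ≤ ‖c‖ₑ * (B * M) := by
    rw [besovSeminorm_eq_luxNorm_poissonNorm (hm.const_mul c) (hint.const_mul c)]
    refine le_trans ?_ (mul_le_mul_right (hB f M h) _)
    refine le_trans (luxNorm_mono hq1 (.of_forall fun t => ?_))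
      (luxNorm_const_mul_le hq1 _ enorm_ne_top)
    rw [mul_left_comm]
    exact mul_le_mul_right (poissonNorm_const_mul_le hp _ _ _ _) _
  refine (add_le_add h2 h3).trans_eq ?_
  push_cast
  rw [enorm_eq_nnnorm]
  ring

theorem MemBesov.besovNorm_ne_top (hp : IsAdmissible p) (hf : MemBesov α p q f) :
    besovNorm α p q f ≠ ⊤ :=
  ENNReal.add_ne_top.2 ⟨hf.1.varLpNorm_ne_top hp.ae_one_le, hf.2.ne⟩

end GaussianBesov

end

open GaussianBesov

/-- For `f ∈ B^α`, the integral defining `𝒟^β f` converges absolutely almost everywhere,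
`𝒟^β f` is `(I + √(-L))^β f` in the sense of Hermite expansions, it belongs to `B^{α-β}`, and
its norm there is at most `C` times the norm of `f` in `B^α`. -/
theorem mainTheorem3 (d : ℕ) (hd : 1 ≤ d) (α β : ℝ) (hβ : 0 < β) (hβα : β < α)
    (p : E d → ℝ) (hp : GaussExponent p) (hpLH : LocLogHolder p)
    (hp_inf : 1 < expInf (gauss d) p) (hp_sup : expSup (gauss d) p < ⊤)
    (q : ℝ → ℝ) (hq : ExponentZeroInfty q) :
    ∃ C : ℝ≥0, ∀ f : E d → ℝ, MemBesov α p q f →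
      (∀ᵐ x ∂(gauss d), IntegrableOn (besselIntegrand β f x) (Set.Ioi 0)) ∧
      (∀ ν : Fin d → ℕ, hermiteCoeff (besselDeriv β f) ν =
        (1 + Real.sqrt ((∑ i, ν i : ℕ) : ℝ)) ^ β * hermiteCoeff f ν) ∧
      MemBesov (α - β) p q (besselDeriv β f) ∧
      besovNorm (α - β) p q (besselDeriv β f) ≤ C * besovNorm α p q f := by
  have hpa := isAdmissible_of hp hpLH hp_inf
  have hq1 := ae_haarPos_of_ae hq.ae_one_le
  obtain ⟨A, hA⟩ := exists_luxNorm_besselAbs_le hpa hβ hβα hq1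
  obtain ⟨C, hC⟩ := exists_besovNorm_besselInt_le hpa hβ hβα hq (1 / besselConst β)
  refine ⟨C, fun f hf => ?_⟩
  have hc := besselConst_ne_zero hβ
  -- A Borel representative is needed for the joint measurability arguments; every quantity in the
  -- conclusion is unchanged up to a null set.
  set g := hf.1.1.mk f with hg
  have hgm : Measurable g := hf.1.1.measurable_mk
  have hfg : f =ᵐ[gauss d] g := hf.1.1.ae_eq_mk
  have hnorm : besovNorm α p q f = besovNorm α p q g := by
    rw [besovNorm, besovNorm, varLpNorm_congr_ae hfg, besovSeminorm_congr_ae hfg]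
  have hfin := hf.besovNorm_ne_top hpa
  have hbound : ∀ M, besovNorm α p q f < M → M ≠ ⊤ → BesovBound α p q g M :=
    fun M hM hMt => .of_besovNorm_lt hpa hq1 hgm hMt (hnorm ▸ hM)
  obtain ⟨M₀, hM₀, hM₀t⟩ := exists_between hfin.lt_top
  have hb₀ := hbound M₀ hM₀ hM₀t.ne
  have hgp : PolyIntegrable g := hb₀.polyIntegrable hpa
  have hN : luxNorm (gauss d) p (besselAbs β g) ≠ ⊤ :=
    ne_top_of_le_ne_top (ENNReal.mul_ne_top ENNReal.coe_ne_top hM₀t.ne) (hA g M₀ hb₀)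
  have hD : besselDeriv β f =ᵐ[gauss d] fun x => 1 / besselConst β * besselInt β g x :=
    (besselDeriv_congr_ae hfg β).trans (.of_forall fun x => besselDeriv_eq hgp β x)
  have hDnorm : besovNorm (α - β) p q (besselDeriv β f) ≤ C * besovNorm α p q f := by
    rw [besovNorm, varLpNorm_congr_ae hD, besovSeminorm_congr_ae hD, ← besovNorm]
    -- The estimate is available for each finite `M` above the norm of `f`; letting `M` decrease to
    -- the norm gives the stated inequality.
    have hne : (𝓝[>] besovNorm α p q f).NeBot := nhdsGT_neBot_of_exists_gt ⟨M₀, hM₀⟩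
    have hlim : Tendsto (fun M : ℝ≥0∞ => C * M) (𝓝[>] besovNorm α p q f)
        (𝓝 (C * besovNorm α p q f)) :=
      ENNReal.Tendsto.const_mul (tendsto_id.mono_left nhdsWithin_le_nhds)
        (.inr ENNReal.coe_ne_top)
    refine ge_of_tendsto hlim ?_
    filter_upwards [Ioo_mem_nhdsGT hM₀] with M hM
    exact hC g M (hbound M hM.1 (hM.2.trans hM₀t).ne)
  have hDfin : besovNorm (α - β) p q (besselDeriv β f) ≠ ⊤ :=
    ne_top_of_le_ne_top (ENNReal.mul_ne_top ENNReal.coe_ne_top hfin) hDnorm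
  refine ⟨?_, fun ν => ?_, ⟨memVarLp_of_varLpNorm_ne_top ?_ ?_, ?_⟩, hDnorm⟩
  · filter_upwards [ae_besselAbs_ne_top hpa hgm hN, hfg] with x hx hfx
    exact (integrableOn_besselIntegrand hgp hx).congr_fun
      (besselIntegrand_congr_ae hfg β hfx).symm measurableSet_Ioi
  · rw [hermiteCoeff_congr_ae hD, hermiteCoeff_congr_ae hfg]
    have h1 : hermiteCoeff (fun x => 1 / besselConst β * besselInt β g x) ν =
        1 / besselConst β * hermiteCoeff (besselInt β g) ν := by
      simp only [hermiteCoeff, mul_assoc]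
      exact integral_const_mul _ _
    rw [h1, hermiteCoeff_besselInt hpa hgp hN]
    field_simp
  · exact ((measurable_besselInt hgm β).const_mul _).aemeasurable.congr hD.symm
  · exact (ENNReal.add_ne_top.1 hDfin).1
  · exact (ENNReal.add_ne_top.1 hDfin).2.lt_top
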